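/- Let $g$ be a smooth $U(n)$-invariant Kähler metric on $\mathbb C^n$ (with its standard complex structure) which is a steady gradient Ricci soliton, i.e. $\mathrm{Ric}(g)=\nabla^2 f$ for some smooth real function $f$ on $\mathbb C^n$, and suppose that $g$ is not flat. Then $g$ is collapsed: there is no $\kappa>0$ such that $\mathrm{vol}(B(p,r))\ge\kappa r^{2n}$ for all $p\in\mathbb C^n$ and all $r>0$ satisfying $|\mathrm{Rm}(q)|\le r^{-2}$ for every $q\in B(p,r)$. Here $B(p,r)$ is the open geodesic ball and $|\mathrm{Rm}|$ is the norm of the Riemann curvature tensor. Moreover, let $\rho(x)$ be the distance from $0$ to $x$ for the Riemannian metric $g=\mathrm{Re}\,(g_{i\bar j}\,dz_i\otimes d\bar z_j)$, and let $R=g^{i\bar j}R_{i\bar j}$ with $R_{i\bar j}=-\partial_i\partial_{\bar j}\log\det(g_{k\bar l})$; this $R$ is one quarter of the Riemannian scalar curvature. Then $$R(x)\,\rho(x)\longrightarrow \frac{\sqrt{R(0)}\,(n-1)}{2}\qquad\text{as }|x|\to\infty .$$ In particular, if $g$ is scaled so that $R(0)=n$, the limit is $\tfrac12\sqrt n\,(n-1)$.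 -/

import Mathlib

open scoped ContDiff ENNReal Topology Matrix

noncomputable section

/-- Complex Euclidean space `ℂⁿ` with its standard holomorphic coordinates. Only its topology and
its smooth and complex linear structures are used below: lengths, volumes and curvatures are those
of a Riemannian metric. -/
abbrev CSpace (n : ℕ) : Type := Fin n → ℂ

/-- A smooth Riemannian metric on the manifold `ℂⁿ` (of real dimension `2n`); the tangent space at
each point is identified with `ℂⁿ`. -/
structure RMetric (n : ℕ) where
  /-- The inner product on the tangent space at `x`. -/
  val : CSpace n → CSpace n →L[ℝ] CSpace n →L[ℝ] ℝ
  symm : ∀ x u v, val x u v = val x v u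
  pos : ∀ x u, u ≠ 0 → 0 < val x u u
  smooth : ContDiff ℝ ∞ val

namespace RMetric

variable {n : ℕ} (g : RMetric n)

/-! ### Length, distance, volume -/

/-- The length of the path `γ` restricted to `[0, 1]`. -/
def pathLength (γ : ℝ → CSpace n) : ℝ≥0∞ :=
  ∫⁻ t in Set.Icc (0 : ℝ) 1, ENNReal.ofReal √(g.val (γ t) (deriv γ t) (deriv γ t))

/-- The Riemannian distance: the infimum of the lengths of the `C¹` paths from `p` to `q`. -/
def eDist (p q : CSpace n) : ℝ≥0∞ :=
  ⨅ (γ : ℝ → CSpace n) (_ : ContDiff ℝ 1 γ) (_ : γ 0 = p) (_ : γ 1 = q), g.pathLength γ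

/-- The Riemannian distance as a real number. -/
def distance (p q : CSpace n) : ℝ := (g.eDist p q).toReal

/-- The open geodesic ball `B(p, r)`. -/
def ball (p : CSpace n) (r : ℝ) : Set (CSpace n) := {q | g.eDist p q < ENNReal.ofReal r}

/-- The index type of the `2n` real coordinates of `ℂⁿ`. -/
abbrev RIndex (n : ℕ) : Type := Σ _ : Fin n, Fin 2

/-- The real coordinate basis `∂/∂x₁, ∂/∂y₁, …, ∂/∂xₙ, ∂/∂yₙ`. -/
def stdBasis (n : ℕ) : Module.Basis (RIndex n) ℝ (CSpace n) :=
  Pi.basis fun _ : Fin n => Complex.basisOneI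

/-- The matrix `(g_{ab})` of the metric in the real coordinate basis. -/
def gram (x : CSpace n) : Matrix (RIndex n) (RIndex n) ℝ :=
  Matrix.of fun a b => g.val x (stdBasis n a) (stdBasis n b)

/-- The Riemannian volume measure `√det(g_{ab}) dx₁ dy₁ ⋯ dxₙ dyₙ`. -/
def vol : MeasureTheory.Measure (CSpace n) :=
  MeasureTheory.volume.withDensity fun x => ENNReal.ofReal √(g.gram x).det

/-! ### Levi-Civita connection and curvature -/

/-- The covector `w ↦ ½ (∂ᵤ g(v, w) + ∂ᵥ g(u, w) - ∂_w g(u, v))` at `x`, for constant vector fields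
`u, v, w`. -/
def koszul (x u v : CSpace n) : CSpace n →L[ℝ] ℝ :=
  (1 / 2 : ℝ) • (fderiv ℝ g.val x u v + fderiv ℝ g.val x v u
    - ((fderiv ℝ g.val x).flip u).flip v)

/-- The Christoffel symbol `Γₓ(u, v)`, i.e. the value at `x` of the Levi-Civita derivative `∇ᵤ v` of
the constant vector field `v`; it is the vector dual to `koszul x u v` under `g`. -/
def christoffel (x u v : CSpace n) : CSpace n := (g.val x).inverse (g.koszul x u v)

/-- The curvature `R(u, v) w = ∇ᵤ ∇ᵥ w - ∇ᵥ ∇ᵤ w`, for constant vector fields `u, v, w`. -/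
def curv (x u v w : CSpace n) : CSpace n :=
  fderiv ℝ (fun y => g.christoffel y v w) x u - fderiv ℝ (fun y => g.christoffel y u w) x v
    + g.christoffel x u (g.christoffel x v w) - g.christoffel x v (g.christoffel x u w)

/-- The curvature tensor with four lower indices, `Rm(u, v, w, z) = g(R(u, v) w, z)`. -/
def rm (x u v w z : CSpace n) : ℝ := g.val x (g.curv x u v w) z

/-- The norm of the curvature tensor:
`|Rm|² = g^{aa'} g^{bb'} g^{cc'} g^{dd'} Rm_{abcd} Rm_{a'b'c'd'}`. -/
def rmNorm (x : CSpace n) : ℝ :=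
  √(∑ a, ∑ b, ∑ c, ∑ d, ∑ a', ∑ b', ∑ c', ∑ d',
    (g.gram x)⁻¹ a a' * (g.gram x)⁻¹ b b' * (g.gram x)⁻¹ c c' * (g.gram x)⁻¹ d d' *
      g.rm x (stdBasis n a) (stdBasis n b) (stdBasis n c) (stdBasis n d) *
      g.rm x (stdBasis n a') (stdBasis n b') (stdBasis n c') (stdBasis n d'))

/-- The Ricci tensor `Ric(u, v) = tr (w ↦ R(w, u) v)`. -/
def ric (x u v : CSpace n) : ℝ :=
  ∑ a, (stdBasis n).repr (g.curv x (stdBasis n a) u v) a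

/-- The Riemannian scalar curvature `g^{ab} Ric_{ab}`. -/
def scal (x : CSpace n) : ℝ :=
  ∑ a, ∑ b, (g.gram x)⁻¹ a b * g.ric x (stdBasis n a) (stdBasis n b)

/-- The scalar curvature `R = g^{ij̄} R_{ij̄}` in the normalization of Kähler geometry. For a Kähler
metric `g = Re (g_{ij̄} dzᵢ ⊗ dz̄ⱼ)`, with `R_{ij̄} = -∂ᵢ∂_{j̄} log det (g_{kl̄})`, it is one quarter of
the Riemannian scalar curvature. -/
def kahlerScal (x : CSpace n) : ℝ := g.scal x / 4

/-- The Hessian `∇²f(u, v)`. -/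
def hess (f : CSpace n → ℝ) (x u v : CSpace n) : ℝ :=
  fderiv ℝ (fun y => fderiv ℝ f y v) x u - fderiv ℝ f x (g.christoffel x u v)

/-! ### The classes of metrics -/

/-- `g` is flat if its curvature tensor vanishes identically. -/
def IsFlat : Prop := ∀ x u v w, g.curv x u v w = 0

/-- `g` is Kähler for the standard complex structure `J = i`: `g` is Hermitian, and its
fundamental form `ω(u, v) = g(Ju, v)` is closed. -/
structure IsKahler : Prop where
  hermitian : ∀ x u v,
    g.val x (Complex.I • u) (Complex.I • v) = g.val x u v
  closed : ∀ x u v w,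
    fderiv ℝ g.val x u (Complex.I • v) w + fderiv ℝ g.val x v (Complex.I • w) u
      + fderiv ℝ g.val x w (Complex.I • u) v = 0

/-- `g` is `U(n)`-symmetric: every unitary transformation of `ℂⁿ` is an isometry of `g`. -/
def IsUnitaryInvariant : Prop :=
  ∀ U ∈ Matrix.unitaryGroup (Fin n) ℂ, ∀ x u v,
    g.val (U *ᵥ x) (U *ᵥ u) (U *ᵥ v) = g.val x u v

/-- `g` is a steady gradient Ricci soliton: `Ric = ∇²f` for some smooth function `f`. -/
def IsSteadyGradientSoliton : Prop :=
  ∃ f : CSpace n → ℝ, ContDiff ℝ ∞ f ∧ ∀ x u v, g.ric x u v = g.hess f x u v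

/-- `g` is noncollapsed with constant `κ`: for every `p` and `r > 0` with `|Rm| ≤ r⁻²` on `B(p, r)`,
one has `vol B(p, r) ≥ κ r²ⁿ` (`2n` is the real dimension). -/
def IsNoncollapsedWith (κ : ℝ) : Prop :=
  ∀ (p : CSpace n) (r : ℝ), 0 < r → (∀ q ∈ g.ball p r, g.rmNorm q ≤ (r ^ 2)⁻¹) →
    ENNReal.ofReal (κ * r ^ (2 * n)) ≤ g.vol (g.ball p r)

/-- `g` is collapsed if it is not noncollapsed with any positive constant. -/
def IsCollapsed : Prop := ¬ ∃ κ : ℝ, 0 < κ ∧ g.IsNoncollapsedWith κ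

end RMetric

end

namespace RMetric

noncomputable section

open Filter ComplexConjugate

variable {n : ℕ}

/-! ### The standard Hermitian form -/

/-! Put `s = |x|²`. Unitary symmetry forces `g_x(x,u) = D(s) Re⟨x,u⟩`, and closedness of the
fundamental form then determines the whole metric: with `φ' = D`, `φ(0) = 0`, the metric is `φ/s` on
the Hermitian complement of the complex line of `x` and `D` on that line (`exists_hasProfile`). Here
`φ` is the moment map of the circle action. The Christoffel symbol, the curvature, the Ricci tensor
and the volume density `(φ/s)^(n-1) D` become explicit in `D` and `φ`.

The potential `f` is not assumed invariant. Instead of averaging it, one picks a point on a unit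
circle where the rotational derivative of `f` is maximal; along the ray through it `f` obeys the
equations of a radial potential. Integrating them twice gives (`soliton_ode`) a constant `a` with
`φ^(n-1) D exp(aφ) = D(0)^n s^(n-1)`. If `a < 0`, `φ` would blow up at a finite `s`; if `a = 0`, the
metric is flat. Hence `a > 0`.

In Kähler normalization `R = a(n - aψ)` with `ψ = sD`, so `R(0) = an`. The quantity `s^n (n - aψ)/ψ`
has derivative `n(n-1)s^(n-1)/φ ≥ 0`, which gives `0 < ψ < n/a`. Then `φ → ∞`, and L'Hôpital's rule
yields `(n - aψ)φ/ψ → n-1` (`scal_mul_moment_tendsto`); so `ψ → n/a` and `φ ~ (n/a) log s`.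

Distance to the origin: `dφ = 2g(x,·)` and `g(x,x) = ψ < n/a`, so `φ` is Lipschitz with constant
`2√(n/a)`; this bounds the distance below by `φ/(2√(n/a))`. The straight ray bounds it above by a
length asymptotic to the same quantity. Multiplying by `R ~ n(n-1)/φ` gives the limit
`√(an)(n-1)/2`.

Collapse: the curvature is `O(1/φ)` (`curvBound_le`), so around a point with `φ = M` a ball of
radius `δ√M` is admissible for a small fixed `δ`. By the Lipschitz bound it lies in the annulus `|φ
- M| < O(√M)`. The volume of an annulus is a multiple of the increment of `φ^n`
(`exists_vol_annulus`), here `o(M^n)`, whereas noncollapsing would require a multiple of `M^n`. -/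

/-- The standard Hermitian form of `ℂⁿ`, conjugate linear in the first variable. -/
def herm (u v : CSpace n) : ℂ := ∑ i, conj (u i) * v i

/-- The square of the standard Hermitian norm of `ℂⁿ`. -/
def nsq (x : CSpace n) : ℝ := (herm x x).re

lemma herm_add_left (u v w : CSpace n) : herm (u + v) w = herm u w + herm v w := by
  simp [herm, add_mul, Finset.sum_add_distrib]

lemma herm_add_right (u v w : CSpace n) : herm u (v + w) = herm u v + herm u w := by
  simp [herm, mul_add, Finset.sum_add_distrib]

lemma herm_smul_left (c : ℂ) (u v : CSpace n) : herm (c • u) v = conj c * herm u v := by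
  simp [herm, Finset.mul_sum, mul_assoc]

lemma herm_smul_right (c : ℂ) (u v : CSpace n) : herm u (c • v) = c * herm u v := by
  simp only [herm, Finset.mul_sum, Pi.smul_apply, smul_eq_mul]
  exact Finset.sum_congr rfl fun i _ => by ring

lemma real_smul_eq (c : ℝ) (u : CSpace n) : c • u = (c : ℂ) • u := by
  ext i; simp

lemma herm_rsmul_left (c : ℝ) (u v : CSpace n) : herm (c • u) v = c * herm u v := by
  rw [real_smul_eq, herm_smul_left, Complex.conj_ofReal]

lemma herm_rsmul_right (c : ℝ) (u v : CSpace n) : herm u (c • v) = c * herm u v := by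
  rw [real_smul_eq, herm_smul_right]

lemma herm_neg_left (u v : CSpace n) : herm (-u) v = -herm u v := by simp [herm]

lemma herm_neg_right (u v : CSpace n) : herm u (-v) = -herm u v := by simp [herm]

lemma herm_sub_left (u v w : CSpace n) : herm (u - v) w = herm u w - herm v w := by
  rw [sub_eq_add_neg, herm_add_left, herm_neg_left, sub_eq_add_neg]

lemma herm_sub_right (u v w : CSpace n) : herm u (v - w) = herm u v - herm u w := by
  rw [sub_eq_add_neg, herm_add_right, herm_neg_right, sub_eq_add_neg]

lemma herm_zero_left (u : CSpace n) : herm 0 u = 0 := by simp [herm]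

lemma herm_conj (u v : CSpace n) : conj (herm u v) = herm v u := by
  simp only [herm, map_sum, map_mul, Complex.conj_conj]
  exact Finset.sum_congr rfl fun i _ => by ring

lemma herm_swap_re (u v : CSpace n) : (herm u v).re = (herm v u).re := by
  rw [← herm_conj v u, Complex.conj_re]

lemma herm_swap_im (u v : CSpace n) : (herm u v).im = -(herm v u).im := by
  rw [← herm_conj v u, Complex.conj_im]

lemma nsq_eq_sum (x : CSpace n) : nsq x = ∑ i, Complex.normSq (x i) := by
  simp only [nsq, herm, Complex.re_sum]
  exact Finset.sum_congr rfl fun i _ => by simp [Complex.normSq_apply]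

lemma nsq_nonneg (x : CSpace n) : 0 ≤ nsq x := by
  rw [nsq_eq_sum]; exact Finset.sum_nonneg fun i _ => Complex.normSq_nonneg _

lemma herm_self (x : CSpace n) : herm x x = (nsq x : ℂ) := by
  apply Complex.ext
  · rfl
  · have := herm_swap_im x x
    simp only [Complex.ofReal_im]; linarith

lemma nsq_zero : nsq (0 : CSpace n) = 0 := by simp [nsq, herm_zero_left]

lemma nsq_pos {x : CSpace n} (hx : x ≠ 0) : 0 < nsq x := by
  obtain ⟨i, hi⟩ := Function.ne_iff.1 hx
  rw [nsq_eq_sum]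
  exact Finset.sum_pos' (fun i _ => Complex.normSq_nonneg _)
    ⟨i, Finset.mem_univ _, Complex.normSq_pos.2 hi⟩

lemma nsq_smul (c : ℂ) (x : CSpace n) : nsq (c • x) = Complex.normSq c * nsq x := by
  have h : herm (c • x) (c • x) = (Complex.normSq c * nsq x : ℝ) := by
    rw [herm_smul_left, herm_smul_right, herm_self, ← mul_assoc, ← Complex.normSq_eq_conj_mul_self]
    push_cast; ring
  rw [nsq, h, Complex.ofReal_re]

lemma nsq_rsmul (c : ℝ) (x : CSpace n) : nsq (c • x) = c ^ 2 * nsq x := by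
  rw [real_smul_eq, nsq_smul, Complex.normSq_ofReal, sq]

lemma nsq_add_smul (x u : CSpace n) (τ : ℝ) :
    nsq (x + τ • u) = nsq x + τ * (2 * (herm x u).re) + τ ^ 2 * nsq u := by
  simp only [nsq, herm_add_left, herm_add_right, herm_rsmul_left, herm_rsmul_right, Complex.add_re,
    Complex.re_ofReal_mul, herm_swap_re u x]
  ring

lemma normSq_herm_le (u v : CSpace n) : Complex.normSq (herm u v) ≤ nsq u * nsq v := by
  rcases eq_or_ne u 0 with rfl | hu
  · simp [herm_zero_left, nsq_zero]
  have hs := nsq_pos hu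
  have h := nsq_nonneg ((nsq u) • v - herm u v • u)
  have e : nsq ((nsq u) • v - herm u v • u)
      = nsq u * (nsq u * nsq v - Complex.normSq (herm u v)) := by
    rw [nsq]
    simp only [herm_sub_left, herm_sub_right, herm_rsmul_left, herm_rsmul_right, herm_smul_left,
      herm_smul_right]
    rw [herm_self, herm_self, ← herm_conj u v]
    simp [Complex.normSq_apply]
    ring
  rw [e] at h
  nlinarith [nonneg_of_mul_nonneg_right h hs]

/-! ### Unitary transformations -/

/-- The matrix of the reflection in the complex hyperplane orthogonal to `v`. -/
def householder (v : CSpace n) : Matrix (Fin n) (Fin n) ℂ :=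
  1 - (2 / nsq v : ℂ) • Matrix.vecMulVec v (star v)

lemma householder_mulVec (v x : CSpace n) :
    householder v *ᵥ x = x - (2 / nsq v * herm v x : ℂ) • v := by
  have h : star v ⬝ᵥ x = herm v x := by simp [dotProduct, herm]
  rw [householder, Matrix.sub_mulVec, Matrix.one_mulVec, Matrix.smul_mulVec,
    Matrix.vecMulVec_mulVec, h]
  ext i
  simp
  ring

lemma mem_unitaryGroup_of_nsq {U : Matrix (Fin n) (Fin n) ℂ}
    (h : ∀ u v, herm (U *ᵥ u) (U *ᵥ v) = herm u v) : U ∈ Matrix.unitaryGroup (Fin n) ℂ := by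
  rw [Matrix.mem_unitaryGroup_iff']
  ext i j
  have := h (Pi.single i 1) (Pi.single j 1)
  simp only [Matrix.mulVec_single_one] at this
  rw [Matrix.mul_apply]
  simp only [herm, Matrix.col_apply] at this
  simp only [Matrix.star_apply, RCLike.star_def, this]
  simp [Pi.single_apply, Matrix.one_apply, eq_comm]

lemma householder_mem {v : CSpace n} (hv : v ≠ 0) :
    householder v ∈ Matrix.unitaryGroup (Fin n) ℂ := by
  have hs : (nsq v : ℂ) ≠ 0 := by exact_mod_cast (nsq_pos hv).ne'
  refine mem_unitaryGroup_of_nsq fun a b => ?_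
  simp only [householder_mulVec, herm_sub_left, herm_sub_right, herm_smul_left, herm_smul_right,
    herm_self, map_mul, map_div₀, Complex.conj_ofReal, herm_conj]
  simp only [map_ofNat]
  field_simp
  ring

lemma smul_one_mem {c : ℂ} (hc : Complex.normSq c = 1) :
    c • (1 : Matrix (Fin n) (Fin n) ℂ) ∈ Matrix.unitaryGroup (Fin n) ℂ := by
  refine mem_unitaryGroup_of_nsq fun a b => ?_
  rw [Matrix.smul_mulVec, Matrix.smul_mulVec, Matrix.one_mulVec, Matrix.one_mulVec,
    herm_smul_left, herm_smul_right, ← mul_assoc, ← Complex.normSq_eq_conj_mul_self, hc]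
  simp

/-- The unitary group acts transitively on spheres. -/
lemma exists_unitary {x y : CSpace n} (h : nsq x = nsq y) :
    ∃ U ∈ Matrix.unitaryGroup (Fin n) ℂ, U *ᵥ x = y := by
  -- A phase `c` making `⟨y, cx⟩` real: only then does the complex reflection along `cx - y` carry
  -- `cx` to `y`.
  obtain ⟨c, hc, hr⟩ : ∃ c : ℂ, Complex.normSq c = 1 ∧ (c * herm y x).im = 0 := by
    rcases eq_or_ne (herm y x) 0 with h0 | h0
    · exact ⟨1, by simp, by simp [h0]⟩
    · have hn : (‖herm y x‖ : ℂ) ≠ 0 := by simpa using h0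
      refine ⟨conj (herm y x) / ‖herm y x‖, ?_, ?_⟩
      · rw [map_div₀, Complex.normSq_conj, Complex.normSq_ofReal, Complex.normSq_eq_norm_sq, sq]
        have : ‖herm y x‖ ≠ 0 := by simpa using h0
        field_simp
      · rw [div_mul_eq_mul_div, ← Complex.normSq_eq_conj_mul_self, ← Complex.ofReal_div]
        simp
  have hcx : (c • (1 : Matrix (Fin n) (Fin n) ℂ)) *ᵥ x = c • x := by
    rw [Matrix.smul_mulVec, Matrix.one_mulVec]
  by_cases hv : c • x - y = 0
  · exact ⟨_, smul_one_mem hc, by rw [hcx, sub_eq_zero.1 hv]⟩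
  refine ⟨householder (c • x - y) * (c • 1),
    mul_mem (householder_mem hv) (smul_one_mem hc), ?_⟩
  rw [← Matrix.mulVec_mulVec, hcx, householder_mulVec]
  have hs : (nsq (c • x - y) : ℂ) ≠ 0 := by exact_mod_cast (nsq_pos hv).ne'
  have h1 : herm y (c • x) = ((c * herm y x).re : ℂ) := by
    rw [herm_smul_right]; apply Complex.ext <;> simp [hr]
  have h2 : herm (c • x) y = ((c * herm y x).re : ℂ) := by
    rw [← herm_conj, h1, Complex.conj_ofReal]
  have h3 : herm (c • x) (c • x) = (nsq y : ℂ) := by rw [herm_self, nsq_smul, hc, one_mul, h]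
  have h4 : (2 / nsq (c • x - y) * herm (c • x - y) (c • x) : ℂ) = 1 := by
    rw [div_mul_eq_mul_div, div_eq_one_iff_eq hs, ← herm_self]
    simp only [herm_sub_left, herm_sub_right, h1, h2, h3, herm_self y]
    ring
  rw [h4, one_smul, sub_sub_cancel]

end

end RMetric

namespace RMetric

noncomputable section

open Filter ComplexConjugate

variable {n : ℕ}

/-! ### Radial profile of an invariant Kähler metric -/

lemma nsq_line_hasDerivAt (x u : CSpace n) :
    HasDerivAt (fun τ : ℝ => nsq (x + τ • u)) (2 * (herm x u).re) 0 := by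
  simp only [nsq_add_smul]
  have h := ((((hasDerivAt_id' (0 : ℝ)).mul_const (2 * (herm x u).re)).const_add (nsq x)).fun_add
    (((hasDerivAt_id' (0 : ℝ)).fun_pow 2).mul_const (nsq u)))
  simpa using h

lemma herm_line_hasDerivAt (x u v : CSpace n) :
    HasDerivAt (fun τ : ℝ => herm (x + τ • u) v) (herm u v) 0 := by
  simp only [herm_add_left, herm_rsmul_left]
  have h := (((hasDerivAt_id (0 : ℝ)).ofReal_comp).mul_const (herm u v)).const_add (herm x v)
  simpa using h

lemma line_hasDerivAt (x u : CSpace n) (t : ℝ) :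
    HasDerivAt (fun τ : ℝ => x + τ • u) u t := by
  simpa using ((hasDerivAt_id t).smul_const u).const_add x

lemma hasDerivAt_re {f : ℝ → ℂ} {f' : ℂ} {t : ℝ} (h : HasDerivAt f f' t) :
    HasDerivAt (fun τ => (f τ).re) f'.re t :=
  Complex.reCLM.hasFDerivAt.comp_hasDerivAt t h

lemma hasDerivAt_im {f : ℝ → ℂ} {f' : ℂ} {t : ℝ} (h : HasDerivAt f f' t) :
    HasDerivAt (fun τ => (f τ).im) f'.im t :=
  Complex.imCLM.hasFDerivAt.comp_hasDerivAt t h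

lemma hasDerivAt_conj {f : ℝ → ℂ} {f' : ℂ} {t : ℝ} (h : HasDerivAt f f' t) :
    HasDerivAt (fun τ => conj (f τ)) (conj f') t :=
  (Complex.conjCLE : ℂ →L[ℝ] ℂ).hasFDerivAt.comp_hasDerivAt t h

lemma line_eventually_ne {x : CSpace n} (hx : x ≠ 0) (u : CSpace n) :
    ∀ᶠ τ : ℝ in 𝓝 0, x + τ • u ≠ 0 := by
  have h : ContinuousAt (fun τ : ℝ => x + τ • u) 0 := (line_hasDerivAt x u 0).continuousAt
  exact h.eventually_ne (by simpa using hx)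

variable (g : RMetric n)

lemma val_differentiable : Differentiable ℝ g.val :=
  g.smooth.differentiable (by simp)

lemma val_comp_hasDerivAt {γ : ℝ → CSpace n} {γ' : CSpace n} {t : ℝ} (h : HasDerivAt γ γ' t) :
    HasDerivAt (fun τ => g.val (γ τ)) (fderiv ℝ g.val (γ t) γ') t :=
  HasFDerivAt.comp_hasDerivAt (l := g.val) t (g.val_differentiable (γ t)).hasFDerivAt h

lemma val_hasDerivAt {γ : ℝ → CSpace n} {γ' : CSpace n} {t : ℝ} (h : HasDerivAt γ γ' t)
    (u v : CSpace n) :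
    HasDerivAt (fun τ => g.val (γ τ) u v) (fderiv ℝ g.val (γ t) γ' u v) t := by
  have h2 := (g.val_comp_hasDerivAt h).clm_apply (hasDerivAt_const t u)
  have h3 := h2.clm_apply (hasDerivAt_const t v)
  simpa using h3

lemma val_line_hasDerivAt (x a u v : CSpace n) :
    HasDerivAt (fun τ : ℝ => g.val (x + τ • a) u v) (fderiv ℝ g.val x a u v) 0 := by
  simpa using g.val_hasDerivAt (line_hasDerivAt x a 0) u v

/-- The radial data of a `U(n)`-invariant Kähler metric: the functions of `s = |x|²` by which the
metric is determined, `D` being the coefficient of the metric in the radial direction and `φ` the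
moment map of the circle action. -/
structure HasProfile (D D₁ D₂ φ : ℝ → ℝ) : Prop where
  cont : Continuous D
  pos : ∀ s, 0 < D s
  -- Differentiability is asked only for `s > 0`: the profile is obtained by evaluating the metric
  -- at `√s • e`, and `√` is not smooth at `0`. Continuity at `0` suffices later.
  deriv₁ : ∀ s, 0 < s → HasDerivAt D (D₁ s) s
  deriv₂ : ∀ s, 0 < s → HasDerivAt D₁ (D₂ s) s
  moment : ∀ s, HasDerivAt φ (D s) s
  moment_zero : φ 0 = 0
  radial : ∀ x u, g.val x x u = D (nsq x) * (herm x u).re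
  formula : ∀ x, x ≠ 0 → ∀ u v, g.val x u v = φ (nsq x) / nsq x * (herm u v).re
    + (D (nsq x) - φ (nsq x) / nsq x) / nsq x * (conj (herm x u) * herm x v).re

variable {g}

lemma val_self_I (hK : g.IsKahler) (x u : CSpace n) : g.val x u (Complex.I • u) = 0 := by
  have h := hK.hermitian x u (Complex.I • u)
  rw [smul_smul, Complex.I_mul_I, neg_one_smul, map_neg, g.symm x (Complex.I • u) u] at h
  linarith

/-- The radial coefficient of the metric along the unit vector `e`. -/
def prof (g : RMetric n) (e : CSpace n) (s : ℝ) : ℝ := g.val (√s • e) e e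

lemma val_self_eq (hU : g.IsUnitaryInvariant) {e : CSpace n} (he : nsq e = 1) (x : CSpace n) :
    g.val x x x = prof g e (nsq x) * nsq x := by
  have h1 : nsq (√(nsq x) • e) = nsq x := by
    rw [nsq_rsmul, he, mul_one, Real.sq_sqrt (nsq_nonneg x)]
  obtain ⟨U, hU1, hU2⟩ := exists_unitary h1
  have h := hU U hU1 (√(nsq x) • e) (√(nsq x) • e) (√(nsq x) • e)
  rw [hU2] at h
  rw [h, prof]
  simp only [map_smul, smul_apply, smul_eq_mul]
  rw [← mul_assoc, Real.mul_self_sqrt (nsq_nonneg x), mul_comm]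

/-- The reflection along `x` fixes `u`, so `g_x(x,u) = g_{-x}(-x,u)`; the isometry `-1` turns the
right side into `g_x(x,-u)`. -/
lemma val_orthogonal (hU : g.IsUnitaryInvariant) {x u : CSpace n} (hx : x ≠ 0)
    (h : herm x u = 0) : g.val x x u = 0 := by
  have hs : (nsq x : ℂ) ≠ 0 := by exact_mod_cast (nsq_pos hx).ne'
  have h1 := hU _ (householder_mem hx) x x u
  have e1 : householder x *ᵥ x = -x := by
    rw [householder_mulVec, herm_self, div_mul_cancel₀ _ hs, two_smul]; abel
  have e2 : householder x *ᵥ u = u := by rw [householder_mulVec, h]; simp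
  rw [e1, e2] at h1
  have h2 := hU ((-1 : ℂ) • 1) (smul_one_mem (by simp)) (-x) (-x) u
  have e3 : ∀ w : CSpace n, ((-1 : ℂ) • (1 : Matrix (Fin n) (Fin n) ℂ)) *ᵥ w = -w := fun w => by
    rw [Matrix.smul_mulVec, Matrix.one_mulVec, neg_one_smul]
  simp only [e3, neg_neg, map_neg, neg_apply] at h1 h2
  linarith

/-- Split `u` into real multiples of `x` and `ix` and a part orthogonal to both. The last is killed
by the reflection argument and `ix` by the Hermitian condition. -/
lemma val_radial (hK : g.IsKahler) (hU : g.IsUnitaryInvariant) {e : CSpace n} (he : nsq e = 1)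
    (x u : CSpace n) : g.val x x u = prof g e (nsq x) * (herm x u).re := by
  rcases eq_or_ne x 0 with rfl | hx
  · simp [herm_zero_left]
  have hs := (nsq_pos hx).ne'
  set c : ℂ := herm x u / nsq x with hc
  have h0 : herm x (u - c • x) = 0 := by
    rw [herm_sub_right, herm_smul_right, herm_self, hc,
      div_mul_cancel₀ _ (by exact_mod_cast hs), sub_self]
  have h1 := val_orthogonal hU hx h0
  have h2 : c • x = c.re • x + c.im • (Complex.I • x) := by
    ext i
    simp only [Pi.smul_apply, Pi.add_apply, smul_eq_mul, Complex.real_smul]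
    nth_rw 1 [← Complex.re_add_im c]; ring
  have h3 : g.val x x u = g.val x x (c • x) := by
    rw [map_sub, sub_eq_zero] at h1; exact h1
  rw [h3, h2, map_add, map_smul, map_smul, val_self_I hK, val_self_eq hU he, hc,
    Complex.div_ofReal_re]
  simp only [smul_eq_mul, mul_zero, add_zero]
  field_simp

lemma continuous_val_apply (g : RMetric n) : Continuous fun p : CSpace n × CSpace n × CSpace n =>
    g.val p.1 p.2.1 p.2.2 := by
  have := g.smooth.continuous
  fun_prop

lemma prof_continuous (g : RMetric n) (e : CSpace n) : Continuous (prof g e) := by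
  have h : Continuous fun s : ℝ => ((√s • e, e, e) : CSpace n × CSpace n × CSpace n) := by
    fun_prop
  exact g.continuous_val_apply.comp h

lemma prof_contDiffOn (g : RMetric n) (e : CSpace n) :
    ContDiffOn ℝ ∞ (prof g e) (Set.Ioi 0) := by
  intro s hs
  have h1 : ContDiffAt ℝ ∞ (fun s : ℝ => √s • e) s :=
    (Real.contDiffAt_sqrt (ne_of_gt hs)).smul contDiffAt_const
  have h2 : ContDiffAt ℝ ∞ (fun s : ℝ => g.val (√s • e)) s :=
    g.smooth.contDiffAt.comp s h1
  exact ((h2.clm_apply contDiffAt_const).clm_apply contDiffAt_const).contDiffWithinAt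

/-- The derivative of the rescaled fundamental form along a ray. -/
lemma kahler_ray (hK : g.IsKahler) {D D₁ : ℝ → ℝ}
    (hrad : ∀ x u, g.val x x u = D (nsq x) * (herm x u).re)
    (hD : ∀ s, 0 < s → HasDerivAt D (D₁ s) s) {y : CSpace n} (hy : y ≠ 0) (u v : CSpace n) :
    2 * g.val y (Complex.I • u) v + fderiv ℝ g.val y y (Complex.I • u) v
      = 2 * D (nsq y) * (herm (Complex.I • u) v).re
        + 2 * D₁ (nsq y) * (conj (herm y u) * herm y v).im := by
  -- Cartan's formula for the Euler field `E = y`: since `ω` is closed, `L_E ω = d(ι_E ω)`. The left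
  -- side is `2ω + ∂_y ω`, and the contraction `ι_E ω` depends only on `D`; `key` differentiates
  -- this contraction.
  have key : ∀ a b : CSpace n, fderiv ℝ g.val y a (Complex.I • b) y
      + g.val y (Complex.I • b) a = -(D₁ (nsq y) * (2 * (herm y a).re) * (herm y b).im
        + D (nsq y) * (herm a b).im) := by
    intro a b
    have e1 : ∀ z, g.val z (Complex.I • b) z = -(D (nsq z) * (herm z b).im) := by
      intro z
      rw [g.symm, hrad, herm_smul_right]
      simp
    have h1 : HasDerivAt (fun τ : ℝ => g.val (y + τ • a) (Complex.I • b) (y + τ • a))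
        (fderiv ℝ g.val y a (Complex.I • b) y + g.val y (Complex.I • b) a) 0 := by
      have h0 : HasDerivAt (fun τ : ℝ => g.val (y + τ • a)) (fderiv ℝ g.val y a) 0 := by
        simpa using g.val_comp_hasDerivAt (line_hasDerivAt y a 0)
      have h2 := (h0.clm_apply (hasDerivAt_const 0 (Complex.I • b))).clm_apply
        (line_hasDerivAt y a 0)
      simpa using h2
    have h2 : HasDerivAt (fun τ : ℝ => -(D (nsq (y + τ • a)) * (herm (y + τ • a) b).im))
        (-(D₁ (nsq y) * (2 * (herm y a).re) * (herm y b).im + D (nsq y) * (herm a b).im)) 0 := by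
      have h3 : HasDerivAt (fun τ : ℝ => D (nsq (y + τ • a))) (D₁ (nsq y) * (2 * (herm y a).re)) 0 := by
        have := nsq_line_hasDerivAt y a
        refine HasDerivAt.comp 0 ?_ this
        simpa using hD _ (nsq_pos hy)
      have h4 : HasDerivAt (fun τ : ℝ => (herm (y + τ • a) b).im) (herm a b).im 0 :=
        hasDerivAt_im (herm_line_hasDerivAt y a b)
      simpa using (h3.fun_mul h4).fun_neg
    have h5 := h1.congr_of_eventuallyEq (Eventually.of_forall fun τ => (e1 _).symm)
    exact h5.unique h2
  have hc := hK.closed y u v y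
  have k1 := key u v
  have hsym : ∀ a b c, fderiv ℝ g.val y a b c = fderiv ℝ g.val y a c b := by
    intro a b c
    refine (g.val_line_hasDerivAt y a b c).unique ?_
    refine (g.val_line_hasDerivAt y a c b).congr_of_eventuallyEq
      (Eventually.of_forall fun τ => g.symm _ _ _)
  have k3 := key v u
  have k4 : fderiv ℝ g.val y v (Complex.I • y) u = -fderiv ℝ g.val y v (Complex.I • u) y := by
    have e : ∀ z, g.val z (Complex.I • y) u = -g.val z (Complex.I • u) y := by
      intro z
      have := hK.hermitian z (Complex.I • y) u
      rw [smul_smul, Complex.I_mul_I, neg_one_smul, map_neg, neg_apply] at this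
      rw [← this, g.symm]
    have h := (g.val_line_hasDerivAt y v (Complex.I • u) y).neg
    exact (g.val_line_hasDerivAt y v (Complex.I • y) u).unique
      (h.congr_of_eventuallyEq (Eventually.of_forall fun τ => e _))
  have k5 : g.val y (Complex.I • v) u = -g.val y (Complex.I • u) v := by
    have := hK.hermitian y (Complex.I • v) u
    rw [smul_smul, Complex.I_mul_I, neg_one_smul, map_neg, neg_apply] at this
    rw [← this, g.symm]
  rw [k4] at hc
  rw [k5] at k1
  have e3 : (herm (Complex.I • u) v).re = (herm u v).im := by rw [herm_smul_left]; simp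
  rw [e3]
  have e4 := herm_swap_im v u
  rw [e4] at k3
  simp only [Complex.mul_im, Complex.conj_re, Complex.conj_im]
  linarith

end

end RMetric

namespace RMetric

noncomputable section

open Filter ComplexConjugate

variable {n : ℕ} {g : RMetric n}

/-! ### Integration of the Kähler condition along rays -/

lemma eq_of_hasDerivAt_zero {f : ℝ → ℝ} {a b : ℝ} (hab : a < b) (hc : ContinuousOn f (Set.Icc a b))
    (h : ∀ t ∈ Set.Ioo a b, HasDerivAt f 0 t) : f a = f b := by
  obtain ⟨c, -, hc'⟩ := exists_hasDerivAt_eq_slope f (fun _ => 0) hab hc h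
  have : b - a ≠ 0 := (sub_pos.2 hab).ne'
  field_simp at hc'
  linarith

lemma eqOn_Ioi_of_hasDerivAt_zero {f : ℝ → ℝ} (h : ∀ t, 0 < t → HasDerivAt f 0 t) {a b : ℝ}
    (ha : 0 < a) (hb : 0 < b) : f a = f b := by
  rcases lt_trichotomy a b with hab | hab | hab
  · exact eq_of_hasDerivAt_zero hab
      (fun t ht => (h t (ha.trans_le ht.1)).continuousAt.continuousWithinAt)
      fun t ht => h t (ha.trans ht.1)
  · rw [hab]
  · exact (eq_of_hasDerivAt_zero hab
      (fun t ht => (h t (hb.trans_le ht.1)).continuousAt.continuousWithinAt)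
      fun t ht => h t (hb.trans ht.1)).symm

lemma smul_ray_hasDerivAt (x : CSpace n) (t : ℝ) : HasDerivAt (fun τ : ℝ => τ • x) x t := by
  simpa using (hasDerivAt_id' t).smul_const x

lemma sq_mul_hasDerivAt (c t : ℝ) : HasDerivAt (fun τ : ℝ => τ ^ 2 * c) (2 * t * c) t := by
  simpa using (((hasDerivAt_id' t).fun_pow 2).mul_const c)

/-- The form `τ² ω_{τx}` is the pull-back of `ω` under dilation by `τ`. It vanishes at `τ = 0`, and
its `τ`-derivative is known from `kahler_ray`, so integration over `[0,1]` recovers `ω_x`. The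
function `f` in the proof is its difference from the claimed primitive. -/
lemma kahler_formula (hK : g.IsKahler) {D D₁ φ : ℝ → ℝ} (hDc : Continuous D)
    (hrad : ∀ x u, g.val x x u = D (nsq x) * (herm x u).re)
    (hD : ∀ s, 0 < s → HasDerivAt D (D₁ s) s) (hφ : ∀ s, HasDerivAt φ (D s) s) (hφ0 : φ 0 = 0)
    {x : CSpace n} (hx : x ≠ 0) (u v : CSpace n) :
    g.val x (Complex.I • u) v = φ (nsq x) / nsq x * (herm (Complex.I • u) v).re
      + (D (nsq x) - φ (nsq x) / nsq x) / nsq x * (conj (herm x u) * herm x v).im := by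
  set s := nsq x with hs
  have hs0 : 0 < s := nsq_pos hx
  set R := (herm (Complex.I • u) v).re with hR
  set S := (conj (herm x u) * herm x v).im with hS
  have hφc : Continuous φ := continuous_iff_continuousAt.2 fun s => (hφ s).continuousAt
  let f : ℝ → ℝ := fun τ => τ ^ 2 * g.val (τ • x) (Complex.I • u) v
    - (φ (τ ^ 2 * s) * R + (τ ^ 2 * s * D (τ ^ 2 * s) - φ (τ ^ 2 * s)) * (S / s)) / s
  have hcont : Continuous f := by
    have h1 : Continuous fun τ : ℝ => ((τ • x, Complex.I • u, v) : CSpace n × CSpace n × CSpace n) := by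
      fun_prop
    have h2 := g.continuous_val_apply.comp h1
    simp only [Function.comp_def] at h2
    fun_prop
  have hder : ∀ τ ∈ Set.Ioo (0 : ℝ) 1, HasDerivAt f 0 τ := by
    intro τ hτ
    have hτ0 := hτ.1
    have hp : 0 < τ ^ 2 * s := by positivity
    have hy : τ • x ≠ 0 := smul_ne_zero hτ0.ne' hx
    have d1 := ((hasDerivAt_id' τ).fun_pow 2).fun_mul
      (g.val_hasDerivAt (smul_ray_hasDerivAt x τ) (Complex.I • u) v)
    have d0 := sq_mul_hasDerivAt s τ
    have d2 : HasDerivAt (fun τ : ℝ => φ (τ ^ 2 * s)) (D (τ ^ 2 * s) * (2 * τ * s)) τ :=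
      (hφ (τ ^ 2 * s)).comp τ d0
    have d3 : HasDerivAt (fun τ : ℝ => D (τ ^ 2 * s)) (D₁ (τ ^ 2 * s) * (2 * τ * s)) τ :=
      (hD (τ ^ 2 * s) hp).comp τ d0
    have d4 := d1.fun_sub (((d2.mul_const R).fun_add
      (((d0.fun_mul d3).fun_sub d2).mul_const (S / s))).div_const s)
    refine d4.congr_deriv ?_
    have hk := kahler_ray hK hrad hD hy u v
    have e1 : nsq (τ • x) = τ ^ 2 * s := nsq_rsmul τ x
    have e2 : (conj (herm (τ • x) u) * herm (τ • x) v).im = τ ^ 2 * S := by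
      rw [herm_rsmul_left, herm_rsmul_left, map_mul, Complex.conj_ofReal, hS]
      simp
      ring
    have e3 : fderiv ℝ g.val (τ • x) (τ • x) (Complex.I • u) v
        = τ * fderiv ℝ g.val (τ • x) x (Complex.I • u) v := by
      rw [(fderiv ℝ g.val (τ • x)).map_smul τ x]; rfl
    rw [e1, e2, e3] at hk
    simp only [Nat.cast_ofNat, Nat.add_one_sub_one, pow_one, mul_one]
    rw [← hR] at hk
    have hs' := hs0.ne'
    have : (2 * τ * g.val (τ • x) (Complex.I • u) v
        + τ ^ 2 * fderiv ℝ g.val (τ • x) x (Complex.I • u) v)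
        = τ * (2 * D (τ ^ 2 * s) * R + 2 * D₁ (τ ^ 2 * s) * (τ ^ 2 * S)) := by
      rw [← hk]; ring
    rw [this]
    field_simp
    ring
  have h01 := eq_of_hasDerivAt_zero one_pos hcont.continuousOn hder
  have hs' := hs0.ne'
  simp only [f, one_pow, one_mul, one_smul, ne_eq, OfNat.ofNat_ne_zero, not_false_eq_true, zero_pow,
    zero_mul, hφ0, sub_zero, add_zero, zero_div] at h01
  have : g.val x (Complex.I • u) v = (φ s * R + (s * D s - φ s) * (S / s)) / s := by linarith
  rw [this]
  field_simp

theorem exists_hasProfile (hK : g.IsKahler) (hU : g.IsUnitaryInvariant) {e : CSpace n}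
    (he : nsq e = 1) : ∃ D D₁ D₂ φ : ℝ → ℝ, g.HasProfile D D₁ D₂ φ := by
  have he0 : e ≠ 0 := by
    rintro rfl; simp [nsq_zero] at he
  have hc := prof_continuous g e
  have h1 : ContDiffOn ℝ ∞ (deriv (prof g e)) (Set.Ioi 0) :=
    (prof_contDiffOn g e).deriv_of_isOpen isOpen_Ioi (by simp)
  have hd1 : ∀ s, 0 < s → HasDerivAt (prof g e) (deriv (prof g e) s) s := fun s hs =>
    (((prof_contDiffOn g e).contDiffAt (Ioi_mem_nhds hs)).differentiableAt (by simp)).hasDerivAt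
  have hφ : ∀ s, HasDerivAt (fun s => ∫ σ in (0 : ℝ)..s, prof g e σ) (prof g e s) s := fun s =>
    intervalIntegral.integral_hasDerivAt_right (hc.intervalIntegrable _ _)
      (hc.stronglyMeasurableAtFilter _ _) hc.continuousAt
  refine ⟨prof g e, deriv (prof g e), deriv (deriv (prof g e)),
    fun s => ∫ σ in (0 : ℝ)..s, prof g e σ, hc, fun s => g.pos _ _ he0, hd1, fun s hs =>
    ((h1.contDiffAt (Ioi_mem_nhds hs)).differentiableAt (by simp)).hasDerivAt, hφ,
    by simp, val_radial hK hU he, fun x hx u v => ?_⟩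
  -- Replacing `u` by `-iu` passes from the fundamental form back to the metric.
  have h := kahler_formula hK hc (val_radial hK hU he) hd1 hφ (by simp) hx
    ((-Complex.I) • u) v
  rw [smul_smul] at h
  simp only [mul_neg, Complex.I_mul_I, neg_neg, one_smul] at h
  rw [h, herm_smul_right]
  congr 2
  simp
  ring

end

end RMetric

namespace RMetric

noncomputable section

open Filter ComplexConjugate

variable {n : ℕ}

/-! ### Duality and smoothness of the connection -/

variable (g : RMetric n)

lemma val_injective (x : CSpace n) : Function.Injective (g.val x) := by
  refine (injective_iff_map_eq_zero _).2 fun u hu => ?_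
  by_contra h
  have := g.pos x u h
  rw [hu] at this
  simp at this

/-- The duality between vectors and covectors given by the metric. -/
def valEquiv (x : CSpace n) : CSpace n ≃L[ℝ] (CSpace n →L[ℝ] ℝ) :=
  (LinearEquiv.ofInjectiveOfFinrankEq (g.val x).toLinearMap (g.val_injective x) (by
    rw [← (LinearMap.toContinuousLinearMap (𝕜 := ℝ) (E := CSpace n) (F' := ℝ)).finrank_eq]
    exact (Subspace.dual_finrank_eq (K := ℝ) (V := CSpace n)).symm)).toContinuousLinearEquiv

lemma coe_valEquiv (x : CSpace n) : (g.valEquiv x : CSpace n →L[ℝ] (CSpace n →L[ℝ] ℝ)) = g.val x := by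
  ext u v
  rfl

lemma inverse_val (x : CSpace n) :
    (g.val x).inverse = ((g.valEquiv x).symm : (CSpace n →L[ℝ] ℝ) →L[ℝ] CSpace n) := by
  rw [← coe_valEquiv, ContinuousLinearMap.inverse_equiv]

lemma val_christoffel (x u v w : CSpace n) : g.val x (g.christoffel x u v) w = g.koszul x u v w := by
  rw [christoffel, inverse_val]
  have := (g.valEquiv x).apply_symm_apply (g.koszul x u v)
  exact congrArg (fun l : CSpace n →L[ℝ] ℝ => l w) this

/-- The symbol is defined through the total function `inverse`; nondegeneracy of the metric lets it
be identified by checking Koszul's identity alone. -/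
lemma christoffel_eq {x u v y : CSpace n} (h : ∀ w, g.val x y w = g.koszul x u v w) :
    g.christoffel x u v = y :=
  g.val_injective x (ContinuousLinearMap.ext fun w => by rw [val_christoffel, h])

lemma koszul_apply (x u v w : CSpace n) : g.koszul x u v w = (1 / 2 : ℝ) *
    (fderiv ℝ g.val x u v w + fderiv ℝ g.val x v u w - fderiv ℝ g.val x w u v) := rfl

lemma contDiff_fderiv_val {E : Type*} [NormedAddCommGroup E] [NormedSpace ℝ E]
    {x u v w : E → CSpace n} (hx : ContDiff ℝ ∞ x) (hu : ContDiff ℝ ∞ u) (hv : ContDiff ℝ ∞ v)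
    (hw : ContDiff ℝ ∞ w) : ContDiff ℝ ∞ fun p => fderiv ℝ g.val (x p) (u p) (v p) (w p) := by
  have h0 : ContDiff ℝ ∞ (Function.uncurry fun (_ : E) => g.val) :=
    g.smooth.comp contDiff_snd
  have h1 : ContDiff ℝ ∞ fun p => fderiv ℝ g.val (x p) (u p) :=
    ContDiff.fderiv_apply (n := ∞) (f := fun _ => g.val) h0 hx hu (by simp)
  exact (h1.clm_apply hv).clm_apply hw

lemma contDiff_inverse_val : ContDiff ℝ ∞ fun x => (g.val x).inverse := by
  rw [contDiff_iff_contDiffAt]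
  intro x
  have h : ContDiffAt ℝ ∞ ContinuousLinearMap.inverse
      (g.valEquiv x : CSpace n →L[ℝ] (CSpace n →L[ℝ] ℝ)) := contDiffAt_map_inverse _
  rw [coe_valEquiv] at h
  exact h.comp x g.smooth.contDiffAt

lemma contDiff_christoffel {E : Type*} [NormedAddCommGroup E] [NormedSpace ℝ E]
    {x u v : E → CSpace n} (hx : ContDiff ℝ ∞ x) (hu : ContDiff ℝ ∞ u) (hv : ContDiff ℝ ∞ v) :
    ContDiff ℝ ∞ fun p => g.christoffel (x p) (u p) (v p) := by
  have h1 : ContDiff ℝ ∞ fun p => g.koszul (x p) (u p) (v p) := by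
    refine contDiff_clm_apply_iff.2 fun w => ?_
    simp only [koszul_apply]
    exact contDiff_const.mul (((g.contDiff_fderiv_val hx hu hv contDiff_const).add
      (g.contDiff_fderiv_val hx hv hu contDiff_const)).sub
      (g.contDiff_fderiv_val hx contDiff_const hu hv))
  exact (g.contDiff_inverse_val.comp hx).clm_apply h1

lemma christoffel_hasDerivAt (x a u v : CSpace n) :
    HasDerivAt (fun τ : ℝ => g.christoffel (x + τ • a) u v)
      (fderiv ℝ (fun y => g.christoffel y u v) x a) 0 := by
  have h1 : DifferentiableAt ℝ (fun y => g.christoffel y u v) (x + (0 : ℝ) • a) :=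
    (g.contDiff_christoffel contDiff_id contDiff_const contDiff_const).differentiable (by simp) _
  have := h1.hasFDerivAt.comp_hasDerivAt 0 (line_hasDerivAt x a 0)
  simp only [zero_smul, add_zero] at this
  exact this

lemma continuous_curv (u v w : CSpace n) : Continuous fun x => g.curv x u v w := by
  have h1 : ∀ v w u : CSpace n,
      Continuous fun x => fderiv ℝ (fun y => g.christoffel y v w) x u := fun v w u =>
    ((g.contDiff_christoffel contDiff_id contDiff_const contDiff_const).continuous_fderiv
      (by simp)).clm_apply continuous_const
  have h2 : ∀ u v w : CSpace n,
      Continuous fun x => g.christoffel x u (g.christoffel x v w) := fun u v w =>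
    (g.contDiff_christoffel contDiff_id contDiff_const
      (g.contDiff_christoffel contDiff_id contDiff_const contDiff_const)).continuous
  exact (((h1 v w u).sub (h1 u w v)).add (h2 u v w)).sub (h2 v u w)

end

end RMetric

namespace RMetric

noncomputable section

open Filter ComplexConjugate

variable {n : ℕ}

/-! ### The connection and the curvature of a radial Kähler metric -/

/-- The coefficient of `⟨x,u⟩v + ⟨x,v⟩u` in the Christoffel symbol. -/
def coefα (D φ : ℝ → ℝ) (s : ℝ) : ℝ := D s / φ s - 1 / s

/-- The coefficient of `⟨x,u⟩⟨x,v⟩x` in the Christoffel symbol. -/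
def coefβ (D D₁ φ : ℝ → ℝ) (s : ℝ) : ℝ := (D₁ s / D s - 2 * (D s / φ s) + 2 / s) / s

/-- The derivative of `coefα`. -/
def coefα₁ (D D₁ φ : ℝ → ℝ) (s : ℝ) : ℝ := D₁ s / φ s - D s ^ 2 / φ s ^ 2 + 1 / s ^ 2

/-- The derivative of `coefβ`. -/
def coefβ₁ (D D₁ D₂ φ : ℝ → ℝ) (s : ℝ) : ℝ :=
  (D₂ s / D s - D₁ s ^ 2 / D s ^ 2 - 2 * (D₁ s / φ s - D s ^ 2 / φ s ^ 2) - 2 / s ^ 2) / s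
    - (D₁ s / D s - 2 * (D s / φ s) + 2 / s) / s ^ 2

variable {g : RMetric n} {D D₁ D₂ φ : ℝ → ℝ}

namespace HasProfile

lemma moment_pos (hP : g.HasProfile D D₁ D₂ φ) {s : ℝ} (hs : 0 < s) : 0 < φ s := by
  have h : StrictMono φ := strictMono_of_deriv_pos fun s => by
    rw [(hP.moment s).deriv]; exact hP.pos s
  simpa [hP.moment_zero] using h hs

lemma coefα_hasDerivAt (hP : g.HasProfile D D₁ D₂ φ) {s : ℝ} (hs : 0 < s) :
    HasDerivAt (coefα D φ) (coefα₁ D D₁ φ s) s := by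
  have hφ := (hP.moment_pos hs).ne'
  have h := (((hP.deriv₁ s hs).fun_div (hP.moment s) hφ).fun_sub
    ((hasDerivAt_const s (1 : ℝ)).fun_div (hasDerivAt_id' s) hs.ne'))
  refine h.congr_deriv ?_
  rw [coefα₁]
  field_simp
  ring

lemma coefβ_hasDerivAt (hP : g.HasProfile D D₁ D₂ φ) {s : ℝ} (hs : 0 < s) :
    HasDerivAt (coefβ D D₁ φ) (coefβ₁ D D₁ D₂ φ s) s := by
  have hφ := (hP.moment_pos hs).ne'
  have hD := (hP.pos s).ne'
  have h := ((((hP.deriv₂ s hs).fun_div (hP.deriv₁ s hs) hD).fun_sub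
    (((hP.deriv₁ s hs).fun_div (hP.moment s) hφ).const_mul 2)).fun_add
    ((hasDerivAt_const s (2 : ℝ)).fun_div (hasDerivAt_id' s) hs.ne')).fun_div
      (hasDerivAt_id' s) hs.ne'
  refine h.congr_deriv ?_
  rw [coefβ₁]
  field_simp
  ring

/-- This is the coefficient of the `(2,0)` part of the curvature, which vanishes for a Kähler
metric. -/
lemma coef_relation (hP : g.HasProfile D D₁ D₂ φ) {s : ℝ} (hs : 0 < s) :
    coefα₁ D D₁ φ s - coefβ D D₁ φ s - coefα D φ s ^ 2
      - coefα D φ s * coefβ D D₁ φ s * s = 0 := by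
  have hφ := (hP.moment_pos hs).ne'
  have hD := (hP.pos s).ne'
  rw [coefα₁, coefβ, coefα]
  field_simp
  ring

lemma fderiv_val (hP : g.HasProfile D D₁ D₂ φ) {x : CSpace n} (hx : x ≠ 0) (a u v : CSpace n) :
    fderiv ℝ g.val x a u v =
      (D (nsq x) - φ (nsq x) / nsq x) / nsq x * (2 * (herm x a).re * (herm u v).re
        + (conj (herm a u) * herm x v + conj (herm x u) * herm a v).re)
      + (D₁ (nsq x) - 2 * ((D (nsq x) - φ (nsq x) / nsq x) / nsq x)) / nsq x
        * (2 * (herm x a).re * (conj (herm x u) * herm x v).re) := by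
  have hs := nsq_pos hx
  have dn : HasDerivAt (fun τ : ℝ => nsq (x + τ • a)) (2 * (herm x a).re) 0 :=
    nsq_line_hasDerivAt x a
  have hx0 : nsq (x + (0 : ℝ) • a) = nsq x := by simp
  have dφ : HasDerivAt (fun τ : ℝ => φ (nsq (x + τ • a))) (D (nsq x) * (2 * (herm x a).re)) 0 :=
    HasDerivAt.comp (0 : ℝ) (by rw [hx0]; exact hP.moment _) dn
  have dD : HasDerivAt (fun τ : ℝ => D (nsq (x + τ • a))) (D₁ (nsq x) * (2 * (herm x a).re)) 0 :=
    HasDerivAt.comp (0 : ℝ) (by rw [hx0]; exact hP.deriv₁ _ hs) dn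
  have hne : nsq (x + (0 : ℝ) • a) ≠ 0 := by rw [hx0]; exact hs.ne'
  have dA := dφ.fun_div dn hne
  have dB := (dD.fun_sub dA).fun_div dn hne
  have dh := hasDerivAt_re ((hasDerivAt_conj (herm_line_hasDerivAt x a u)).fun_mul
    (herm_line_hasDerivAt x a v))
  have h := (dA.mul_const (herm u v).re).fun_add (dB.fun_mul dh)
  have h1 : HasDerivAt (fun τ : ℝ => g.val (x + τ • a) u v) _ 0 :=
    h.congr_of_eventuallyEq ((line_eventually_ne hx a).mono fun τ hτ => hP.formula _ hτ u v)
  rw [(g.val_line_hasDerivAt x a u v).unique h1]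
  simp only [zero_smul, add_zero]
  have hs' := hs.ne'
  simp only [Complex.add_re]
  field_simp
  ring

/-- For a Kähler metric the symbol is complex bilinear in its two arguments. Unitary symmetry then
leaves only these two terms, and Koszul's identity confirms the coefficients. -/
lemma christoffel_formula (hP : g.HasProfile D D₁ D₂ φ) {x : CSpace n} (hx : x ≠ 0)
    (u v : CSpace n) :
    g.christoffel x u v = (coefα D φ (nsq x) : ℂ) • (herm x u • v + herm x v • u)
      + (coefβ D D₁ φ (nsq x) * (herm x u * herm x v) : ℂ) • x := by
  refine g.christoffel_eq fun w => ?_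
  have hs := nsq_pos hx
  have hφ := (hP.moment_pos hs).ne'
  have hD := (hP.pos (nsq x)).ne'
  rw [koszul_apply, hP.fderiv_val hx, hP.fderiv_val hx, hP.fderiv_val hx, hP.formula x hx]
  simp only [herm_add_left, herm_add_right, herm_smul_left, herm_smul_right, herm_self,
    ← herm_conj u v, ← herm_conj u w, ← herm_conj v w]
  simp only [Complex.add_re, Complex.mul_re, Complex.conj_re, Complex.conj_im, Complex.ofReal_re,
    Complex.ofReal_im, Complex.add_im, Complex.mul_im, map_add, map_mul, Complex.conj_ofReal]
  have hs' := hs.ne'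
  generalize (herm x u).re = a1
  generalize (herm x u).im = a2
  generalize (herm x v).re = b1
  generalize (herm x v).im = b2
  generalize (herm x w).re = c1
  generalize (herm x w).im = c2
  generalize (herm u w).re = p1
  generalize (herm u w).im = p2
  generalize (herm v w).re = q1
  generalize (herm v w).im = q2
  generalize (herm u v).re = r1
  generalize (herm u v).im = r2
  rw [coefα, coefβ]
  field_simp
  ring

end HasProfile

end

end RMetric

namespace RMetric

noncomputable section

open Filter ComplexConjugate

variable {n : ℕ}

/-! ### Curvature as the `∂̄`-derivative of the connection -/

/-- The `∂̄`-derivative in the direction `u` of the Christoffel symbol applied to `v` and `w`. -/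
def dbarChristoffel (a b a₁ b₁ : ℝ) (x u v w : CSpace n) : CSpace n :=
  (a₁ * conj (herm x u) : ℂ) • (herm x v • w + herm x w • v)
    + (a : ℂ) • (herm u v • w + herm u w • v)
    + (b₁ * (conj (herm x u) * herm x v * herm x w)
      + b * (herm u v * herm x w + herm x v * herm u w) : ℂ) • x

variable {g : RMetric n} {D D₁ D₂ φ : ℝ → ℝ}

namespace HasProfile

lemma fderiv_christoffel (hP : g.HasProfile D D₁ D₂ φ) {x : CSpace n} (hx : x ≠ 0)
    (u v w : CSpace n) :
    fderiv ℝ (fun y => g.christoffel y v w) x u =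
      (coefα₁ D D₁ φ (nsq x) * (herm x u + conj (herm x u)) : ℂ) • (herm x v • w + herm x w • v)
        + (coefα D φ (nsq x) : ℂ) • (herm u v • w + herm u w • v)
        + (coefβ₁ D D₁ D₂ φ (nsq x) * (herm x u + conj (herm x u)) * (herm x v * herm x w)
          + coefβ D D₁ φ (nsq x) * (herm u v * herm x w + herm x v * herm u w) : ℂ) • x
        + (coefβ D D₁ φ (nsq x) * (herm x v * herm x w) : ℂ) • u := by
  have hs := nsq_pos hx
  have hx0 : nsq (x + (0 : ℝ) • u) = nsq x := by simp
  have dn := nsq_line_hasDerivAt x u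
  have dα : HasDerivAt (fun τ : ℝ => (coefα D φ (nsq (x + τ • u)) : ℂ))
      (coefα₁ D D₁ φ (nsq x) * (2 * (herm x u).re) : ℝ) 0 :=
    HasDerivAt.ofReal_comp (f := fun τ : ℝ => coefα D φ (nsq (x + τ • u)))
      (HasDerivAt.comp (0 : ℝ) (h₂ := coefα D φ) (by rw [hx0]; exact hP.coefα_hasDerivAt hs) dn)
  have dβ : HasDerivAt (fun τ : ℝ => (coefβ D D₁ φ (nsq (x + τ • u)) : ℂ))
      (coefβ₁ D D₁ D₂ φ (nsq x) * (2 * (herm x u).re) : ℝ) 0 :=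
    HasDerivAt.ofReal_comp (f := fun τ : ℝ => coefβ D D₁ φ (nsq (x + τ • u)))
      (HasDerivAt.comp (0 : ℝ) (h₂ := coefβ D D₁ φ) (by rw [hx0]; exact hP.coefβ_hasDerivAt hs) dn)
  have dv := herm_line_hasDerivAt x u v
  have dw := herm_line_hasDerivAt x u w
  have h := (dα.fun_smul ((dv.fun_smul (hasDerivAt_const 0 w)).fun_add
    (dw.fun_smul (hasDerivAt_const 0 v)))).fun_add
    ((dβ.fun_mul (dv.fun_mul dw)).fun_smul (line_hasDerivAt x u 0))
  have h1 : HasDerivAt (fun τ : ℝ => g.christoffel (x + τ • u) v w) _ 0 :=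
    h.congr_of_eventuallyEq ((line_eventually_ne hx u).mono fun τ hτ =>
      hP.christoffel_formula hτ v w)
  rw [(g.christoffel_hasDerivAt x u v w).unique h1]
  -- Splits the derivative of `|x|²` into its linear and antilinear parts in `u`; the antilinear
  -- parts make up `dbarChristoffel`.
  have hre : ((2 * (herm x u).re : ℝ) : ℂ) = herm x u + conj (herm x u) := by
    rw [Complex.add_conj]
  simp only [zero_smul, add_zero, smul_zero, zero_add, Complex.ofReal_mul _ (2 * (herm x u).re), hre]
  ext i
  simp only [Pi.add_apply, Pi.smul_apply, smul_eq_mul]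
  ring

theorem curv_formula (hP : g.HasProfile D D₁ D₂ φ) {x : CSpace n} (hx : x ≠ 0)
    (u v w : CSpace n) :
    g.curv x u v w =
      dbarChristoffel (coefα D φ (nsq x)) (coefβ D D₁ φ (nsq x)) (coefα₁ D D₁ φ (nsq x))
        (coefβ₁ D D₁ D₂ φ (nsq x)) x u v w
      - dbarChristoffel (coefα D φ (nsq x)) (coefβ D D₁ φ (nsq x)) (coefα₁ D D₁ φ (nsq x))
        (coefβ₁ D D₁ D₂ φ (nsq x)) x v u w := by
  have hr : (coefα₁ D D₁ φ (nsq x) - coefβ D D₁ φ (nsq x) - coefα D φ (nsq x) ^ 2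
      - coefα D φ (nsq x) * coefβ D D₁ φ (nsq x) * nsq x : ℂ) = 0 := by
    exact_mod_cast hP.coef_relation (nsq_pos hx)
  rw [curv, hP.fderiv_christoffel hx, hP.fderiv_christoffel hx]
  simp only [hP.christoffel_formula hx, dbarChristoffel, herm_add_right, herm_smul_right, herm_self]
  ext i
  simp only [Pi.add_apply, Pi.sub_apply, Pi.smul_apply, smul_eq_mul]
  -- What remains after removing the `∂̄` terms is the `(2,0)` part, which is a multiple of
  -- `coef_relation`.
  linear_combination (herm x u * herm x w * v i - herm x v * herm x w * u i) * hr

end HasProfile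

/-! ### Traces in the real coordinate basis -/

lemma stdBasis_zero (i : Fin n) : stdBasis n ⟨i, 0⟩ = Pi.single i 1 := by
  simp [stdBasis, Pi.basis_apply]

lemma stdBasis_one (i : Fin n) : stdBasis n ⟨i, 1⟩ = Pi.single i Complex.I := by
  simp [stdBasis, Pi.basis_apply]

lemma herm_single_left (i : Fin n) (c : ℂ) (v : CSpace n) :
    herm (Pi.single i c) v = conj c * v i := by
  rw [herm, Finset.sum_eq_single i]
  · simp
  · intro j _ hj; simp [hj]
  · simp

lemma herm_single_right (i : Fin n) (c : ℂ) (v : CSpace n) :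
    herm v (Pi.single i c) = conj (v i) * c := by
  rw [← herm_conj, herm_single_left, map_mul, Complex.conj_conj, mul_comm]

lemma stdBasis_repr (v : CSpace n) (a : RIndex n) :
    (stdBasis n).repr v a = (herm (stdBasis n a) v).re := by
  obtain ⟨i, k⟩ := a
  rw [stdBasis, Pi.basis_repr]
  fin_cases k
  · have := stdBasis_zero i
    rw [stdBasis] at this
    simp [this, herm_single_left]
  · have := stdBasis_one i
    rw [stdBasis] at this
    simp [this, herm_single_left]

lemma sum_rIndex {M : Type*} [AddCommMonoid M] (f : RIndex n → M) :
    ∑ a, f a = ∑ i, (f ⟨i, 0⟩ + f ⟨i, 1⟩) := by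
  rw [Fintype.sum_sigma]
  exact Finset.sum_congr rfl fun i _ => by rw [Fin.sum_univ_two]

/-- The real trace of a rank one complex linear map. -/
lemma sum_herm_mul_herm (p q : CSpace n) :
    ∑ a, (herm p (stdBasis n a) * herm (stdBasis n a) q) = 2 * herm p q := by
  rw [sum_rIndex]
  simp only [stdBasis_zero, stdBasis_one, herm_single_left, herm_single_right]
  rw [herm, Finset.mul_sum]
  refine Finset.sum_congr rfl fun i _ => ?_
  have : Complex.I * Complex.I = -1 := Complex.I_mul_I
  simp only [Complex.conj_I, map_one]
  linear_combination (-(conj (p i) * q i)) * this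

/-- The real trace of a rank one complex antilinear map vanishes. -/
lemma sum_herm_mul_herm_anti (p q : CSpace n) :
    ∑ a, (herm (stdBasis n a) p * herm (stdBasis n a) q) = 0 := by
  rw [sum_rIndex]
  refine Finset.sum_eq_zero fun i _ => ?_
  simp only [stdBasis_zero, stdBasis_one, herm_single_left]
  have : Complex.I * Complex.I = -1 := Complex.I_mul_I
  simp only [Complex.conj_I, map_one]
  linear_combination (p i * q i) * this

/-- The real trace of the identity. -/
lemma sum_herm_self : ∑ a, herm (stdBasis n a) (stdBasis n a) = 2 * (n : ℂ) := by
  rw [sum_rIndex]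
  simp only [stdBasis_zero, stdBasis_one, herm_single_left]
  simp [mul_comm]
  ring

namespace HasProfile

variable {g : RMetric n} {D D₁ D₂ φ : ℝ → ℝ}

/-- Of the curvature terms, those antilinear in the traced vector have zero real trace, while each
complex linear one contributes twice its complex trace; this gives the factor `-2`. -/
lemma ric_formula' (hP : g.HasProfile D D₁ D₂ φ) {x : CSpace n} (hx : x ≠ 0) (u v : CSpace n) :
    g.ric x u v = -2 * (((n + 1) * coefα D φ (nsq x) + nsq x * coefβ D D₁ φ (nsq x))
        * (herm u v).re
      + ((n + 1) * coefα₁ D D₁ φ (nsq x) + nsq x * coefβ₁ D D₁ D₂ φ (nsq x)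
        + coefβ D D₁ φ (nsq x)) * (conj (herm x u) * herm x v).re) := by
  have h : (g.ric x u v : ℝ) = (∑ a, herm (stdBasis n a) (g.curv x (stdBasis n a) u v)).re := by
    rw [ric, Complex.re_sum]
    exact Finset.sum_congr rfl fun a _ => stdBasis_repr _ _
  rw [h]
  simp only [hP.curv_formula hx]
  generalize coefα D φ (nsq x) = a
  generalize coefβ D D₁ φ (nsq x) = b
  generalize coefα₁ D D₁ φ (nsq x) = a₁
  generalize coefβ₁ D D₁ D₂ φ (nsq x) = b₁
  have e : ∀ i, herm (stdBasis n i) (dbarChristoffel a b a₁ b₁ x (stdBasis n i) u v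
      - dbarChristoffel a b a₁ b₁ x u (stdBasis n i) v) =
      (a₁ * herm x u) * (herm (stdBasis n i) x * herm (stdBasis n i) v)
      + (a₁ * herm x v) * (herm (stdBasis n i) x * herm (stdBasis n i) u)
      + (2 * a) * (herm (stdBasis n i) u * herm (stdBasis n i) v)
      + (b₁ * (herm x u * herm x v)) * (herm (stdBasis n i) x * herm (stdBasis n i) x)
      + (b * herm x v) * (herm (stdBasis n i) u * herm (stdBasis n i) x)
      + (b * herm x u) * (herm (stdBasis n i) v * herm (stdBasis n i) x)
      - (a₁ * conj (herm x u)) * (herm x (stdBasis n i) * herm (stdBasis n i) v)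
      - (a₁ * conj (herm x u) * herm x v + a * herm u v) * herm (stdBasis n i) (stdBasis n i)
      - a * (herm u (stdBasis n i) * herm (stdBasis n i) v)
      - (b₁ * conj (herm x u) * herm x v + b * herm u v) * (herm x (stdBasis n i) * herm (stdBasis n i) x)
      - b * herm x v * (herm u (stdBasis n i) * herm (stdBasis n i) x) := by
    intro i
    simp only [dbarChristoffel, herm_sub_right, herm_add_right, herm_smul_right, herm_conj]
    ring
  rw [Finset.sum_congr rfl fun i _ => e i]
  simp only [Finset.sum_sub_distrib, Finset.sum_add_distrib, ← Finset.mul_sum, sum_herm_mul_herm,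
    sum_herm_mul_herm_anti, sum_herm_self, herm_self x, ← herm_conj x u]
  simp only [Complex.add_re, Complex.sub_re, Complex.mul_re, Complex.ofReal_re, Complex.ofReal_im,
    Complex.mul_im, Complex.conj_re, Complex.conj_im, Complex.add_im, Complex.re_ofNat,
    Complex.im_ofNat, Complex.natCast_re, Complex.natCast_im, Complex.zero_re, Complex.zero_im]
  ring

end HasProfile

end

end RMetric

namespace RMetric

noncomputable section

open Filter ComplexConjugate

variable {n : ℕ}

/-! ### Ricci form, scalar curvature and volume density -/

/-- The derivative of the logarithm of the volume density. -/
def logDet₁ (n : ℕ) (D D₁ φ : ℝ → ℝ) (s : ℝ) : ℝ := (n - 1) * (D s / φ s - 1 / s) + D₁ s / D s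

/-- The second derivative of the logarithm of the volume density. -/
def logDet₂ (n : ℕ) (D D₁ D₂ φ : ℝ → ℝ) (s : ℝ) : ℝ :=
  (n - 1) * (D₁ s / φ s - D s ^ 2 / φ s ^ 2 + 1 / s ^ 2) + (D₂ s / D s - D₁ s ^ 2 / D s ^ 2)

/-- The complex linear map `u ↦ p u + q ⟨x,u⟩ x`. -/
def radialMap (p q : ℝ) (x : CSpace n) : CSpace n →ₗ[ℂ] CSpace n where
  toFun u := (p : ℂ) • u + (q * herm x u : ℂ) • x
  map_add' u v := by
    rw [herm_add_right]; module
  map_smul' c u := by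
    rw [herm_smul_right, RingHom.id_apply]; module

lemma radialMap_apply (p q : ℝ) (x u : CSpace n) :
    radialMap p q x u = (p : ℂ) • u + (q * herm x u : ℂ) • x := rfl

lemma radialMap_comp (p q p' q' : ℝ) (x : CSpace n) :
    radialMap p q x ∘ₗ radialMap p' q' x
      = radialMap (p * p') (p * q' + q * p' + q * q' * nsq x) x := by
  refine LinearMap.ext fun u => ?_
  simp only [LinearMap.comp_apply, radialMap_apply, herm_add_right, herm_smul_right, herm_self]
  push_cast
  module

/-- The matrix of `radialMap` in the real coordinate basis. -/
def radialMatrix (p q : ℝ) (x : CSpace n) : Matrix (RIndex n) (RIndex n) ℝ :=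
  LinearMap.toMatrix (stdBasis n) (stdBasis n) ((radialMap p q x).restrictScalars ℝ)

lemma radialMatrix_apply (p q : ℝ) (x : CSpace n) (a b : RIndex n) :
    radialMatrix p q x a b = p * (herm (stdBasis n a) (stdBasis n b)).re
      + q * (conj (herm x (stdBasis n a)) * herm x (stdBasis n b)).re := by
  rw [radialMatrix, LinearMap.toMatrix_apply, stdBasis_repr, LinearMap.restrictScalars_apply,
    radialMap_apply, herm_add_right, herm_smul_right, herm_smul_right, Complex.add_re,
    Complex.re_ofReal_mul, mul_assoc, Complex.re_ofReal_mul, herm_conj, mul_comm (herm x _)]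

lemma radialMatrix_mul (p q p' q' : ℝ) (x : CSpace n) :
    radialMatrix p q x * radialMatrix p' q' x
      = radialMatrix (p * p') (p * q' + q * p' + q * q' * nsq x) x := by
  rw [radialMatrix, radialMatrix, ← LinearMap.toMatrix_comp, radialMatrix, ← radialMap_comp]
  rfl

lemma radialMatrix_one (x : CSpace n) : radialMatrix 1 0 x = 1 := by
  rw [radialMatrix, ← LinearMap.toMatrix_id (stdBasis n)]
  congr 1
  refine LinearMap.ext fun u => ?_
  simp [radialMap_apply]

lemma radialMatrix_trace (p q : ℝ) (x : CSpace n) :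
    (radialMatrix p q x).trace = 2 * n * p + 2 * q * nsq x := by
  simp only [Matrix.trace, Matrix.diag_apply, radialMatrix_apply, Finset.sum_add_distrib,
    ← Finset.mul_sum, ← Complex.re_sum, sum_herm_self, herm_conj, mul_comm (herm (stdBasis n _) x),
    sum_herm_mul_herm, herm_self x]
  simp
  ring

/-- The complex determinant is that of a rank one perturbation of a scalar; the real determinant is
its squared modulus. -/
lemma radialMatrix_det {p q : ℝ} (hp : p ≠ 0) (x : CSpace n) :
    (radialMatrix p q x).det = (p ^ n * (1 + q / p * nsq x)) ^ 2 := by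
  have hp' : (p : ℂ) ≠ 0 := by exact_mod_cast hp
  have h1 : LinearMap.det (radialMap p q x) = ((p ^ n * (1 + q / p * nsq x) : ℝ) : ℂ) := by
    have h2 : LinearMap.toMatrix' (radialMap p q x)
        = (p : ℂ) • (1 + Matrix.replicateCol Unit ((q / p : ℂ) • x)
          * Matrix.replicateRow Unit (star x)) := by
      ext i j
      simp only [LinearMap.toMatrix'_apply, radialMap_apply, Pi.add_apply, Pi.smul_apply,
        smul_eq_mul, Matrix.smul_apply, Matrix.add_apply, Matrix.mul_apply,
        Matrix.replicateCol_apply, Matrix.replicateRow_apply, Finset.univ_unique,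
        Finset.sum_singleton, Matrix.one_apply, Pi.star_apply, RCLike.star_def]
      rw [herm_single_right, Pi.single_apply]
      field_simp
    rw [← LinearMap.det_toMatrix', h2, Matrix.det_smul,
      Matrix.det_one_add_replicateCol_mul_replicateRow, Fintype.card_fin]
    have h3 : star x ⬝ᵥ (q / p : ℂ) • x = (q / p * nsq x : ℂ) := by
      rw [dotProduct_smul, smul_eq_mul, ← herm_self]
      rfl
    rw [h3]
    push_cast
    rfl
  rw [radialMatrix, LinearMap.det_toMatrix, LinearMap.det_restrictScalars, h1,
    Algebra.norm_complex_apply, Complex.normSq_ofReal, sq]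

variable {g : RMetric n} {D D₁ D₂ φ : ℝ → ℝ}

namespace HasProfile

lemma gram_eq (hP : g.HasProfile D D₁ D₂ φ) {x : CSpace n} (hx : x ≠ 0) :
    g.gram x = radialMatrix (φ (nsq x) / nsq x)
      ((D (nsq x) - φ (nsq x) / nsq x) / nsq x) x := by
  ext a b
  rw [gram, Matrix.of_apply, hP.formula x hx, radialMatrix_apply]

lemma gram_inv_eq (hP : g.HasProfile D D₁ D₂ φ) {x : CSpace n} (hx : x ≠ 0) :
    (g.gram x)⁻¹ = radialMatrix (nsq x / φ (nsq x))
      ((1 / D (nsq x) - nsq x / φ (nsq x)) / nsq x) x := by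
  have hs := (nsq_pos hx).ne'
  have hφ := (hP.moment_pos (nsq_pos hx)).ne'
  have hD := (hP.pos (nsq x)).ne'
  refine Matrix.inv_eq_right_inv ?_
  rw [hP.gram_eq hx, radialMatrix_mul, ← radialMatrix_one x]
  congr 1
  · field_simp
  · field_simp
    ring

/-- The complex eigenvalues are `φ/s`, with multiplicity `n-1`, and `D`; the square root undoes the
doubling over `ℝ`. -/
lemma det_gram (hP : g.HasProfile D D₁ D₂ φ) {x : CSpace n} (hx : x ≠ 0) :
    √(g.gram x).det = (φ (nsq x) / nsq x) ^ (n - 1) * D (nsq x) := by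
  have hs := nsq_pos hx
  have hφ := hP.moment_pos hs
  have hD := hP.pos (nsq x)
  have hn : n ≠ 0 := by
    rintro rfl; exact hx (Subsingleton.elim _ _)
  rw [hP.gram_eq hx, radialMatrix_det (by positivity)]
  have : (φ (nsq x) / nsq x) ^ n * (1 + (D (nsq x) - φ (nsq x) / nsq x) / nsq x
      / (φ (nsq x) / nsq x) * nsq x) = (φ (nsq x) / nsq x) ^ (n - 1) * D (nsq x) := by
    rw [← pow_sub_one_mul hn, mul_assoc]
    congr 1
    field_simp
    ring
  rw [this, Real.sqrt_sq (by positivity)]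

/-- The coefficients are the first two derivatives in `s` of the logarithm of the volume density, as
predicted by the Kähler identity `Ric = -∂∂̄ log det`. -/
lemma ric_formula (hP : g.HasProfile D D₁ D₂ φ) {x : CSpace n} (hx : x ≠ 0) (u v : CSpace n) :
    g.ric x u v = -2 * (logDet₁ n D D₁ φ (nsq x) * (herm u v).re
      + logDet₂ n D D₁ D₂ φ (nsq x) * (conj (herm x u) * herm x v).re) := by
  have hs := (nsq_pos hx).ne'
  have hφ := (hP.moment_pos (nsq_pos hx)).ne'
  have hD := (hP.pos (nsq x)).ne'
  have e1 : (n + 1) * coefα D φ (nsq x) + nsq x * coefβ D D₁ φ (nsq x)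
      = logDet₁ n D D₁ φ (nsq x) := by
    rw [coefα, coefβ, logDet₁]; field_simp; ring
  have e2 : (n + 1) * coefα₁ D D₁ φ (nsq x) + nsq x * coefβ₁ D D₁ D₂ φ (nsq x)
      + coefβ D D₁ φ (nsq x) = logDet₂ n D D₁ D₂ φ (nsq x) := by
    rw [coefα₁, coefβ₁, coefβ, logDet₂]; field_simp; ring
  rw [hP.ric_formula' hx, e1, e2]

/-- The real trace doubles the complex one and the Ricci tensor carries a further factor `2`; the
normalization by `4` removes both. -/
theorem kahlerScal_formula (hP : g.HasProfile D D₁ D₂ φ) {x : CSpace n} (hx : x ≠ 0) :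
    g.kahlerScal x = -((n - 1) * (nsq x / φ (nsq x)) * logDet₁ n D D₁ φ (nsq x)
      + (logDet₁ n D D₁ φ (nsq x) + nsq x * logDet₂ n D D₁ D₂ φ (nsq x)) / D (nsq x)) := by
  have hs := (nsq_pos hx).ne'
  have hφ := (hP.moment_pos (nsq_pos hx)).ne'
  have hD := (hP.pos (nsq x)).ne'
  have h1 : ∀ a b, g.ric x (stdBasis n a) (stdBasis n b)
      = radialMatrix (-2 * logDet₁ n D D₁ φ (nsq x)) (-2 * logDet₂ n D D₁ D₂ φ (nsq x)) x b a := by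
    intro a b
    rw [hP.ric_formula hx, radialMatrix_apply, herm_swap_re (stdBasis n a)]
    have : (conj (herm x (stdBasis n a)) * herm x (stdBasis n b)).re
        = (conj (herm x (stdBasis n b)) * herm x (stdBasis n a)).re := by
      simp only [Complex.mul_re, Complex.conj_re, Complex.conj_im]; ring
    rw [this]; ring
  have h2 : g.scal x = ((g.gram x)⁻¹ * radialMatrix (-2 * logDet₁ n D D₁ φ (nsq x))
      (-2 * logDet₂ n D D₁ D₂ φ (nsq x)) x).trace := by
    simp only [scal, h1, Matrix.trace, Matrix.diag_apply, Matrix.mul_apply]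
  rw [kahlerScal, h2, hP.gram_inv_eq hx, radialMatrix_mul, radialMatrix_trace]
  field_simp
  ring

end HasProfile

variable (g)

lemma gram_posDef (x : CSpace n) : (g.gram x).PosDef := by
  refine Matrix.PosDef.of_dotProduct_mulVec_pos ?_ fun v hv => ?_
  · ext a b
    simp [gram, g.symm x (stdBasis n a)]
  · have h0 : ∑ a, v a • stdBasis n a ≠ 0 := fun h =>
      hv (funext fun a => Fintype.linearIndependent_iff.1 (stdBasis n).linearIndependent v h a)
    have h := g.pos x _ h0
    simp only [map_sum, map_smul, _root_.sum_apply, smul_apply, smul_eq_mul] at h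
    refine h.trans_eq ?_
    simp only [dotProduct, Matrix.mulVec, gram, Matrix.of_apply, star_trivial, Finset.mul_sum]
    rw [Finset.sum_comm]
    refine Finset.sum_congr rfl fun a _ => Finset.sum_congr rfl fun b _ => ?_
    ring

lemma gram_det_ne_zero (x : CSpace n) : (g.gram x).det ≠ 0 := (g.gram_posDef x).det_pos.ne'

lemma continuous_gram : Continuous g.gram := by
  refine continuous_matrix fun a b => ?_
  have h : Continuous fun x : CSpace n =>
    ((x, stdBasis n a, stdBasis n b) : CSpace n × CSpace n × CSpace n) := by fun_prop
  exact g.continuous_val_apply.comp h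

lemma continuous_kahlerScal : Continuous g.kahlerScal := by
  have h1 : Continuous fun x => (g.gram x)⁻¹ := by
    simp only [Matrix.inv_def, Ring.inverse_eq_inv']
    exact (g.continuous_gram.matrix_det.inv₀ g.gram_det_ne_zero).smul
      g.continuous_gram.matrix_adjugate
  refine Continuous.div_const ?_ 4
  refine continuous_finsetSum _ fun a _ => continuous_finsetSum _ fun b _ => ?_
  refine (h1.matrix_elem a b).mul ?_
  refine continuous_finsetSum _ fun c _ => ?_
  exact ((LinearMap.continuous_of_finiteDimensional ((stdBasis n).coord c)).comp
    (g.continuous_curv (stdBasis n c) (stdBasis n a) (stdBasis n b)))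

end

end RMetric

namespace RMetric

noncomputable section

open Filter ComplexConjugate

variable {n : ℕ}

/-! ### Norm of the curvature tensor -/

lemma sum_sq_eq {ι κ : Type*} [Fintype ι] [Fintype κ] (P : ι → ι → ℝ) (N : κ → ι → ℝ) (f : ι → ℝ)
    (hP : ∀ a b, P a b = ∑ i, N i a * N i b) :
    ∑ a, ∑ b, P a b * f a * f b = ∑ i, (∑ a, N i a * f a) ^ 2 := by
  simp only [hP, sq, Finset.sum_mul, Finset.mul_sum]
  rw [Finset.sum_congr rfl fun a _ => Finset.sum_comm, Finset.sum_comm]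
  refine Finset.sum_congr rfl fun i _ => Finset.sum_congr rfl fun a _ => Finset.sum_congr rfl fun b _ => ?_
  ring

lemma isLinearMap_sum {ι V : Type*} [Fintype ι] [AddCommGroup V] [Module ℝ V] {F : V → ℝ}
    (h : IsLinearMap ℝ F) (q : ι → ℝ) (e : ι → V) : F (∑ a, q a • e a) = ∑ a, q a * F (e a) := by
  have h1 := map_sum h.mk' (fun a => q a • e a) Finset.univ
  simp only [map_smul, smul_eq_mul] at h1
  exact h1

/-- The square norm of a 4-linear form is the sum of the squares of its values on a frame. -/
lemma quartic_sum_eq {ι κ V : Type*} [Fintype ι] [Fintype κ] [AddCommGroup V] [Module ℝ V]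
    (P : ι → ι → ℝ) (c : κ → ι → ℝ) (hP : ∀ a b, P a b = ∑ i, c i a * c i b) (e : ι → V)
    (f : V → V → V → V → ℝ) (h₁ : ∀ v w z, IsLinearMap ℝ fun u => f u v w z)
    (h₂ : ∀ u w z, IsLinearMap ℝ fun v => f u v w z)
    (h₃ : ∀ u v z, IsLinearMap ℝ fun w => f u v w z)
    (h₄ : ∀ u v w, IsLinearMap ℝ fun z => f u v w z) :
    ∑ a, ∑ b, ∑ c, ∑ d, ∑ a', ∑ b', ∑ c', ∑ d',
      P a a' * P b b' * P c c' * P d d' * f (e a) (e b) (e c) (e d) * f (e a') (e b') (e c') (e d')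
    = ∑ i, ∑ j, ∑ k, ∑ l, f (∑ a, c i a • e a) (∑ a, c j a • e a) (∑ a, c k a • e a)
        (∑ a, c l a • e a) ^ 2 := by
  have l₁ : ∀ (q : ι → ℝ) v w z, f (∑ a, q a • e a) v w z = ∑ a, q a * f (e a) v w z :=
    fun q v w z => isLinearMap_sum (h₁ v w z) q e
  have l₂ : ∀ (q : ι → ℝ) u w z, f u (∑ a, q a • e a) w z = ∑ a, q a * f u (e a) w z :=
    fun q u w z => isLinearMap_sum (h₂ u w z) q e
  have l₃ : ∀ (q : ι → ℝ) u v z, f u v (∑ a, q a • e a) z = ∑ a, q a * f u v (e a) z :=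
    fun q u v z => isLinearMap_sum (h₃ u v z) q e
  have l₄ : ∀ (q : ι → ℝ) u v w, f u v w (∑ a, q a • e a) = ∑ a, q a * f u v w (e a) :=
    fun q u v w => isLinearMap_sum (h₄ u v w) q e
  have key := sum_sq_eq (ι := ι × ι × ι × ι) (κ := κ × κ × κ × κ)
    (fun a b => P a.1 b.1 * P a.2.1 b.2.1 * P a.2.2.1 b.2.2.1 * P a.2.2.2 b.2.2.2)
    (fun i a => c i.1 a.1 * c i.2.1 a.2.1 * c i.2.2.1 a.2.2.1 * c i.2.2.2 a.2.2.2)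
    (fun a => f (e a.1) (e a.2.1) (e a.2.2.1) (e a.2.2.2)) (fun a b => by
      simp only [hP, Fintype.sum_prod_type]
      trans ∑ i, ∑ j, ∑ k, ∑ l, (c i a.1 * c i b.1) * ((c j a.2.1 * c j b.2.1)
        * ((c k a.2.2.1 * c k b.2.2.1) * (c l a.2.2.2 * c l b.2.2.2)))
      · simp only [← Finset.mul_sum, ← Finset.sum_mul]
        ring
      · refine Finset.sum_congr rfl fun i _ => Finset.sum_congr rfl fun j _ =>
          Finset.sum_congr rfl fun k _ => Finset.sum_congr rfl fun l _ => ?_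
        ring)
  simp only [Fintype.sum_prod_type] at key
  rw [key]
  refine Finset.sum_congr rfl fun i _ => Finset.sum_congr rfl fun j _ =>
    Finset.sum_congr rfl fun k _ => Finset.sum_congr rfl fun l _ => ?_
  simp only [l₁, l₂, l₃, l₄, Finset.mul_sum, mul_assoc]

lemma isLinearMap_of {V : Type*} [AddCommGroup V] [Module ℝ V] {f : V → CSpace n}
    (h₁ : ∀ u v, f (u + v) = f u + f v) (h₂ : ∀ (c : ℝ) u, f (c • u) = c • f u) (l : CSpace n →L[ℝ] ℝ) :
    IsLinearMap ℝ fun u => l (f u) :=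
  ⟨fun u v => by rw [h₁, map_add], fun c u => by rw [h₂, map_smul]⟩

section

variable (a b a₁ b₁ : ℝ) (x u v w : CSpace n)

lemma dbar_add₁ (u' : CSpace n) : dbarChristoffel a b a₁ b₁ x (u + u') v w
    = dbarChristoffel a b a₁ b₁ x u v w + dbarChristoffel a b a₁ b₁ x u' v w := by
  simp only [dbarChristoffel, herm_add_right, herm_add_left, map_add]
  module

lemma dbar_smul₁ (c : ℝ) : dbarChristoffel a b a₁ b₁ x (c • u) v w
    = c • dbarChristoffel a b a₁ b₁ x u v w := by
  simp only [dbarChristoffel, real_smul_eq c, herm_smul_right, herm_smul_left, map_mul,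
    Complex.conj_ofReal]
  module

lemma dbar_add₂ (v' : CSpace n) : dbarChristoffel a b a₁ b₁ x u (v + v') w
    = dbarChristoffel a b a₁ b₁ x u v w + dbarChristoffel a b a₁ b₁ x u v' w := by
  simp only [dbarChristoffel, herm_add_right]
  module

lemma dbar_smul₂ (c : ℝ) : dbarChristoffel a b a₁ b₁ x u (c • v) w
    = c • dbarChristoffel a b a₁ b₁ x u v w := by
  simp only [dbarChristoffel, real_smul_eq c, herm_smul_right]
  module

lemma dbar_symm : dbarChristoffel a b a₁ b₁ x u v w = dbarChristoffel a b a₁ b₁ x u w v := by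
  simp only [dbarChristoffel]
  module

end

variable {g : RMetric n} {D D₁ D₂ φ : ℝ → ℝ}

namespace HasProfile

/-- A bound of the curvature tensor on a frame bounds its norm. -/
lemma rmNorm_le (hP : g.HasProfile D D₁ D₂ φ) {x : CSpace n} (hx : x ≠ 0) {K : ℝ} (hK : 0 ≤ K)
    (h : ∀ u v w z, |g.rm x u v w z|
      ≤ K * (√(g.val x u u) * √(g.val x v v) * √(g.val x w w) * √(g.val x z z))) :
    g.rmNorm x ≤ (2 * n) ^ 2 * K := by
  -- The inverse Gram matrix is written as `∑ c_i c_iᵀ`, so `|Rm|²` is a sum of squares over the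
  -- vectors `E i` with coordinates `c i`. These need not be orthonormal: only `∑ g(E i, E i) = 2n`
  -- is used.
  obtain ⟨m, c, hc⟩ := Matrix.posSemidef_iff_eq_sum_vecMulVec.1 (g.gram_posDef x).inv.posSemidef
  have hP' : ∀ a b, (g.gram x)⁻¹ a b = ∑ i, c i a * c i b := fun a b => by
    rw [hc, Matrix.sum_apply]
    simp [Matrix.vecMulVec_apply]
  have hrm : ∀ u v w z, g.rm x u v w z = g.val x (dbarChristoffel (coefα D φ (nsq x))
        (coefβ D D₁ φ (nsq x)) (coefα₁ D D₁ φ (nsq x)) (coefβ₁ D D₁ D₂ φ (nsq x)) x u v w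
      - dbarChristoffel (coefα D φ (nsq x)) (coefβ D D₁ φ (nsq x)) (coefα₁ D D₁ φ (nsq x))
        (coefβ₁ D D₁ D₂ φ (nsq x)) x v u w) z := fun u v w z => by
    rw [rm, hP.curv_formula hx]
  have hz : ∀ z, ∀ y, g.val x y z = g.val x z y := fun z y => g.symm x y z
  have key := quartic_sum_eq _ c hP' (stdBasis n) (g.rm x)
    (fun v w z => by
      simp only [hrm, hz z]
      refine isLinearMap_of (fun u u' => ?_) (fun r u => ?_) (g.val x z)
      · rw [dbar_add₁, dbar_add₂]; abel
      · rw [dbar_smul₁, dbar_smul₂, smul_sub])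
    (fun u w z => by
      simp only [hrm, hz z]
      refine isLinearMap_of (fun u u' => ?_) (fun r u => ?_) (g.val x z)
      · rw [dbar_add₁, dbar_add₂]; abel
      · rw [dbar_smul₁, dbar_smul₂, smul_sub])
    (fun u v z => by
      simp only [hrm, hz z]
      refine isLinearMap_of (fun w w' => ?_) (fun r w => ?_) (g.val x z)
      · simp only [dbar_symm _ _ _ _ x _ _ (_ + _), dbar_add₂, dbar_symm _ _ _ _ x _ _ w,
          dbar_symm _ _ _ _ x _ _ w']
        abel
      · rw [dbar_symm, dbar_smul₂, dbar_symm _ _ _ _ x v, dbar_smul₂, smul_sub,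
          dbar_symm _ _ _ _ x _ w, dbar_symm _ _ _ _ x _ w])
    (fun u v w => ⟨fun z z' => by simp only [rm, map_add], fun r z => by
      simp only [rm, map_smul, smul_eq_mul]⟩)
  rw [rmNorm, key]
  set E : Fin m → CSpace n := fun i => ∑ a, c i a • stdBasis n a with hE
  have hpos : ∀ i, 0 ≤ g.val x (E i) (E i) := fun i => by
    rcases eq_or_ne (E i) 0 with h0 | h0
    · simp [h0]
    · exact (g.pos x _ h0).le
  have htr : ∑ i, g.val x (E i) (E i) = 2 * n := by
    have h1 : ((g.gram x)⁻¹ * g.gram x).trace = 2 * n := by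
      rw [Matrix.nonsing_inv_mul _ (g.gram_det_ne_zero x).isUnit, Matrix.trace_one]
      simp [RIndex, mul_comm]
    rw [← h1]
    simp only [hE, map_sum, map_smul, _root_.sum_apply, smul_apply, smul_eq_mul, Matrix.trace,
      Matrix.diag_apply, Matrix.mul_apply, hP', Finset.sum_mul, Finset.mul_sum]
    rw [Finset.sum_comm]
    refine Finset.sum_congr rfl fun a _ => ?_
    rw [Finset.sum_comm]
    refine Finset.sum_congr rfl fun b _ => Finset.sum_congr rfl fun i _ => ?_
    rw [gram, Matrix.of_apply]
    ring
  refine Real.sqrt_le_iff.2 ⟨by positivity, ?_⟩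
  have hb : ∀ i j k l, g.rm x (E i) (E j) (E k) (E l) ^ 2 ≤ K ^ 2 * (g.val x (E i) (E i)
      * (g.val x (E j) (E j) * (g.val x (E k) (E k) * g.val x (E l) (E l)))) := by
    intro i j k l
    have h1 := h (E i) (E j) (E k) (E l)
    have h2 := pow_le_pow_left₀ (abs_nonneg _) h1 2
    rw [sq_abs] at h2
    refine h2.trans_eq ?_
    simp only [mul_pow, Real.sq_sqrt (hpos _)]
    ring
  calc _ ≤ ∑ i, ∑ j, ∑ k, ∑ l, K ^ 2 * (g.val x (E i) (E i)
      * (g.val x (E j) (E j) * (g.val x (E k) (E k) * g.val x (E l) (E l)))) := by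
        gcongr with i _ j _ k _ l _
        exact hb i j k l
    _ = ((2 * n) ^ 2 * K) ^ 2 := by
        simp only [← Finset.mul_sum, htr, ← Finset.sum_mul]
        ring

end HasProfile

end

end RMetric

namespace RMetric

noncomputable section

open Filter ComplexConjugate

variable {n : ℕ}

/-! ### Radial and orthogonal components of the curvature -/

/-- The Hermitian form of the components orthogonal to `x`. -/
def hermPerp (x u v : CSpace n) : ℂ := herm u v - conj (herm x u) * herm x v / nsq x

lemma hermPerp_eq {x : CSpace n} (hx : x ≠ 0) (u v : CSpace n) :
    hermPerp x u v = herm (u - (herm x u / nsq x : ℂ) • x) (v - (herm x v / nsq x : ℂ) • x) := by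
  have hs : (nsq x : ℂ) ≠ 0 := by exact_mod_cast (nsq_pos hx).ne'
  simp only [hermPerp, herm_sub_left, herm_sub_right, herm_smul_left, herm_smul_right, herm_self,
    map_div₀, Complex.conj_ofReal, herm_conj]
  field_simp
  ring

/-- A sum of the four types of components of the curvature is bounded by the sum of the bounds. -/
lemma norm_components_le {c₁ c₂ c₃ c₄ p q : ℝ} {N₁ N₂ N₃ N₄ : ℝ} {huv huw hzw hzv u v w z : ℂ}
    (hp : 0 ≤ p) (h1 : 0 ≤ N₁) (h2 : 0 ≤ N₂) (h3 : 0 ≤ N₃)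
    (huv' : ‖huv‖ ≤ p * (N₁ * N₂)) (huw' : ‖huw‖ ≤ p * (N₁ * N₃)) (hzw' : ‖hzw‖ ≤ p * (N₄ * N₃))
    (hzv' : ‖hzv‖ ≤ p * (N₄ * N₂)) (hu : ‖u‖ ≤ q * N₁) (hv : ‖v‖ ≤ q * N₂) (hw : ‖w‖ ≤ q * N₃)
    (hz : ‖z‖ ≤ q * N₄) :
    ‖(c₁ : ℂ) * (huv * hzw + huw * hzv) + c₂ * (huv * w * conj z + huw * v * conj z)
        + c₃ * (conj u * v * hzw + conj u * w * hzv) + c₄ * (conj u * v * w * conj z)‖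
      ≤ (2 * |c₁| * p ^ 2 + 2 * |c₂| * (p * q ^ 2) + 2 * |c₃| * (p * q ^ 2) + |c₄| * q ^ 4)
        * (N₁ * N₂ * N₃ * N₄) := by
  have hu0 := (norm_nonneg u).trans hu
  have hv0 := (norm_nonneg v).trans hv
  have hw0 := (norm_nonneg w).trans hw
  calc _ ≤ |c₁| * (‖huv‖ * ‖hzw‖ + ‖huw‖ * ‖hzv‖)
      + |c₂| * (‖huv‖ * ‖w‖ * ‖z‖ + ‖huw‖ * ‖v‖ * ‖z‖)
      + |c₃| * (‖u‖ * ‖v‖ * ‖hzw‖ + ‖u‖ * ‖w‖ * ‖hzv‖) + |c₄| * (‖u‖ * ‖v‖ * ‖w‖ * ‖z‖) := by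
        refine (norm_add_le _ _).trans (add_le_add ((norm_add_le _ _).trans (add_le_add
          ((norm_add_le _ _).trans (add_le_add ?_ ?_)) ?_)) ?_)
        · rw [norm_mul, Complex.norm_real, Real.norm_eq_abs]
          gcongr
          exact (norm_add_le _ _).trans_eq (by simp)
        · rw [norm_mul, Complex.norm_real, Real.norm_eq_abs]
          gcongr
          exact (norm_add_le _ _).trans_eq (by simp)
        · rw [norm_mul, Complex.norm_real, Real.norm_eq_abs]
          gcongr
          exact (norm_add_le _ _).trans_eq (by simp)
        · simp
    _ ≤ |c₁| * ((p * (N₁ * N₂)) * (p * (N₄ * N₃)) + (p * (N₁ * N₃)) * (p * (N₄ * N₂)))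
      + |c₂| * ((p * (N₁ * N₂)) * (q * N₃) * (q * N₄) + (p * (N₁ * N₃)) * (q * N₂) * (q * N₄))
      + |c₃| * ((q * N₁) * (q * N₂) * (p * (N₄ * N₃)) + (q * N₁) * (q * N₃) * (p * (N₄ * N₂)))
      + |c₄| * ((q * N₁) * (q * N₂) * (q * N₃) * (q * N₄)) := by gcongr
    _ = _ := by ring

/-- The curvature bound of a radial Kähler metric at the points with `|x|² = s`. -/
def curvBound (D D₁ D₂ φ : ℝ → ℝ) (s : ℝ) : ℝ :=
  2 * |s * coefα D φ s| / φ s + 2 * |s * coefα D φ s + s ^ 2 * coefβ D D₁ φ s| / φ s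
    + 2 * |s ^ 2 * coefα₁ D D₁ φ s + s * coefα D φ s| / (s * D s)
    + |2 * s ^ 2 * coefα₁ D D₁ φ s + 2 * s * coefα D φ s + s ^ 3 * coefβ₁ D D₁ D₂ φ s
      + 2 * s ^ 2 * coefβ D D₁ φ s| / (s * D s)

variable {g : RMetric n} {D D₁ D₂ φ : ℝ → ℝ}

namespace HasProfile

lemma val_eq_perp (hP : g.HasProfile D D₁ D₂ φ) {x : CSpace n} (hx : x ≠ 0) (u v : CSpace n) :
    g.val x u v = (φ (nsq x) / nsq x * hermPerp x v u
      + D (nsq x) / nsq x * (conj (herm x v) * herm x u) : ℂ).re := by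
  have hs := (nsq_pos hx).ne'
  have hs' : (nsq x : ℂ) ≠ 0 := by exact_mod_cast hs
  rw [hP.formula x hx]
  have e : (φ (nsq x) / nsq x * hermPerp x v u
      + D (nsq x) / nsq x * (conj (herm x v) * herm x u) : ℂ)
      = ((φ (nsq x) / nsq x : ℝ) : ℂ) * herm v u
        + (((D (nsq x) - φ (nsq x) / nsq x) / nsq x : ℝ) : ℂ) * (conj (herm x v) * herm x u) := by
    rw [hermPerp]; push_cast; field_simp; ring
  rw [e, Complex.add_re, Complex.re_ofReal_mul, Complex.re_ofReal_mul, herm_swap_re u v]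
  simp only [Complex.mul_re, Complex.conj_re, Complex.conj_im]
  ring

/-- The complex line of `x` and its Hermitian complement are also `g`-orthogonal, so each component
of `u` is at most as long as `u`. -/
lemma perp_bounds (hP : g.HasProfile D D₁ D₂ φ) {x : CSpace n} (hx : x ≠ 0) (u : CSpace n) :
    √(nsq (u - (herm x u / nsq x : ℂ) • x)) ≤ √(nsq x / φ (nsq x)) * √(g.val x u u) ∧
      ‖herm x u‖ ≤ √(nsq x / D (nsq x)) * √(g.val x u u) := by
  have hs := nsq_pos hx
  have hφ := hP.moment_pos hs
  have hD := hP.pos (nsq x)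
  set y := u - (herm x u / nsq x : ℂ) • x
  have e : g.val x u u = φ (nsq x) / nsq x * nsq y + D (nsq x) / nsq x * ‖herm x u‖ ^ 2 := by
    rw [hP.val_eq_perp hx, hermPerp_eq hx, herm_self, ← Complex.normSq_eq_conj_mul_self,
      Complex.normSq_eq_norm_sq]
    norm_cast
  have hy := nsq_nonneg y
  constructor
  · rw [← Real.sqrt_mul (by positivity)]
    refine Real.sqrt_le_sqrt ?_
    rw [e]
    have : nsq x / φ (nsq x) * (φ (nsq x) / nsq x * nsq y + D (nsq x) / nsq x * ‖herm x u‖ ^ 2)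
        = nsq y + D (nsq x) / φ (nsq x) * ‖herm x u‖ ^ 2 := by field_simp
    rw [this]
    have : 0 ≤ D (nsq x) / φ (nsq x) * ‖herm x u‖ ^ 2 := by positivity
    linarith
  · rw [← Real.sqrt_mul (by positivity)]
    refine Real.le_sqrt_of_sq_le ?_
    rw [e]
    have : nsq x / D (nsq x) * (φ (nsq x) / nsq x * nsq y + D (nsq x) / nsq x * ‖herm x u‖ ^ 2)
        = ‖herm x u‖ ^ 2 + φ (nsq x) / D (nsq x) * nsq y := by field_simp; ring
    rw [this]
    have : 0 ≤ φ (nsq x) / D (nsq x) * nsq y := by positivity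
    linarith

lemma norm_hermPerp_le (hP : g.HasProfile D D₁ D₂ φ) {x : CSpace n} (hx : x ≠ 0)
    (u v : CSpace n) :
    ‖hermPerp x u v‖ ≤ nsq x / φ (nsq x) * (√(g.val x u u) * √(g.val x v v)) := by
  have hs := nsq_pos hx
  have hφ := hP.moment_pos hs
  have h := normSq_herm_le (u - (herm x u / nsq x : ℂ) • x) (v - (herm x v / nsq x : ℂ) • x)
  rw [← hermPerp_eq hx, Complex.normSq_eq_norm_sq] at h
  have h1 := Real.le_sqrt_of_sq_le h
  rw [Real.sqrt_mul (nsq_nonneg _)] at h1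
  refine h1.trans ((mul_le_mul (hP.perp_bounds hx u).1 (hP.perp_bounds hx v).1
    (Real.sqrt_nonneg _) (by positivity)).trans_eq ?_)
  have := Real.mul_self_sqrt (show 0 ≤ nsq x / φ (nsq x) by positivity)
  linear_combination (√(g.val x u u) * √(g.val x v v)) * this

lemma abs_val_dbar_le (hP : g.HasProfile D D₁ D₂ φ) {x : CSpace n} (hx : x ≠ 0)
    (u v w z : CSpace n) :
    |g.val x (dbarChristoffel (coefα D φ (nsq x)) (coefβ D D₁ φ (nsq x)) (coefα₁ D D₁ φ (nsq x))
        (coefβ₁ D D₁ D₂ φ (nsq x)) x u v w) z| ≤ curvBound D D₁ D₂ φ (nsq x)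
      * (√(g.val x u u) * √(g.val x v v) * √(g.val x w w) * √(g.val x z z)) := by
  have hs := nsq_pos hx
  have hφ := hP.moment_pos hs
  have hD := hP.pos (nsq x)
  have hs' : (nsq x : ℂ) ≠ 0 := by exact_mod_cast hs.ne'
  rw [curvBound]
  generalize coefα D φ (nsq x) = a
  generalize coefβ D D₁ φ (nsq x) = b
  generalize coefα₁ D D₁ φ (nsq x) = a₁
  generalize coefβ₁ D D₁ D₂ φ (nsq x) = b₁
  -- Components with an odd number of radial entries vanish. The rest have none, two (in two
  -- arrangements) or four, which accounts for the four summands of `curvBound`.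
  have e : (φ (nsq x) / nsq x * hermPerp x z (dbarChristoffel a b a₁ b₁ x u v w)
      + D (nsq x) / nsq x * (conj (herm x z) * herm x (dbarChristoffel a b a₁ b₁ x u v w)) : ℂ)
      = ((φ (nsq x) / nsq x * a : ℝ) : ℂ)
          * (hermPerp x u v * hermPerp x z w + hermPerp x u w * hermPerp x z v)
        + ((D (nsq x) / nsq x * (a + nsq x * b) : ℝ) : ℂ) * (hermPerp x u v * herm x w
          * conj (herm x z) + hermPerp x u w * herm x v * conj (herm x z))
        + ((φ (nsq x) / nsq x * (a₁ + a / nsq x) : ℝ) : ℂ) * (conj (herm x u) * herm x v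
          * hermPerp x z w + conj (herm x u) * herm x w * hermPerp x z v)
        + ((D (nsq x) / nsq x ^ 3 * (2 * nsq x ^ 2 * a₁ + 2 * nsq x * a + nsq x ^ 3 * b₁
          + 2 * nsq x ^ 2 * b) : ℝ) : ℂ) * (conj (herm x u) * herm x v * herm x w
          * conj (herm x z)) := by
    simp only [hermPerp, dbarChristoffel, herm_add_right, herm_smul_right, herm_self]
    rw [← herm_conj x z]
    push_cast
    field_simp
    ring
  rw [hP.val_eq_perp hx, e]
  refine (Complex.abs_re_le_norm _).trans ((norm_components_le (p := nsq x / φ (nsq x))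
    (q := √(nsq x / D (nsq x))) (by positivity) (Real.sqrt_nonneg (g.val x u u))
    (Real.sqrt_nonneg (g.val x v v)) (Real.sqrt_nonneg (g.val x w w))
    (hP.norm_hermPerp_le hx u v) (hP.norm_hermPerp_le hx u w)
    (hP.norm_hermPerp_le hx z w) (hP.norm_hermPerp_le hx z v) (hP.perp_bounds hx u).2
    (hP.perp_bounds hx v).2 (hP.perp_bounds hx w).2 (hP.perp_bounds hx z).2).trans_eq ?_)
  congr 1
  have hq : √(nsq x / D (nsq x)) ^ 2 = nsq x / D (nsq x) := Real.sq_sqrt (by positivity)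
  have hq4 : √(nsq x / D (nsq x)) ^ 4 = (nsq x / D (nsq x)) ^ 2 := by
    rw [show (4 : ℕ) = 2 * 2 from rfl, pow_mul, hq]
  rw [hq, hq4]
  have f1 : |nsq x * a| = nsq x * |a| := by rw [abs_mul, abs_of_pos hs]
  have f2 : |nsq x * a + nsq x ^ 2 * b| = nsq x * |a + nsq x * b| := by
    rw [← abs_of_pos hs, ← abs_mul, abs_of_pos hs]; ring_nf
  have f3 : |nsq x ^ 2 * a₁ + nsq x * a| = nsq x ^ 2 * |a₁ + a / nsq x| := by
    rw [← abs_of_pos (pow_pos hs 2), ← abs_mul, abs_of_pos (pow_pos hs 2)]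
    congr 1; field_simp
  have g1 : |φ (nsq x) / nsq x * a| = φ (nsq x) / nsq x * |a| := by
    rw [abs_mul, abs_of_pos (by positivity)]
  have g2 : |D (nsq x) / nsq x * (a + nsq x * b)| = D (nsq x) / nsq x * |a + nsq x * b| := by
    rw [abs_mul, abs_of_pos (by positivity)]
  have g3 : |φ (nsq x) / nsq x * (a₁ + a / nsq x)| = φ (nsq x) / nsq x * |a₁ + a / nsq x| := by
    rw [abs_mul, abs_of_pos (by positivity)]
  rw [f1, f2, f3, g1, g2, g3, abs_mul, abs_of_pos (show 0 < D (nsq x) / nsq x ^ 3 by positivity)]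
  field_simp

theorem rmNorm_le_curvBound (hP : g.HasProfile D D₁ D₂ φ) {x : CSpace n} (hx : x ≠ 0) :
    g.rmNorm x ≤ (2 * n) ^ 2 * (2 * curvBound D D₁ D₂ φ (nsq x)) := by
  have hφ := hP.moment_pos (nsq_pos hx)
  have hD := hP.pos (nsq x)
  have hs := nsq_pos hx
  refine hP.rmNorm_le hx (by rw [curvBound]; positivity) fun u v w z => ?_
  rw [rm, hP.curv_formula hx, map_sub, sub_apply]
  refine (abs_sub _ _).trans ((add_le_add (hP.abs_val_dbar_le hx u v w z)
    (hP.abs_val_dbar_le hx v u w z)).trans_eq ?_)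
  ring

end HasProfile

end

end RMetric

namespace RMetric

noncomputable section

open Filter ComplexConjugate

variable {n : ℕ}

/-! ### The soliton equation -/

/-- The derivative of `f` in the direction of the holomorphic linear vector field `c x`. -/
def linDeriv (f : CSpace n → ℝ) (c : ℂ) (x : CSpace n) : ℝ := fderiv ℝ f x (c • x)

lemma linDeriv_rsmul (f : CSpace n → ℝ) (r : ℝ) (c : ℂ) (x : CSpace n) :
    linDeriv f (r * c) x = r * linDeriv f c x := by
  rw [linDeriv, mul_smul, ← real_smul_eq, map_smul]; rfl

variable {g : RMetric n} {D D₁ D₂ φ : ℝ → ℝ}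

namespace HasProfile

/-- Differentiating `df(cx)` along `c'x` gives `∇²f(c'x, cx)`, which is the Ricci term, plus `df` of
`Γ(c'x, cx) + c'c x`. By complex bilinearity this vector is a real multiple of `c'c x`, so the
system closes on the functions `linDeriv f`. -/
lemma linDeriv_hasDerivAt (hP : g.HasProfile D D₁ D₂ φ) {f : CSpace n → ℝ}
    (hf : ContDiff ℝ ∞ f) (hS : ∀ x u v, g.ric x u v = g.hess f x u v) {γ : ℝ → CSpace n} {t : ℝ}
    {c' : ℂ} (hγ : HasDerivAt γ (c' • γ t) t) (h0 : γ t ≠ 0) (c : ℂ) :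
    HasDerivAt (fun τ => linDeriv f c (γ τ))
      (-2 * (nsq (γ t) * logDet₁ n D D₁ φ (nsq (γ t)) + nsq (γ t) ^ 2
          * logDet₂ n D D₁ D₂ φ (nsq (γ t))) * (conj c' * c).re
        + (1 + nsq (γ t) * D₁ (nsq (γ t)) / D (nsq (γ t))) * linDeriv f (c' * c) (γ t)) t := by
  set x := γ t with hx
  have hs := (nsq_pos h0).ne'
  have hφ := (hP.moment_pos (nsq_pos h0)).ne'
  have hD := (hP.pos (nsq x)).ne'
  have hdf : Differentiable ℝ (fderiv ℝ f) :=
    (hf.fderiv_right (m := ∞) (by simp)).differentiable (by simp)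
  have d1 : HasDerivAt (fun τ => fderiv ℝ f (γ τ)) (fderiv ℝ (fderiv ℝ f) x (c' • x)) t :=
    HasFDerivAt.comp_hasDerivAt (l := fderiv ℝ f) t (hdf (γ t)).hasFDerivAt hγ
  have d2 := d1.clm_apply (hγ.const_smul c)
  have hh := hS x (c' • x) (c • x)
  have e1 : fderiv ℝ (fun y => fderiv ℝ f y (c • x)) x (c' • x)
      = fderiv ℝ (fderiv ℝ f) x (c' • x) (c • x) := by
    rw [fderiv_clm_apply (hdf x) (differentiableAt_const _)]
    simp
  have e2 : g.christoffel x (c' • x) (c • x) = (nsq x * D₁ (nsq x) / D (nsq x)) • ((c' * c) • x) := by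
    rw [hP.christoffel_formula h0, real_smul_eq]
    simp only [herm_smul_right, herm_self]
    have : nsq x * D₁ (nsq x) / D (nsq x)
        = 2 * nsq x * coefα D φ (nsq x) + nsq x ^ 2 * coefβ D D₁ φ (nsq x) := by
      rw [coefα, coefβ]; field_simp; ring
    rw [this]
    push_cast
    module
  rw [hess, e1, e2, (fderiv ℝ f x).map_smul (_ : ℝ), smul_eq_mul, hP.ric_formula h0] at hh
  simp only [herm_smul_left, herm_smul_right, herm_self, map_mul, Complex.conj_ofReal] at hh
  refine d2.congr_deriv ?_
  have e3 : linDeriv f (c' * c) x = fderiv ℝ f x (c • c' • x) := by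
    rw [linDeriv, smul_smul, mul_comm]
  have e4 : fderiv ℝ f x ((c' * c) • x) = linDeriv f (c' * c) x := rfl
  have e5 : ∀ r : ℝ, (c * (conj c' * r) : ℂ).re = r * (conj c' * c).re := fun r => by
    rw [← mul_assoc, mul_comm, Complex.re_ofReal_mul, mul_comm c]
  have e6 : (conj c' * nsq x * (c * nsq x) : ℂ).re = nsq x ^ 2 * (conj c' * c).re := by
    rw [← Complex.re_ofReal_mul]; congr 1; push_cast; ring
  rw [e4, e5, e6] at hh
  rw [e3] at hh ⊢
  rw [Pi.smul_apply, ← hx]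
  linarith

lemma logDet₁_hasDerivAt (hP : g.HasProfile D D₁ D₂ φ) {s : ℝ} (hs : 0 < s) :
    HasDerivAt (logDet₁ n D D₁ φ) (logDet₂ n D D₁ D₂ φ s) s := by
  have hφ := (hP.moment_pos hs).ne'
  have hD := (hP.pos s).ne'
  have h := (((((hP.deriv₁ s hs).fun_div (hP.moment s) hφ).fun_sub
    ((hasDerivAt_const s (1 : ℝ)).fun_div (hasDerivAt_id' s) hs.ne')).const_mul ((n : ℝ) - 1))).fun_add
    ((hP.deriv₂ s hs).fun_div (hP.deriv₁ s hs) hD)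
  refine h.congr_deriv ?_
  rw [logDet₂]
  field_simp
  ring

/-- The derivative along the circles of the potential is a multiple of `√ψ` on each ray. -/
lemma linDeriv_I_ray (hP : g.HasProfile D D₁ D₂ φ) {f : CSpace n → ℝ}
    (hf : ContDiff ℝ ∞ f) (hS : ∀ x u v, g.ric x u v = g.hess f x u v) {y : CSpace n}
    (hy : nsq y = 1) {τ : ℝ} (hτ : 0 < τ) :
    linDeriv f Complex.I (τ • y) = linDeriv f Complex.I y * (τ * √(D (τ ^ 2)) / √(D 1)) := by
  have hy0 : y ≠ 0 := by rintro rfl; simp [nsq_zero] at hy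
  have hder : ∀ t, 0 < t →
      HasDerivAt (fun t : ℝ => linDeriv f Complex.I (t • y) / (t * √(D (t ^ 2)))) 0 t := by
    intro t ht
    have hD := hP.pos (t ^ 2)
    have hsq : 0 < √(D (t ^ 2)) := Real.sqrt_pos.2 hD
    have hγ : HasDerivAt (fun t : ℝ => t • y) ((1 / t : ℂ) • t • y) t := by
      refine (smul_ray_hasDerivAt y t).congr_deriv ?_
      have : (t : ℂ) ≠ 0 := by exact_mod_cast ht.ne'
      rw [real_smul_eq, smul_smul, one_div_mul_cancel this, one_smul]
    have h1 := hP.linDeriv_hasDerivAt hf hS hγ (smul_ne_zero ht.ne' hy0) Complex.I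
    -- The radial and rotational directions are orthogonal for `Ric`, so the equation is
    -- homogeneous, with solution `t √D(t²)`.
    have e1 : (conj (1 / t : ℂ) * Complex.I).re = 0 := by
      rw [← Complex.ofReal_one, ← Complex.ofReal_div, Complex.conj_ofReal, Complex.re_ofReal_mul]
      simp
    have e2 : linDeriv f ((1 / t : ℂ) * Complex.I) (t • y) = 1 / t * linDeriv f Complex.I (t • y) := by
      rw [← linDeriv_rsmul]; push_cast; rfl
    rw [e1, e2, nsq_rsmul, hy, mul_one, mul_zero, zero_add] at h1
    have h2 : HasDerivAt (fun t : ℝ => √(D (t ^ 2))) (D₁ (t ^ 2) * (2 * t) / (2 * √(D (t ^ 2)))) t := by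
      have h0 : HasDerivAt (fun t : ℝ => t ^ 2) (2 * t) t := by
        simpa using (hasDerivAt_id' t).fun_pow 2
      have : HasDerivAt (fun t : ℝ => D (t ^ 2)) (D₁ (t ^ 2) * (2 * t)) t :=
        (hP.deriv₁ (t ^ 2) (by positivity)).comp t h0
      exact this.sqrt hD.ne'
    have h3 := h1.fun_div ((hasDerivAt_id' t).fun_mul h2) (by positivity)
    refine h3.congr_deriv ?_
    have hq : √(D (t ^ 2)) ^ 2 = D (t ^ 2) := Real.sq_sqrt hD.le
    field_simp
    rw [hq]
    field_simp
    ring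
  have h := eqOn_Ioi_of_hasDerivAt_zero hder hτ one_pos
  have h1 := Real.sqrt_pos.2 (hP.pos (τ ^ 2))
  have h2 := Real.sqrt_pos.2 (hP.pos 1)
  simp only [one_smul, one_pow, one_mul] at h
  field_simp at h ⊢
  linarith

/-- On a suitable ray the potential satisfies the equations of a radial potential. -/
lemma exists_radial_ray (hP : g.HasProfile D D₁ D₂ φ) {f : CSpace n → ℝ}
    (hf : ContDiff ℝ ∞ f) (hS : ∀ x u v, g.ric x u v = g.hess f x u v) {e : CSpace n}
    (he : nsq e = 1) : ∃ y : CSpace n, nsq y = 1 ∧ ∀ τ : ℝ, 0 < τ →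
      -2 * (τ ^ 2 * logDet₁ n D D₁ φ (τ ^ 2) + (τ ^ 2) ^ 2 * logDet₂ n D D₁ D₂ φ (τ ^ 2))
        = (1 + τ ^ 2 * D₁ (τ ^ 2) / D (τ ^ 2)) * linDeriv f 1 (τ • y) := by
  have hcont : Continuous fun c : Circle => linDeriv f Complex.I ((c : ℂ) • e) := by
    have h1 : Continuous fun c : Circle => (c : ℂ) • e := by fun_prop
    have h2 : Continuous fun c : Circle => Complex.I • (c : ℂ) • e := by fun_prop
    exact ((hf.continuous_fderiv (by simp)).comp h1).clm_apply h2
  -- A maximum of the rotational derivative `df(ix)` over the circle: there its own rotational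
  -- derivative vanishes, which is the missing second equation for `df(x)`.
  obtain ⟨c₀, -, hmax⟩ := isCompact_univ.exists_isMaxOn Set.univ_nonempty hcont.continuousOn
  have hun : ∀ c : Circle, nsq ((c : ℂ) • e) = 1 := fun c => by
    rw [nsq_smul, Circle.normSq_coe, he, one_mul]
  refine ⟨(c₀ : ℂ) • e, hun c₀, fun τ hτ => ?_⟩
  set y := (c₀ : ℂ) • e with hy
  have hy0 : τ • y ≠ 0 := by
    refine smul_ne_zero hτ.ne' ?_
    intro h; have := hun c₀; rw [← hy, h, nsq_zero] at this; simp at this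
  let γ : ℝ → CSpace n := fun θ => Complex.exp (θ * Complex.I) • τ • y
  have hγ0 : γ 0 = τ • y := by simp [γ]
  have hγ : HasDerivAt γ (Complex.I • γ 0) 0 := by
    have h1 : HasDerivAt (fun θ : ℝ => Complex.exp (θ * Complex.I)) Complex.I 0 := by
      have h2 : HasDerivAt (fun θ : ℝ => (θ : ℂ) * Complex.I) Complex.I 0 := by
        simpa using ((hasDerivAt_id' (0 : ℝ)).ofReal_comp).mul_const Complex.I
      simpa using h2.cexp
    have := h1.smul_const (τ • y)
    rw [hγ0]
    exact this
  have h1 := hP.linDeriv_hasDerivAt hf hS hγ (by rwa [hγ0]) Complex.I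
  -- By `linDeriv_I_ray` the values at radius `τ` are those at radius `1` times a nonnegative factor
  -- independent of the phase, so the same `c₀` is a maximum at every radius.
  have hlm : IsLocalMax (fun θ => linDeriv f Complex.I (γ θ)) 0 := by
    refine Eventually.of_forall fun θ => ?_
    have e1 : γ θ = τ • (((Circle.exp θ * c₀ : Circle) : ℂ) • e) := by
      simp only [γ, hy, Circle.coe_mul, Circle.coe_exp]
      rw [smul_comm, mul_smul]
    simp only
    rw [e1, hγ0, hP.linDeriv_I_ray hf hS (hun _) hτ, hP.linDeriv_I_ray hf hS (hun c₀) hτ]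
    exact mul_le_mul_of_nonneg_right (hmax (Set.mem_univ _)) (by positivity)
  have h2 := hlm.hasDerivAt_eq_zero h1
  have e1 : linDeriv f (Complex.I * Complex.I) (γ 0) = -linDeriv f 1 (γ 0) := by
    have := linDeriv_rsmul f (-1) 1 (γ 0)
    rw [Complex.I_mul_I]
    simpa using this
  rw [e1, hγ0, nsq_rsmul, hun c₀, mul_one] at h2
  simp only [Complex.conj_I, neg_mul, Complex.I_mul_I, neg_neg, Complex.one_re, mul_one] at h2
  linarith

/-- The soliton equation, integrated twice. -/
theorem soliton_ode (hP : g.HasProfile D D₁ D₂ φ) (hS : g.IsSteadyGradientSoliton)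
    {e : CSpace n} (he : nsq e = 1) : ∃ a : ℝ,
      (∀ s, 0 < s → logDet₁ n D D₁ φ s = -a * D s) ∧
      ∀ s, 0 < s → (n - 1) * Real.log (φ s / s) + Real.log (D s) + a * φ s = n * Real.log (D 0) := by
  obtain ⟨f, hf, hS⟩ := hS
  obtain ⟨y, hy, hray⟩ := hP.exists_radial_ray hf hS he
  have hy0 : y ≠ 0 := by rintro rfl; simp [nsq_zero] at hy
  have hder : ∀ t, 0 < t →
      HasDerivAt (fun t : ℝ => linDeriv f 1 (t • y) / (t ^ 2 * D (t ^ 2))) 0 t := by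
    intro t ht
    have hD := hP.pos (t ^ 2)
    have hγ : HasDerivAt (fun t : ℝ => t • y) ((1 / t : ℂ) • t • y) t := by
      refine (smul_ray_hasDerivAt y t).congr_deriv ?_
      have : (t : ℂ) ≠ 0 := by exact_mod_cast ht.ne'
      rw [real_smul_eq, smul_smul, one_div_mul_cancel this, one_smul]
    have h1 := hP.linDeriv_hasDerivAt hf hS hγ (smul_ne_zero ht.ne' hy0) 1
    have e1 : (conj (1 / t : ℂ) * 1).re = 1 / t := by
      rw [← Complex.ofReal_one, ← Complex.ofReal_div, Complex.conj_ofReal, Complex.re_ofReal_mul]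
      simp
    have e2 : linDeriv f ((1 / t : ℂ) * 1) (t • y) = 1 / t * linDeriv f 1 (t • y) := by
      rw [← linDeriv_rsmul]; push_cast; rfl
    rw [e1, e2, nsq_rsmul, hy, mul_one, hray t ht] at h1
    have h0 : HasDerivAt (fun t : ℝ => t ^ 2) (2 * t) t := by
      simpa using (hasDerivAt_id' t).fun_pow 2
    have h2 : HasDerivAt (fun t : ℝ => D (t ^ 2)) (D₁ (t ^ 2) * (2 * t)) t :=
      (hP.deriv₁ (t ^ 2) (by positivity)).comp t h0
    have h3 := h1.fun_div (h0.fun_mul h2) (by positivity)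
    refine h3.congr_deriv ?_
    field_simp
    ring
  -- Along the chosen ray `df(x)` is a constant times `sD`. Writing the constant as `2a` matches `f
  -- = aφ + const`, because `df(x) = 2s f'(s)` for radial `f`.
  set a := linDeriv f 1 ((1 : ℝ) • y) / (1 ^ 2 * D (1 ^ 2)) / 2 with ha
  have hW : ∀ t, 0 < t → linDeriv f 1 (t • y) = 2 * a * (t ^ 2 * D (t ^ 2)) := by
    intro t ht
    have h := eqOn_Ioi_of_hasDerivAt_zero hder ht one_pos
    have hD := hP.pos (t ^ 2)
    rw [div_eq_iff (by positivity)] at h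
    rw [h, ha]; ring
  -- Both sides are exact derivatives, of `s · logDet₁` and of `-a s D`; this gives the first
  -- integration.
  have hF : ∀ s, 0 < s → logDet₁ n D D₁ φ s + s * logDet₂ n D D₁ D₂ φ s
      = -a * (D s + s * D₁ s) := by
    intro s hs
    have h := hray (√s) (Real.sqrt_pos.2 hs)
    rw [hW _ (Real.sqrt_pos.2 hs), Real.sq_sqrt hs.le] at h
    have hD := (hP.pos s).ne'
    field_simp at h
    linarith
  have hG : ∀ s, 0 < s → HasDerivAt (fun s => s * logDet₁ n D D₁ φ s + a * (s * D s)) 0 s := by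
    intro s hs
    have h := ((hasDerivAt_id' s).fun_mul (hP.logDet₁_hasDerivAt hs)).fun_add
      (((hasDerivAt_id' s).fun_mul (hP.deriv₁ s hs)).const_mul a)
    refine h.congr_deriv ?_
    linarith [hF s hs]
  set c := 1 * logDet₁ n D D₁ φ 1 + a * (1 * D 1) with hc
  have hGc : ∀ s, 0 < s → s * logDet₁ n D D₁ φ s + a * (s * D s) = c := fun s hs =>
    eqOn_Ioi_of_hasDerivAt_zero hG hs one_pos
  let Λ : ℝ → ℝ := fun s => (n - 1) * Real.log (φ s / s) + Real.log (D s) + a * φ s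
  have hΛ : ∀ s, 0 < s → HasDerivAt (fun s => Λ s - c * Real.log s) 0 s := by
    intro s hs
    have hφ := hP.moment_pos hs
    have hD := hP.pos s
    have h := (((((hP.moment s).fun_div (hasDerivAt_id' s) hs.ne').log (by positivity)).const_mul
      ((n : ℝ) - 1)).fun_add ((hP.deriv₁ s hs).log hD.ne')).fun_add ((hP.moment s).const_mul a)
    have h2 := h.fun_sub ((Real.hasDerivAt_log hs.ne').const_mul c)
    refine h2.congr_deriv ?_
    rw [← hGc s hs, logDet₁]
    field_simp
    ring
  have hlim : Tendsto Λ (𝓝[>] 0) (𝓝 (n * Real.log (D 0))) := by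
    have h1 : Tendsto (fun s => φ s / s) (𝓝[>] 0) (𝓝 (D 0)) := by
      have h := (hasDerivAt_iff_tendsto_slope_zero.1 (hP.moment 0)).mono_left
        (nhdsWithin_mono 0 (fun s (hs : 0 < s) => hs.ne'))
      refine h.congr fun s => ?_
      simp [hP.moment_zero, div_eq_inv_mul]
    have h2 : Tendsto D (𝓝[>] 0) (𝓝 (D 0)) := (hP.cont.tendsto 0).mono_left nhdsWithin_le_nhds
    have h3 : Tendsto φ (𝓝[>] 0) (𝓝 0) := by
      have := (hP.moment 0).continuousAt.tendsto
      rw [hP.moment_zero] at this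
      exact this.mono_left nhdsWithin_le_nhds
    have h4 := (((h1.log (hP.pos 0).ne').const_mul ((n : ℝ) - 1)).add (h2.log (hP.pos 0).ne')).add
      (h3.const_mul a)
    convert h4 using 2
    ring
  have hk : ∀ s, 0 < s → Λ s - c * Real.log s = Λ 1 - c * Real.log 1 := fun s hs =>
    eqOn_Ioi_of_hasDerivAt_zero hΛ hs one_pos
  -- Since `Λ - c log s` is constant and `Λ` has a finite limit at `0`, smoothness of the metric at
  -- the origin forces `c = 0`.
  have hc0 : c = 0 := by
    by_contra hne
    have h1 : Tendsto (fun s => (Λ s - (Λ 1 - c * Real.log 1)) / c) (𝓝[>] 0)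
        (𝓝 ((n * Real.log (D 0) - (Λ 1 - c * Real.log 1)) / c)) := (hlim.sub_const _).div_const c
    have h2 : Tendsto Real.log (𝓝[>] 0)
        (𝓝 ((n * Real.log (D 0) - (Λ 1 - c * Real.log 1)) / c)) := by
      refine h1.congr' ?_
      filter_upwards [self_mem_nhdsWithin] with s hs
      rw [← hk s hs]
      field_simp
      ring
    exact not_tendsto_nhds_of_tendsto_atBot Real.tendsto_log_nhdsGT_zero _ h2
  refine ⟨a, fun s hs => ?_, fun s hs => ?_⟩
  · have h := hGc s hs
    rw [hc0] at h
    have : s * (logDet₁ n D D₁ φ s + a * D s) = 0 := by linarith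
    rcases mul_eq_zero.1 this with h' | h'
    · exact absurd h' hs.ne'
    · linarith
  · have h1 : Tendsto Λ (𝓝[>] 0) (𝓝 (Λ 1)) := by
      refine tendsto_const_nhds.congr' ?_
      filter_upwards [self_mem_nhdsWithin] with t ht
      have := hk t ht
      rw [hc0] at this; linarith
    have h2 := tendsto_nhds_unique h1 hlim
    have := hk s hs
    rw [hc0] at this
    rw [← h2]
    show Λ s = Λ 1
    linarith

end HasProfile

end

end RMetric

namespace RMetric

noncomputable section

open Filter ComplexConjugate

/-! ### Asymptotics of the profile -/

/-- L'Hôpital's rule for quotients with denominator tending to infinity. -/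
theorem tendsto_div_of_tendsto_deriv_div {f g f' g' : ℝ → ℝ} {L : ℝ}
    (hf : ∀ᶠ s in atTop, HasDerivAt f (f' s) s) (hg : ∀ᶠ s in atTop, HasDerivAt g (g' s) s)
    (hg' : ∀ᶠ s in atTop, 0 < g' s) (hgt : Tendsto g atTop atTop)
    (h : Tendsto (fun s => f' s / g' s) atTop (𝓝 L)) :
    Tendsto (fun s => f s / g s) atTop (𝓝 L) := by
  rw [Metric.tendsto_nhds]
  intro ε hε
  have h1 := (Metric.tendsto_nhds.1 h) (ε / 2) (half_pos hε)
  obtain ⟨s₀, hs₀⟩ := eventually_atTop.1 (hf.and (hg.and (hg'.and h1)))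
  have hb : ∀ s, s₀ ≤ s → |f' s - L * g' s| ≤ ε / 2 * g' s := by
    intro s hs
    obtain ⟨-, -, h3, h4⟩ := hs₀ s hs
    have : f' s - L * g' s = (f' s / g' s - L) * g' s := by field_simp
    rw [this, abs_mul, abs_of_pos h3]
    exact mul_le_mul_of_nonneg_right (Real.dist_eq _ _ ▸ h4.le) h3.le
  -- Both functions `(ε/2) g ± (f - Lg)` are eventually nondecreasing, hence bounded below; dividing
  -- by `g → ∞` absorbs the constants. No limit of `f` is required.
  have hmono : ∀ σ : ℝ, |σ| = 1 →
      MonotoneOn (fun s => ε / 2 * g s + σ * (f s - L * g s)) (Set.Ici s₀) := by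
    intro σ hσ
    have hd : ∀ s, s₀ ≤ s → HasDerivAt (fun s => ε / 2 * g s + σ * (f s - L * g s))
        (ε / 2 * g' s + σ * (f' s - L * g' s)) s := fun s hs =>
      ((hs₀ s hs).2.1.const_mul _).fun_add
        (((hs₀ s hs).1.fun_sub ((hs₀ s hs).2.1.const_mul L)).const_mul σ)
    refine monotoneOn_of_deriv_nonneg (convex_Ici s₀)
      (fun s hs => (hd s hs).continuousAt.continuousWithinAt)
      (fun s hs => (hd s (interior_subset hs)).differentiableAt.differentiableWithinAt)
      fun s hs => ?_
    rw [(hd s (interior_subset hs)).deriv]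
    have h2 := hb s (interior_subset hs)
    have h3 : |σ * (f' s - L * g' s)| ≤ ε / 2 * g' s := by rw [abs_mul, hσ, one_mul]; exact h2
    linarith [neg_abs_le (σ * (f' s - L * g' s))]
  set C := |ε / 2 * g s₀ + 1 * (f s₀ - L * g s₀)| + |ε / 2 * g s₀ + (-1) * (f s₀ - L * g s₀)| with hC
  filter_upwards [eventually_ge_atTop s₀, hgt.eventually_gt_atTop (2 * C / ε + 1)] with s hs hgs
  have hC0 : 0 ≤ C := by positivity
  have hg0 : 0 < g s := lt_of_le_of_lt (by positivity) hgs
  have m1 := hmono 1 (by simp) (Set.mem_Ici.2 le_rfl) (Set.mem_Ici.2 hs) hs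
  have m2 := hmono (-1) (by simp) (Set.mem_Ici.2 le_rfl) (Set.mem_Ici.2 hs) hs
  simp only at m1 m2
  have k1 := neg_abs_le (ε / 2 * g s₀ + 1 * (f s₀ - L * g s₀))
  have k2 := neg_abs_le (ε / 2 * g s₀ + (-1) * (f s₀ - L * g s₀))
  have k3 := abs_nonneg (ε / 2 * g s₀ + 1 * (f s₀ - L * g s₀))
  have k4 := abs_nonneg (ε / 2 * g s₀ + (-1) * (f s₀ - L * g s₀))
  have hCg : C < ε / 2 * g s := by
    have : 2 * C / ε < g s := by linarith
    rw [div_lt_iff₀ hε] at this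
    linarith
  have : f s / g s - L = (f s - L * g s) / g s := by field_simp
  rw [Real.dist_eq, this, abs_div, abs_of_pos hg0, div_lt_iff₀ hg0, abs_lt]
  constructor <;> linarith

variable {n : ℕ} {g : RMetric n} {D D₁ D₂ φ : ℝ → ℝ}

/-! ### Steady soliton profiles: scalar curvature and the sign of `a` -/

/-- The radial data of a steady soliton: `a` is the constant with `f = a φ`. -/
structure HasSolitonProfile (g : RMetric n) (D D₁ D₂ φ : ℝ → ℝ) (a : ℝ) : Prop
    extends g.HasProfile D D₁ D₂ φ where
  ode : ∀ s, 0 < s → logDet₁ n D D₁ φ s = -a * D s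
  integral : ∀ s, 0 < s →
    (n - 1) * Real.log (φ s / s) + Real.log (D s) + a * φ s = n * Real.log (D 0)
  one_le : (1 : ℝ) ≤ n

namespace HasSolitonProfile

variable {a : ℝ}

lemma ode' (h : g.HasSolitonProfile D D₁ D₂ φ a) {s : ℝ} (hs : 0 < s) :
    s * D₁ s = D s * ((n - 1) - (n - 1) * (s * D s) / φ s - a * (s * D s)) := by
  have h1 := h.ode s hs
  have hφ := (h.moment_pos hs).ne'
  have hD := (h.pos s).ne'
  rw [logDet₁] at h1
  field_simp at h1 ⊢
  linarith

lemma logDet₂_eq (h : g.HasSolitonProfile D D₁ D₂ φ a) {s : ℝ} (hs : 0 < s) :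
    logDet₂ n D D₁ D₂ φ s = -a * D₁ s := by
  have h1 : HasDerivAt (logDet₁ n D D₁ φ) (-a * D₁ s) s :=
    ((h.deriv₁ s hs).const_mul (-a)).congr_of_eventuallyEq
      ((eventually_gt_nhds hs).mono fun t ht => h.ode t ht)
  exact (h.logDet₁_hasDerivAt hs).unique h1

lemma kahlerScal_eq (h : g.HasSolitonProfile D D₁ D₂ φ a) {x : CSpace n} (hx : x ≠ 0) :
    g.kahlerScal x = a * (n - a * (nsq x * D (nsq x))) := by
  have hs := nsq_pos hx
  have hφ := (h.moment_pos hs).ne'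
  have hD := (h.pos (nsq x)).ne'
  rw [h.kahlerScal_formula hx, h.ode _ hs, h.logDet₂_eq hs]
  have h1 := h.ode' hs
  have h2 : (-a * D (nsq x) + nsq x * (-a * D₁ (nsq x)))
      = -a * (D (nsq x) + nsq x * D₁ (nsq x)) := by ring
  rw [h2, h1]
  field_simp
  ring

/-- The radial formulas hold only off the origin; continuity of the scalar curvature along a ray
supplies the value there. -/
lemma kahlerScal_zero (h : g.HasSolitonProfile D D₁ D₂ φ a) {e : CSpace n} (he : nsq e = 1) :
    g.kahlerScal 0 = a * n := by
  have he0 : e ≠ 0 := by rintro rfl; simp [nsq_zero] at he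
  have h1 : Tendsto (fun τ : ℝ => g.kahlerScal (τ • e)) (𝓝[>] 0) (𝓝 (g.kahlerScal 0)) := by
    have hc : Continuous fun τ : ℝ => g.kahlerScal (τ • e) :=
      g.continuous_kahlerScal.comp (by fun_prop)
    have := hc.tendsto 0
    rw [zero_smul] at this
    exact this.mono_left nhdsWithin_le_nhds
  have h2 : Tendsto (fun τ : ℝ => a * (n - a * (τ ^ 2 * D (τ ^ 2)))) (𝓝[>] 0) (𝓝 (a * n)) := by
    have hD := h.cont
    have hc : Continuous fun τ : ℝ => a * (n - a * (τ ^ 2 * D (τ ^ 2))) := by fun_prop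
    have := hc.tendsto 0
    simp only [ne_eq, OfNat.ofNat_ne_zero, not_false_eq_true, zero_pow, zero_mul, mul_zero,
      sub_zero] at this
    exact this.mono_left nhdsWithin_le_nhds
  refine tendsto_nhds_unique h1 (h2.congr' ?_)
  filter_upwards [self_mem_nhdsWithin] with τ hτ
  rw [h.kahlerScal_eq (smul_ne_zero (ne_of_gt hτ) he0), nsq_rsmul, he, mul_one]

/-- The exponential form of the integrated soliton equation. -/
lemma integral_exp (h : g.HasSolitonProfile D D₁ D₂ φ a) {s : ℝ} (hs : 0 < s) :
    φ s ^ (n - 1) * D s * Real.exp (a * φ s) = D 0 ^ n * s ^ (n - 1) := by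
  have hφ := h.moment_pos hs
  have hD := h.pos s
  have hD0 := h.pos 0
  have hn : 1 ≤ n := by exact_mod_cast h.one_le
  have h1 := congrArg Real.exp (h.integral s hs)
  have e1 : ((n : ℝ) - 1) = ((n - 1 : ℕ) : ℝ) := by push_cast [hn]; ring
  rw [Real.exp_add, Real.exp_add, Real.exp_log hD, e1, ← Real.log_pow, Real.exp_log (by positivity),
    ← Real.log_pow, Real.exp_log (by positivity), div_pow] at h1
  field_simp at h1
  linarith

/-- If `a = -2b < 0`, the integrated equation gives `D ≥ const · exp(2bφ)/φ^(n-1)`, too fast a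
growth for a solution on all of `[1,∞)`: the positive function `exp(-bφ)` would decrease at a rate
bounded away from zero. -/
lemma nonneg (h : g.HasSolitonProfile D D₁ D₂ φ a) : 0 ≤ a := by
  by_contra hneg
  push Not at hneg
  -- Half of the exponent serves to absorb the power `φ^(n-1)`, the other half gives the rate `c`.
  set b := -a / 2 with hb
  have hb0 : 0 < b := by rw [hb]; linarith
  set m := n - 1
  set c := b * (D 0 ^ n * b ^ m / m.factorial) with hc
  have hc0 : 0 < c := by have := h.pos 0; positivity
  have hd : ∀ s, HasDerivAt (fun s => Real.exp (-b * φ s) + c * s)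
      (Real.exp (-b * φ s) * (-b * D s) + c * 1) s := fun s =>
    (((h.moment s).const_mul (-b)).exp).fun_add ((hasDerivAt_id' s).const_mul c)
  have hmono : AntitoneOn (fun s => Real.exp (-b * φ s) + c * s) (Set.Ici 1) := by
    refine antitoneOn_of_deriv_nonpos (convex_Ici 1)
      (fun s _ => (hd s).continuousAt.continuousWithinAt)
      (fun s _ => (hd s).differentiableAt.differentiableWithinAt) fun s hs => ?_
    rw [(hd s).deriv]
    have hs1 : 1 ≤ s := interior_subset hs
    have hs0 : 0 < s := by linarith
    have hφ := h.moment_pos hs0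
    have hD := h.pos s
    have k1 := Real.pow_div_factorial_le_exp (b * φ s) (by positivity) m
    rw [div_le_iff₀ (by positivity), mul_pow] at k1
    have k2 := h.integral_exp hs0
    have k3 : D 0 ^ n ≤ φ s ^ m * D s * Real.exp (a * φ s) := by
      rw [k2]
      have := h.pos 0
      exact le_mul_of_one_le_right (by positivity) (one_le_pow₀ hs1)
    have k4 : Real.exp (a * φ s) = Real.exp (-b * φ s) * Real.exp (-b * φ s) := by
      rw [← Real.exp_add]; congr 1; rw [hb]; ring
    have k5 : Real.exp (b * φ s) * Real.exp (-b * φ s) = 1 := by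
      rw [← Real.exp_add]; simp
    have k6 : D 0 ^ n * b ^ m ≤ m.factorial * (D s * Real.exp (-b * φ s)) := by
      calc D 0 ^ n * b ^ m ≤ φ s ^ m * D s * Real.exp (a * φ s) * b ^ m := by gcongr
        _ = (b ^ m * φ s ^ m) * (D s * (Real.exp (-b * φ s) * Real.exp (-b * φ s))) := by
          rw [k4]; ring
        _ ≤ (Real.exp (b * φ s) * m.factorial)
            * (D s * (Real.exp (-b * φ s) * Real.exp (-b * φ s))) := by gcongr
        _ = m.factorial * (D s * Real.exp (-b * φ s))
            * (Real.exp (b * φ s) * Real.exp (-b * φ s)) := by ring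
        _ = _ := by rw [k5, mul_one]
    have k7 : D 0 ^ n * b ^ m / m.factorial ≤ D s * Real.exp (-b * φ s) := by
      rw [div_le_iff₀ (by positivity)]; linarith
    have := mul_le_mul_of_nonneg_left k7 hb0.le
    rw [← hc] at this
    linarith
  set S := 1 + Real.exp (-b * φ 1) / c with hS
  have hS1 : 1 ≤ S := by rw [hS]; have : 0 ≤ Real.exp (-b * φ 1) / c := by positivity
                         linarith
  have := hmono (Set.mem_Ici.2 le_rfl) (Set.mem_Ici.2 hS1) hS1
  simp only at this
  have e1 : c * S = c + Real.exp (-b * φ 1) := by rw [hS]; field_simp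
  rw [e1] at this
  linarith [Real.exp_pos (-b * φ S)]

/-- With `a = 0` the integrated equation reads `(φ^n)' = ((D(0) s)^n)'`. Thus `φ = D(0) s`, and the
metric is a constant multiple of the Euclidean one. -/
lemma isFlat_of_eq_zero (h : g.HasSolitonProfile D D₁ D₂ φ 0) {e : CSpace n} (he : nsq e = 1) :
    g.IsFlat := by
  have hn : n ≠ 0 := by
    have := h.one_le
    rintro rfl
    norm_num at this
  have he0 : e ≠ 0 := by rintro rfl; simp [nsq_zero] at he
  have hφ : ∀ s, 0 < s → φ s = D 0 * s := by
    intro s hs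
    have hφc : Continuous φ := continuous_iff_continuousAt.2 fun s => (h.moment s).continuousAt
    have h1 := eq_of_hasDerivAt_zero (f := fun s => φ s ^ n - (D 0 * s) ^ n) hs
      (by fun_prop) (fun t ht => by
        have := ((h.moment t).fun_pow n).fun_sub (((hasDerivAt_id' t).const_mul (D 0)).fun_pow n)
        refine this.congr_deriv ?_
        have k := h.integral_exp ht.1
        rw [zero_mul, Real.exp_zero, mul_one] at k
        rw [mul_pow, ← mul_pow_sub_one hn (D 0)] at *
        linear_combination (n : ℝ) * k)
    simp only [h.moment_zero, mul_zero, sub_self] at h1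
    have hD := h.pos 0
    exact (pow_left_inj₀ (h.moment_pos hs).le (by positivity) hn).1 (sub_eq_zero.1 h1.symm)
  have hD : ∀ s, 0 < s → D s = D 0 := fun s hs => by
    have h1 : HasDerivAt φ (D 0 * 1) s := ((hasDerivAt_id' s).const_mul (D 0)).congr_of_eventuallyEq
      ((eventually_gt_nhds hs).mono fun t ht => hφ t ht)
    rw [(h.moment s).unique h1, mul_one]
  have hval : ∀ x, x ≠ 0 → ∀ u v, g.val x u v = D 0 * (herm u v).re := fun x hx u v => by
    have hs := nsq_pos hx
    rw [h.formula x hx, hD _ hs, hφ _ hs]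
    field_simp
    ring
  have hval0 : ∀ u v, g.val 0 u v = D 0 * (herm u v).re := fun u v => by
    have h1 : Tendsto (fun τ : ℝ => g.val (τ • e) u v) (𝓝[>] 0) (𝓝 (g.val 0 u v)) := by
      have hc : Continuous fun τ : ℝ => g.val (τ • e) u v :=
        g.continuous_val_apply.comp (f := fun τ : ℝ => (τ • e, u, v)) (by fun_prop)
      have := hc.tendsto 0
      rw [zero_smul] at this
      exact this.mono_left nhdsWithin_le_nhds
    refine tendsto_nhds_unique h1 (tendsto_const_nhds.congr' ?_)
    filter_upwards [self_mem_nhdsWithin] with τ hτ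
    rw [hval _ (smul_ne_zero (ne_of_gt hτ) he0)]
  have hconst : ∀ x u v, g.val x u v = D 0 * (herm u v).re := fun x u v => by
    rcases eq_or_ne x 0 with rfl | hx
    · exact hval0 u v
    · exact hval x hx u v
  have hfd : ∀ x u v w, fderiv ℝ g.val x u v w = 0 := fun x u v w => by
    refine (g.val_line_hasDerivAt x u v w).unique ?_
    simp only [hconst]
    exact hasDerivAt_const _ _
  have hc : ∀ x u v, g.christoffel x u v = 0 := fun x u v =>
    g.christoffel_eq fun w => by rw [koszul_apply]; simp [hfd]
  intro x u v w
  simp [curv, hc]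

end HasSolitonProfile

end

end RMetric

namespace RMetric

noncomputable section

open Filter ComplexConjugate

variable {n : ℕ} {g : RMetric n} {D D₁ D₂ φ : ℝ → ℝ} {a : ℝ}

/-! ### Growth of the moment map and decay of the curvature -/

namespace HasSolitonProfile

/-- The factor `s^(n-1)/D` integrates the linear equation satisfied by `n - a s D`. The sign of this
derivative gives `R > 0`, and its exact form feeds L'Hôpital's rule. -/
lemma ratio_hasDerivAt (h : g.HasSolitonProfile D D₁ D₂ φ a) {s : ℝ} (hs : 0 < s) :
    HasDerivAt (fun s => s ^ (n - 1) * (n - a * (s * D s)) / D s)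
      (n * (n - 1) * s ^ (n - 1) / φ s) s := by
  have hφ := (h.moment_pos hs).ne'
  have hD := (h.pos s).ne'
  have hn : 1 ≤ n := by exact_mod_cast h.one_le
  have h1 := (((hasDerivAt_id' s).fun_pow (n - 1)).fun_mul
    ((((hasDerivAt_id' s).fun_mul (h.deriv₁ s hs)).const_mul a).const_sub (n : ℝ))).fun_div
      (h.deriv₁ s hs) hD
  refine h1.congr_deriv ?_
  have e1 : ((n - 1 : ℕ) : ℝ) * s ^ (n - 1 - 1) = (n - 1) * s ^ (n - 1) / s := by
    rcases Nat.exists_eq_add_of_le hn with ⟨m, hm⟩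
    have hm' : n - 1 = m := by omega
    have hm2 : (n : ℝ) - 1 = m := by rw [hm]; push_cast; ring
    rw [hm', hm2]
    rcases m with _ | m
    · simp
    · rw [Nat.add_sub_cancel, pow_succ]; field_simp
  have e2 : D₁ s = D s * ((n - 1) - (n - 1) * (s * D s) / φ s - a * (s * D s)) / s := by
    rw [← h.ode' hs]; field_simp
  rw [e1, e2]
  field_simp
  ring

/-- The scalar curvature is positive. -/
lemma scal_pos (h : g.HasSolitonProfile D D₁ D₂ φ a) {s : ℝ} (hs : 0 < s) :
    0 < n - a * (s * D s) := by
  have hn : (0 : ℝ) < n := by linarith [h.one_le]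
  have hmono : MonotoneOn (fun s => s ^ (n - 1) * (n - a * (s * D s)) / D s) (Set.Ioi 0) := by
    refine monotoneOn_of_deriv_nonneg (convex_Ioi 0)
      (fun s hs => (h.ratio_hasDerivAt hs).continuousAt.continuousWithinAt)
      (fun s hs => (h.ratio_hasDerivAt
        (interior_subset hs)).differentiableAt.differentiableWithinAt) fun s hs => ?_
    have hs : 0 < s := interior_subset hs
    rw [(h.ratio_hasDerivAt hs).deriv]
    have := h.moment_pos hs
    have h1 : (0 : ℝ) ≤ n - 1 := by linarith [h.one_le]
    positivity
  have hlim : Tendsto (fun s => n - a * (s * D s)) (𝓝 0) (𝓝 n) := by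
    have hD := h.cont
    have hc : Continuous fun s => n - a * (s * D s) := by fun_prop
    simpa using hc.tendsto 0
  have hev : ∀ᶠ t in 𝓝[>] (0 : ℝ), t < s ∧ 0 < t ∧ 0 < n - a * (t * D t) := by
    filter_upwards [self_mem_nhdsWithin, (hlim.eventually_const_lt hn).filter_mono nhdsWithin_le_nhds,
      (eventually_lt_nhds hs).filter_mono nhdsWithin_le_nhds] with t h1 h2 h3
    exact ⟨h3, h1, h2⟩
  obtain ⟨t, hts, ht, hpos⟩ := hev.exists
  have h1 := hmono (Set.mem_Ioi.2 ht) (Set.mem_Ioi.2 hs) hts.le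
  have hDt := h.pos t
  have hDs := h.pos s
  have h2 : 0 < s ^ (n - 1) * (n - a * (s * D s)) / D s := lt_of_lt_of_le (by positivity) h1
  have h3 : n - a * (s * D s)
      = s ^ (n - 1) * (n - a * (s * D s)) / D s * (D s / s ^ (n - 1)) := by field_simp
  rw [h3]
  positivity

lemma psi_lt (h : g.HasSolitonProfile D D₁ D₂ φ a) (ha : 0 < a)
    {s : ℝ} (hs : 0 < s) : s * D s < n / a := by
  rw [lt_div_iff₀ ha]
  linarith [h.scal_pos hs]

lemma moment_strictMono (h : g.HasSolitonProfile D D₁ D₂ φ a) : StrictMono φ :=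
  strictMono_of_deriv_pos fun s => by rw [(h.moment s).deriv]; exact h.pos s

/-- By the integrated equation, `n log s = (n-1) log φ + log(sD) + aφ - n log D(0)`, and `sD < n/a`;
so a bounded `φ` would bound `log s`. -/
lemma moment_tendsto (h : g.HasSolitonProfile D D₁ D₂ φ a) (ha : 0 < a) : Tendsto φ atTop atTop := by
  refine tendsto_atTop_atTop_of_monotone h.moment_strictMono.monotone fun M => ?_
  by_contra hM
  push Not at hM
  have hn : (0 : ℝ) < n := by linarith [h.one_le]
  have hn1 : (0 : ℝ) ≤ n - 1 := by linarith [h.one_le]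
  have hb : ∀ s, 0 < s → n * Real.log s
      ≤ Real.log (n / a) - n * Real.log (D 0) + a * M + (n - 1) * Real.log M := by
    intro s hs
    have hφ := h.moment_pos hs
    have hD := h.pos s
    have h1 := h.integral s hs
    rw [Real.log_div hφ.ne' hs.ne'] at h1
    have h2 : Real.log (s * D s) ≤ Real.log (n / a) :=
      Real.log_le_log (by positivity) (h.psi_lt ha hs).le
    rw [Real.log_mul hs.ne' hD.ne'] at h2
    have h3 : Real.log (φ s) ≤ Real.log M := Real.log_le_log hφ (hM s).le
    nlinarith [mul_le_mul_of_nonneg_left h3 hn1, mul_le_mul_of_nonneg_left (hM s).le ha.le]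
  have ht : Tendsto (fun s => n * Real.log s) atTop atTop :=
    Real.tendsto_log_atTop.const_mul_atTop hn
  obtain ⟨s, hs1, hs2⟩ := ((eventually_gt_atTop 0).and (ht.eventually_gt_atTop _)).exists
  exact absurd (hb s hs1) (not_le.2 hs2)

lemma psi_div_tendsto (h : g.HasSolitonProfile D D₁ D₂ φ a) (ha : 0 < a) :
    Tendsto (fun s => s * D s / φ s) atTop (𝓝 0) := by
  have h1 : Tendsto (fun s => n / a / φ s) atTop (𝓝 0) := (h.moment_tendsto ha).const_div_atTop _
  refine tendsto_of_tendsto_of_tendsto_of_le_of_le' tendsto_const_nhds h1 ?_ ?_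
  · filter_upwards [eventually_gt_atTop 0] with s hs
    have := h.moment_pos hs
    have := h.pos s
    positivity
  · filter_upwards [eventually_gt_atTop 0] with s hs
    have := h.moment_pos hs
    have := h.psi_lt ha hs
    gcongr

/-- Since `D < (n/a)/s`, also `φ' → 0` and `φ/s → 0`. This makes the denominator `s^n/φ` in the next
limit tend to infinity. -/
lemma div_moment_tendsto (h : g.HasSolitonProfile D D₁ D₂ φ a) (ha : 0 < a) :
    Tendsto (fun s => s / φ s) atTop atTop := by
  have h0 : Tendsto D atTop (𝓝 0) := by
    have h1 : Tendsto (fun s : ℝ => n / a / s) atTop (𝓝 0) := tendsto_id.const_div_atTop _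
    refine tendsto_of_tendsto_of_tendsto_of_le_of_le' tendsto_const_nhds h1
      (Eventually.of_forall fun s => (h.pos s).le) ?_
    filter_upwards [eventually_gt_atTop 0] with s hs
    rw [le_div_iff₀ hs]
    linarith [h.psi_lt ha hs]
  have h1 : Tendsto (fun s => φ s / s) atTop (𝓝 0) :=
    tendsto_div_of_tendsto_deriv_div (g' := fun _ => 1) (Eventually.of_forall h.moment)
      (Eventually.of_forall fun s => hasDerivAt_id' s) (by simp) tendsto_id (by simpa using h0)
  have h2 : Tendsto (fun s => φ s / s) atTop (𝓝[>] 0) := by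
    refine tendsto_nhdsWithin_iff.2 ⟨h1, ?_⟩
    filter_upwards [eventually_gt_atTop 0] with s hs
    have := h.moment_pos hs
    exact div_pos this hs
  refine h2.inv_tendsto_nhdsGT_zero.congr fun s => ?_
  simp

/-- The scalar curvature decays like the inverse of the moment map. -/
lemma scal_mul_moment_tendsto (h : g.HasSolitonProfile D D₁ D₂ φ a) (ha : 0 < a) :
    Tendsto (fun s => (n - a * (s * D s)) * φ s / (s * D s)) atTop (𝓝 (n - 1)) := by
  have hn : (0 : ℝ) < n := by linarith [h.one_le]
  have hn1 : 1 ≤ n := by exact_mod_cast h.one_le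
  have hψ := h.psi_div_tendsto ha
  have hg : ∀ᶠ s in atTop, HasDerivAt (fun s => s ^ n / φ s)
      (s ^ (n - 1) / φ s * (n - s * D s / φ s)) s := by
    filter_upwards [eventually_gt_atTop 0] with s hs
    have hφ := (h.moment_pos hs).ne'
    refine (((hasDerivAt_id' s).fun_pow n).fun_div (h.moment s) hφ).congr_deriv ?_
    rw [← pow_sub_one_mul (by omega : n ≠ 0) s]
    field_simp
  have hg' : ∀ᶠ s in atTop, 0 < s ^ (n - 1) / φ s * (n - s * D s / φ s) := by
    filter_upwards [eventually_gt_atTop 0, hψ.eventually_lt_const hn] with s hs h1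
    have := h.moment_pos hs
    have : 0 < n - s * D s / φ s := by linarith
    positivity
  have hgt : Tendsto (fun s => s ^ n / φ s) atTop atTop := by
    refine tendsto_atTop_mono' _ ?_ (h.div_moment_tendsto ha)
    filter_upwards [eventually_ge_atTop 1] with s hs
    have := h.moment_pos (by linarith : 0 < s)
    gcongr
    exact le_self_pow₀ hs (by omega)
  have hlim : Tendsto (fun s => (n * (n - 1) * s ^ (n - 1) / φ s)
      / (s ^ (n - 1) / φ s * (n - s * D s / φ s))) atTop (𝓝 ((n - 1 : ℝ))) := by
    have h1 : Tendsto (fun s => (n * (n - 1) : ℝ) / (n - s * D s / φ s)) atTop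
        (𝓝 (n * (n - 1) / (n - 0))) := tendsto_const_nhds.div (hψ.const_sub (n : ℝ)) (by simpa using hn.ne')
    have e : (n * (n - 1) / (n - 0) : ℝ) = n - 1 := by
      rw [sub_zero, mul_div_cancel_left₀ _ hn.ne']
    rw [e] at h1
    refine h1.congr' ?_
    filter_upwards [eventually_gt_atTop 0, hg'] with s hs h2
    have hφ := (h.moment_pos hs)
    have h3 : (n - s * D s / φ s) ≠ 0 := fun h0 => by rw [h0] at h2; simp at h2
    field_simp
  -- The quotient is that of `s^(n-1)(n - a s D)/D` by `s^n/φ`. The ratio of the derivatives is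
  -- `n(n-1)/(n - sD/φ)`, with limit `n-1` because `sD/φ → 0`.
  have hfin := tendsto_div_of_tendsto_deriv_div
    ((eventually_gt_atTop 0).mono fun s hs => h.ratio_hasDerivAt hs) hg hg' hgt hlim
  refine hfin.congr' ?_
  filter_upwards [eventually_gt_atTop 0] with s hs
  have hφ := (h.moment_pos hs).ne'
  have hD := (h.pos s).ne'
  rw [← pow_sub_one_mul (by omega : n ≠ 0) s]
  field_simp

lemma scal_tendsto (h : g.HasSolitonProfile D D₁ D₂ φ a) (ha : 0 < a) :
    Tendsto (fun s => n - a * (s * D s)) atTop (𝓝 0) := by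
  have h1 := (h.scal_mul_moment_tendsto ha).mul (h.psi_div_tendsto ha)
  rw [mul_zero] at h1
  refine h1.congr' ?_
  filter_upwards [eventually_gt_atTop 0] with s hs
  have hφ := (h.moment_pos hs).ne'
  have hD := (h.pos s).ne'
  field_simp

lemma psi_tendsto (h : g.HasSolitonProfile D D₁ D₂ φ a) (ha : 0 < a) :
    Tendsto (fun s => s * D s) atTop (𝓝 (n / a)) := by
  have h1 := ((h.scal_tendsto ha).const_sub (n : ℝ)).div_const a
  rw [sub_zero] at h1
  refine h1.congr fun s => ?_
  field_simp
  ring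

lemma moment_div_log_tendsto (h : g.HasSolitonProfile D D₁ D₂ φ a) (ha : 0 < a) :
    Tendsto (fun s => φ s / Real.log s) atTop (𝓝 (n / a)) := by
  refine tendsto_div_of_tendsto_deriv_div (g' := fun s => s⁻¹) (Eventually.of_forall h.moment)
    ((eventually_gt_atTop 0).mono fun s hs => Real.hasDerivAt_log (ne_of_gt hs))
    ((eventually_gt_atTop 0).mono fun s hs => inv_pos.2 hs) Real.tendsto_log_atTop ?_
  refine (h.psi_tendsto ha).congr fun s => ?_
  rw [div_inv_eq_mul, mul_comm]

set_option maxHeartbeats 600000 in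
/-- The curvature decays at least like the inverse of the moment map. -/
lemma curvBound_le (h : g.HasSolitonProfile D D₁ D₂ φ a) (ha : 0 < a) :
    ∃ C : ℝ, 0 < C ∧ ∃ s₀ : ℝ, 0 < s₀ ∧ ∀ s, s₀ ≤ s → curvBound D D₁ D₂ φ s ≤ C / φ s := by
  have hn : (0 : ℝ) < n := by linarith [h.one_le]
  have hn1 : (0 : ℝ) ≤ n - 1 := by linarith [h.one_le]
  have hev := (((h.psi_div_tendsto ha).eventually_lt_const one_pos).and
    (((h.moment_tendsto ha).eventually_ge_atTop 1).and
    ((h.scal_mul_moment_tendsto ha).eventually_lt_const (show (n : ℝ) - 1 < n by linarith))))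
  obtain ⟨s₀, hs₀⟩ := eventually_atTop.1 hev
  -- The four summands bound the four summands of `curvBound`; see `b1` to `b4`.
  refine ⟨2 + 4 * n + 4 * n + (2 * n * n + (n - 1) * (2 * n + 1) * (n / a)), by positivity,
    max s₀ 1, by positivity, fun s hs => ?_⟩
  have hs0 : 0 < s := by linarith [le_max_right s₀ 1]
  obtain ⟨h1, h2, h3⟩ := hs₀ s ((le_max_left _ _).trans hs)
  have hφ := h.moment_pos hs0
  have hD := h.pos s
  have hψ : 0 < s * D s := by positivity
  have hχ := h.scal_pos hs0
  have hψ2 := h.psi_lt ha hs0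
  have hode := h.ode' hs0
  have hode2 := h.logDet₂_eq hs0
  set χ := n - a * (s * D s) with hχdef
  set y := s * D s / φ s with hy
  have hy0 : 0 < y := by positivity
  have hχn : χ < n := by have : 0 < a * (s * D s) := by positivity
                         linarith
  -- The essential decay: `χ/y` tends to `n-1 < n`, so eventually `χ ≤ n y`, where `y = sD/φ =
  -- O(1/φ)`. All components are then expressed through `χ`, `y` and `φ`.
  have hχy : χ ≤ n * y := by
    have : χ = χ * φ s / (s * D s) * y := by rw [hy]; field_simp
    rw [this]
    exact mul_le_mul_of_nonneg_right h3.le hy0.le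
  have d1 : s * D₁ s / D s = χ - 1 - (n - 1) * y := by
    rw [hode, hy, hχdef]; field_simp; ring
  have t1 : s * coefα D φ s = y - 1 := by
    rw [coefα, hy]; field_simp
  have t2 : s * coefα D φ s + s ^ 2 * coefβ D D₁ φ s = χ - n * y := by
    have : s ^ 2 * coefβ D D₁ φ s = s * D₁ s / D s - 2 * y + 2 := by
      rw [coefβ, hy]; field_simp
    rw [this, d1, t1]; ring
  have t3 : s ^ 2 * coefα₁ D D₁ φ s + s * coefα D φ s = (χ - n * y) * (s * D s) / φ s := by
    have : s ^ 2 * coefα₁ D D₁ φ s + s * coefα D φ s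
        = (s * D s) / φ s * (1 + s * D₁ s / D s) - y ^ 2 := by
      rw [coefα₁, coefα, hy]; field_simp; ring
    rw [this, d1, hy]; field_simp; ring
  have t4 : 2 * s ^ 2 * coefα₁ D D₁ φ s + 2 * s * coefα D φ s + s ^ 3 * coefβ₁ D D₁ D₂ φ s
      + 2 * s ^ 2 * coefβ D D₁ φ s
      = -(s * D s) * (a * (χ - (n - 1) * y) + (n - 1) * ((χ - (n - 1) * y) - y) / φ s) := by
    have e1 : D₂ s / D s - D₁ s ^ 2 / D s ^ 2
        = -a * D₁ s - (n - 1) * (D₁ s / φ s - D s ^ 2 / φ s ^ 2 + 1 / s ^ 2) := by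
      rw [logDet₂] at hode2; linarith
    have e2 : 2 * s ^ 2 * coefα₁ D D₁ φ s + 2 * s * coefα D φ s + s ^ 3 * coefβ₁ D D₁ D₂ φ s
        + 2 * s ^ 2 * coefβ D D₁ φ s
        = s ^ 2 * (D₂ s / D s - D₁ s ^ 2 / D s ^ 2) + s * D₁ s / D s := by
      rw [coefα₁, coefα, coefβ₁, coefβ]; field_simp; ring
    have e3 : s ^ 2 * (-a * D₁ s - (n - 1) * (D₁ s / φ s - D s ^ 2 / φ s ^ 2 + 1 / s ^ 2))
        + s * D₁ s / D s
        = -a * (s * D s) * (s * D₁ s / D s)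
          - (n - 1) * ((s * D s) * (s * D₁ s / D s) / φ s - y ^ 2 + 1) + s * D₁ s / D s := by
      rw [hy]; field_simp
    rw [e2, e1, e3, d1]
    have e4 : y ^ 2 = (s * D s) * y / φ s := by rw [hy]; field_simp
    rw [e4]
    have e5 : s * D s = y * φ s := by rw [hy]; field_simp
    rw [hχdef, e5]
    field_simp
    ring
  rw [curvBound, t2, t3, t4, t1]
  have hyφ : y * φ s ≤ n / a := by rw [hy, div_mul_cancel₀ _ hφ.ne']; exact hψ2.le
  clear t1 t2 t3 t4 d1 hode hode2 h3
  clear_value χ y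
  have hω : |χ - (n - 1) * y| ≤ 2 * n * y := by
    rw [abs_le]; constructor <;> nlinarith
  have hω' : |χ - n * y| ≤ 2 * n := by
    rw [abs_le]; constructor <;> nlinarith
  have b1 : 2 * |y - 1| / φ s ≤ 2 / φ s := by
    gcongr
    have : |y - 1| ≤ 1 := by rw [abs_le]; constructor <;> linarith
    linarith
  have b2 : 2 * |χ - n * y| / φ s ≤ 4 * n / φ s := by
    exact div_le_div_of_nonneg_right (by linarith) hφ.le
  have b3 : 2 * |(χ - n * y) * (s * D s) / φ s| / (s * D s) ≤ 4 * n / φ s := by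
    rw [abs_div, abs_mul, abs_of_pos hψ, abs_of_pos hφ]
    have : 2 * (|χ - n * y| * (s * D s) / φ s) / (s * D s) = 2 * |χ - n * y| / φ s := by
      field_simp
    rw [this]; exact b2
  have b4 : |-(s * D s) * (a * (χ - (n - 1) * y) + (n - 1) * ((χ - (n - 1) * y) - y) / φ s)|
      / (s * D s) ≤ (2 * n * n + (n - 1) * (2 * n + 1) * (n / a)) / φ s := by
    rw [abs_mul, abs_neg, abs_of_pos hψ, mul_div_assoc, mul_comm, div_mul_cancel₀ _ hψ.ne']
    have hayφ : a * (y * φ s) ≤ n := by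
      have := mul_le_mul_of_nonneg_left hyφ ha.le
      rwa [mul_div_cancel₀ _ ha.ne'] at this
    rw [le_div_iff₀ hφ]
    have c1 : |a * (χ - (n - 1) * y) + (n - 1) * ((χ - (n - 1) * y) - y) / φ s|
        ≤ a * (2 * n * y) + (n - 1) * (2 * n * y + y) := by
      refine (abs_add_le _ _).trans (add_le_add ?_ ?_)
      · rw [abs_mul, abs_of_pos ha]; gcongr
      · rw [abs_div, abs_mul, abs_of_nonneg hn1, abs_of_pos hφ]
        refine (div_le_self (by positivity) h2).trans ?_
        gcongr
        exact (abs_sub _ _).trans (by rw [abs_of_pos hy0]; linarith)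
    calc _ ≤ (a * (2 * n * y) + (n - 1) * (2 * n * y + y)) * φ s := by gcongr
      _ = 2 * n * (a * (y * φ s)) + (n - 1) * (2 * n + 1) * (y * φ s) := by ring
      _ ≤ _ := by gcongr
  calc _ ≤ 2 / φ s + 4 * n / φ s + 4 * n / φ s
      + (2 * n * n + (n - 1) * (2 * n + 1) * (n / a)) / φ s := by gcongr
    _ = _ := by ring

end HasSolitonProfile

end

end RMetric

namespace RMetric

noncomputable section

open Filter ComplexConjugate MeasureTheory

variable {n : ℕ}

/-! ### Distances -/

lemma nsq_comp_hasDerivAt {γ : ℝ → CSpace n} {γ' : CSpace n} {t : ℝ} (h : HasDerivAt γ γ' t) :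
    HasDerivAt (fun τ => nsq (γ τ)) (2 * (herm (γ t) γ').re) t := by
  have h1 : HasDerivAt (fun τ => ∑ i, (conj (γ τ i) * γ τ i).re)
      (∑ i, (conj (γ' i) * γ t i + conj (γ t i) * γ' i).re) t := by
    refine HasDerivAt.fun_sum fun i _ => ?_
    have h2 := hasDerivAt_pi.1 h i
    exact hasDerivAt_re ((hasDerivAt_conj h2).mul h2)
  have e1 : (fun τ => nsq (γ τ)) = fun τ => ∑ i, (conj (γ τ i) * γ τ i).re := by
    funext τ
    rw [nsq_eq_sum]
    refine Finset.sum_congr rfl fun i _ => ?_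
    rw [Complex.normSq_apply, Complex.mul_re, Complex.conj_re, Complex.conj_im]
    ring
  rw [e1]
  refine h1.congr_deriv ?_
  rw [herm, Complex.re_sum, Finset.mul_sum]
  refine Finset.sum_congr rfl fun i _ => ?_
  simp only [Complex.add_re, Complex.mul_re, Complex.conj_re, Complex.conj_im]
  ring

lemma continuous_nsq : Continuous (nsq : CSpace n → ℝ) := by
  simp only [funext nsq_eq_sum]
  exact continuous_finsetSum _ fun i _ => Complex.continuous_normSq.comp (continuous_apply i)

lemma norm_sq_le_nsq (x : CSpace n) : ‖x‖ ^ 2 ≤ nsq x := by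
  have h : ‖x‖ ≤ √(nsq x) := by
    refine (pi_norm_le_iff_of_nonneg (Real.sqrt_nonneg _)).2 fun i => Real.le_sqrt_of_sq_le ?_
    rw [← Complex.normSq_eq_norm_sq, nsq_eq_sum]
    exact Finset.single_le_sum (f := fun i => Complex.normSq (x i))
      (fun i _ => Complex.normSq_nonneg _) (Finset.mem_univ i)
  calc ‖x‖ ^ 2 ≤ √(nsq x) ^ 2 := by gcongr
    _ = nsq x := Real.sq_sqrt (nsq_nonneg x)

lemma tendsto_nsq_cocompact : Tendsto (nsq : CSpace n → ℝ) (cocompact (CSpace n)) atTop :=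
  tendsto_atTop_mono norm_sq_le_nsq
    ((tendsto_pow_atTop two_ne_zero).comp tendsto_norm_cocompact_atTop)

variable {g : RMetric n} {D D₁ D₂ φ : ℝ → ℝ}

lemma val_nonneg (x u : CSpace n) : 0 ≤ g.val x u u := by
  by_cases hu : u = 0
  · simp [hu]
  · exact (g.pos x u hu).le

lemma val_sq_le (x u v : CSpace n) : g.val x u v ^ 2 ≤ g.val x u u * g.val x v v := by
  by_cases hu : u = 0
  · simp [hu]
  have h1 := g.pos x u hu
  have h2 := g.val_nonneg x (g.val x u u • v - g.val x u v • u)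
  simp only [map_sub, map_smul, _root_.sub_apply, _root_.smul_apply, smul_eq_mul, g.symm x v u] at h2
  have h3 : 0 ≤ g.val x u u * (g.val x u u * g.val x v v - g.val x u v ^ 2) := by linarith
  exact sub_nonneg.1 (nonneg_of_mul_nonneg_right h3 h1)

/-- The length of the straight segment from the origin to a point `x` with `|x|² = s`. -/
def rayLength (D : ℝ → ℝ) (s : ℝ) : ℝ := ∫ r in (0 : ℝ)..√s, √(D (r ^ 2))

namespace HasProfile

lemma val_smul_self (h : g.HasProfile D D₁ D₂ φ) (x : CSpace n) {τ : ℝ} (hτ : τ ≠ 0) :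
    g.val (τ • x) x x = D (τ ^ 2 * nsq x) * nsq x := by
  have h1 := h.radial (τ • x) x
  rw [map_smul, _root_.smul_apply, smul_eq_mul, nsq_rsmul, herm_rsmul_left, herm_self,
    ← Complex.ofReal_mul, Complex.ofReal_re] at h1
  apply mul_left_cancel₀ hτ
  rw [h1]
  ring

lemma pathLength_ray (h : g.HasProfile D D₁ D₂ φ) (x : CSpace n) :
    g.pathLength (fun τ => τ • x) = ENNReal.ofReal (rayLength D (nsq x)) := by
  have hD := h.cont
  have hd : deriv (fun τ : ℝ => τ • x) = fun _ => x :=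
    funext fun τ => (smul_ray_hasDerivAt x τ).deriv
  have hc : Continuous fun τ : ℝ => √(D ((τ * √(nsq x)) ^ 2)) * √(nsq x) := by fun_prop
  have e1 : rayLength D (nsq x)
      = ∫ τ in (0 : ℝ)..1, √(D ((τ * √(nsq x)) ^ 2)) * √(nsq x) := by
    rw [intervalIntegral.integral_mul_const, mul_comm,
      intervalIntegral.mul_integral_comp_mul_right (f := fun r => √(D (r ^ 2))), rayLength, zero_mul,
      one_mul]
  rw [pathLength, e1, intervalIntegral.integral_of_le zero_le_one, hd,
    ofReal_integral_eq_lintegral_ofReal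
      (hc.integrableOn_Icc.mono_set Set.Ioc_subset_Icc_self)
      (Eventually.of_forall fun τ => by positivity),
    -- The endpoint `τ = 0` is discarded because `val_smul_self` divides by `τ`.
    setLIntegral_congr Ioc_ae_eq_Icc.symm]
  refine setLIntegral_congr_fun measurableSet_Ioc fun τ hτ => ?_
  simp only
  rw [h.val_smul_self x hτ.1.ne', Real.sqrt_mul (h.pos _).le, mul_pow,
    Real.sq_sqrt (nsq_nonneg x)]

lemma eDist_zero_le (h : g.HasProfile D D₁ D₂ φ) (x : CSpace n) :
    g.eDist 0 x ≤ ENNReal.ofReal (rayLength D (nsq x)) := by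
  rw [← h.pathLength_ray x]
  exact iInf_le_of_le (fun τ : ℝ => τ • x) (iInf_le_of_le (by fun_prop)
    (iInf_le_of_le (zero_smul ℝ x) (iInf_le_of_le (one_smul ℝ x) le_rfl)))

lemma rayLength_hasDerivAt (h : g.HasProfile D D₁ D₂ φ) {s : ℝ} (hs : 0 < s) :
    HasDerivAt (rayLength D) (√(D s) / (2 * √s)) s := by
  have hD := h.cont
  have hc : Continuous fun r => √(D (r ^ 2)) := by fun_prop
  have h1 := hc.integral_hasStrictDerivAt 0 (√s)
  have h2 := h1.hasDerivAt.comp s (Real.hasDerivAt_sqrt hs.ne')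
  refine h2.congr_deriv ?_
  rw [Real.sq_sqrt hs.le]
  ring

end HasProfile

namespace HasSolitonProfile

variable {a : ℝ}

/-- The differential of `φ` is `v ↦ 2g(y,v)`; Cauchy–Schwarz for `g` and `g(y,y) = sD ≤ n/a` give
the bound. -/
lemma moment_deriv_sq_le (h : g.HasSolitonProfile D D₁ D₂ φ a) (ha : 0 < a) (y v : CSpace n) :
    (D (nsq y) * (2 * (herm y v).re)) ^ 2 ≤ (2 * √(n / a)) ^ 2 * g.val y v v := by
  have hna : (0 : ℝ) ≤ n / a := by positivity
  rw [mul_pow 2 √(n / a), Real.sq_sqrt hna]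
  by_cases hy : y = 0
  · subst hy
    rw [herm_zero_left]
    have := g.val_nonneg 0 v
    simp only [Complex.zero_re, mul_zero, ne_eq, OfNat.ofNat_ne_zero, not_false_eq_true, zero_pow]
    positivity
  have h1 := g.val_sq_le y y v
  have h2 := g.val_nonneg y v
  have h3 : g.val y y y ≤ n / a := by
    rw [h.radial, herm_self, Complex.ofReal_re, mul_comm]
    exact (h.psi_lt ha (nsq_pos hy)).le
  rw [h.radial] at h1
  calc (D (nsq y) * (2 * (herm y v).re)) ^ 2 = 4 * (D (nsq y) * (herm y v).re) ^ 2 := by ring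
    _ ≤ 4 * (g.val y y y * g.val y v v) := by linarith
    _ ≤ 4 * (n / a * g.val y v v) := by gcongr
    _ = _ := by ring

lemma abs_moment_sub_le (h : g.HasSolitonProfile D D₁ D₂ φ a) (ha : 0 < a) {γ : ℝ → CSpace n}
    (hγ : ContDiff ℝ 1 γ) :
    ENNReal.ofReal |φ (nsq (γ 1)) - φ (nsq (γ 0))|
      ≤ ENNReal.ofReal (2 * √(n / a)) * g.pathLength γ := by
  have hd : ∀ t, HasDerivAt (fun τ => φ (nsq (γ τ)))
      (D (nsq (γ t)) * (2 * (herm (γ t) (deriv γ t)).re)) t := fun t =>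
    (h.moment (nsq (γ t))).comp t
      (nsq_comp_hasDerivAt (hγ.differentiable one_ne_zero t).hasDerivAt)
  have hγc := hγ.continuous
  have hγ'c : Continuous (deriv γ) := hγ.continuous_deriv le_rfl
  have hDc := h.cont
  have hh : Continuous fun t => (herm (γ t) (deriv γ t)).re := by
    simp only [herm]
    refine Complex.continuous_re.comp (continuous_finsetSum _ fun i _ => ?_)
    exact (Complex.continuous_conj.comp ((continuous_apply i).comp hγc)).mul
      ((continuous_apply i).comp hγ'c)
  have hc : Continuous fun t => D (nsq (γ t)) * (2 * (herm (γ t) (deriv γ t)).re) :=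
    (hDc.comp (continuous_nsq.comp hγc)).mul (continuous_const.mul hh)
  have h1 := intervalIntegral.integral_eq_sub_of_hasDerivAt (a := 0) (b := 1) (fun t _ => hd t)
    (hc.intervalIntegrable _ _)
  rw [← h1, intervalIntegral.integral_of_le zero_le_one, ← Real.norm_eq_abs, ofReal_norm]
  refine (enorm_integral_le_lintegral_enorm _).trans ?_
  rw [pathLength, ← lintegral_const_mul' _ _ ENNReal.ofReal_ne_top]
  refine (lintegral_mono_set Set.Ioc_subset_Icc_self).trans (lintegral_mono fun t => ?_)
  rw [← ofReal_norm, Real.norm_eq_abs, ← ENNReal.ofReal_mul (by positivity)]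
  refine ENNReal.ofReal_le_ofReal (abs_le_of_sq_le_sq ?_ (by positivity))
  rw [mul_pow _ (√(g.val _ _ _)), Real.sq_sqrt (g.val_nonneg _ _)]
  exact h.moment_deriv_sq_le ha _ _

/-- The moment map is Lipschitz for the Riemannian distance. -/
lemma abs_moment_sub_le_eDist (h : g.HasSolitonProfile D D₁ D₂ φ a) (ha : 0 < a)
    (p q : CSpace n) :
    ENNReal.ofReal (|φ (nsq q) - φ (nsq p)| / (2 * √(n / a))) ≤ g.eDist p q := by
  have hn : (0 : ℝ) < n := by linarith [h.one_le]
  have hL : 0 < 2 * √(n / a) := by positivity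
  refine le_iInf fun γ => le_iInf fun hγ => le_iInf fun h0 => le_iInf fun h1 => ?_
  rw [ENNReal.ofReal_div_of_pos hL]
  refine ENNReal.div_le_of_le_mul' ?_
  rw [← h0, ← h1]
  exact h.abs_moment_sub_le ha hγ

/-- The ratio of the `s`-derivatives is `√(sD)/2`, which converges by `psi_tendsto`. -/
lemma rayLength_div_log_tendsto (h : g.HasSolitonProfile D D₁ D₂ φ a) (ha : 0 < a) :
    Tendsto (fun s => rayLength D s / Real.log s) atTop (𝓝 (√(n / a) / 2)) := by
  refine tendsto_div_of_tendsto_deriv_div (g' := fun s => s⁻¹)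
    ((eventually_gt_atTop 0).mono fun s hs => h.rayLength_hasDerivAt hs)
    ((eventually_gt_atTop 0).mono fun s hs => Real.hasDerivAt_log (ne_of_gt hs))
    ((eventually_gt_atTop 0).mono fun s hs => inv_pos.2 hs) Real.tendsto_log_atTop ?_
  refine ((h.psi_tendsto ha).sqrt.div_const 2).congr' ?_
  filter_upwards [eventually_gt_atTop 0] with s hs
  have h1 := Real.sqrt_pos.2 hs
  rw [Real.sqrt_mul hs.le]
  field_simp
  rw [Real.sq_sqrt hs.le, mul_comm]

lemma distance_bounds (h : g.HasSolitonProfile D D₁ D₂ φ a) (ha : 0 < a) {x : CSpace n}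
    (hx : x ≠ 0) :
    φ (nsq x) / (2 * √(n / a)) ≤ g.distance 0 x ∧ g.distance 0 x ≤ rayLength D (nsq x) := by
  have h1 := h.eDist_zero_le x
  have h2 := h.abs_moment_sub_le_eDist ha 0 x
  rw [nsq_zero, h.moment_zero, sub_zero, abs_of_pos (h.moment_pos (nsq_pos hx))] at h2
  have h3 : 0 ≤ rayLength D (nsq x) :=
    intervalIntegral.integral_nonneg (Real.sqrt_nonneg _) fun r _ => Real.sqrt_nonneg _
  exact ⟨(ENNReal.ofReal_le_iff_le_toReal (ne_top_of_le_ne_top ENNReal.ofReal_ne_top h1)).1 h2,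
    ENNReal.toReal_le_of_le_ofReal h3 h1⟩

/-- The product of the scalar curvature with the distance to the origin converges. -/
theorem kahlerScal_mul_distance_tendsto (h : g.HasSolitonProfile D D₁ D₂ φ a) (ha : 0 < a) :
    Tendsto (fun x : CSpace n => g.kahlerScal x * g.distance 0 x) (cocompact (CSpace n))
      (𝓝 (√(a * n) * ((n : ℝ) - 1) / 2)) := by
  have hn : (0 : ℝ) < n := by linarith [h.one_le]
  have hL : 0 < √(n / a) := by positivity
  have hLsq : √(n / a) * √(n / a) = n / a := Real.mul_self_sqrt (by positivity)
  have han : √(a * n) = a * √(n / a) := by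
    have : a * n = a ^ 2 * (n / a) := by field_simp
    rw [this, Real.sqrt_mul (by positivity), Real.sqrt_sq ha.le]
  have key := (h.scal_mul_moment_tendsto ha).mul (h.psi_tendsto ha)
  have hlow : Tendsto (fun s => a * (n - a * (s * D s)) * (φ s / (2 * √(n / a)))) atTop
      (𝓝 (√(a * n) * ((n : ℝ) - 1) / 2)) := by
    have h1 := (key.const_mul a).div_const (2 * √(n / a))
    have e : a * ((n - 1) * (n / a)) / (2 * √(n / a)) = √(a * n) * ((n : ℝ) - 1) / 2 := by
      rw [han]
      field_simp
      rw [sq, hLsq]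
      field_simp
    rw [e] at h1
    refine h1.congr' ?_
    filter_upwards [eventually_gt_atTop 0] with s hs
    have := h.pos s
    field_simp
  -- The ray length is compared with `φ` through `log s`, to which both are asymptotically
  -- proportional. The limit agrees with that of the lower bound.
  have hup : Tendsto (fun s => a * (n - a * (s * D s)) * rayLength D s) atTop
      (𝓝 (√(a * n) * ((n : ℝ) - 1) / 2)) := by
    have h1 := ((key.const_mul a).mul (h.rayLength_div_log_tendsto ha)).div
      (h.moment_div_log_tendsto ha) (by positivity)
    have e : a * ((n - 1) * (n / a)) * (√(n / a) / 2) / (n / a) = √(a * n) * ((n : ℝ) - 1) / 2 := by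
      rw [han]; field_simp
    rw [e] at h1
    refine h1.congr' ?_
    filter_upwards [eventually_gt_atTop 1] with s hs
    have := h.pos s
    have h2 := h.moment_pos (by linarith : 0 < s)
    have h3 := Real.log_pos hs
    simp only [Pi.div_apply]
    field_simp
  have hev := (tendsto_nsq_cocompact (n := n)).eventually (eventually_gt_atTop 0)
  have hb : ∀ᶠ x : CSpace n in cocompact (CSpace n),
      a * (n - a * (nsq x * D (nsq x))) * (φ (nsq x) / (2 * √(n / a)))
        ≤ g.kahlerScal x * g.distance 0 x ∧
      g.kahlerScal x * g.distance 0 x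
        ≤ a * (n - a * (nsq x * D (nsq x))) * rayLength D (nsq x) := by
    filter_upwards [hev] with x hx
    have hx0 : x ≠ 0 := by rintro rfl; simp [nsq_zero] at hx
    have h1 := h.distance_bounds ha hx0
    have h2 := h.scal_pos hx
    rw [h.kahlerScal_eq hx0]
    exact ⟨mul_le_mul_of_nonneg_left h1.1 (by positivity),
      mul_le_mul_of_nonneg_left h1.2 (by positivity)⟩
  exact tendsto_of_tendsto_of_tendsto_of_le_of_le' (hlow.comp tendsto_nsq_cocompact)
    (hup.comp tendsto_nsq_cocompact) (hb.mono fun x hx => hx.1) (hb.mono fun x hx => hx.2)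

end HasSolitonProfile

end

end RMetric

namespace RMetric

noncomputable section

open Filter ComplexConjugate MeasureTheory

variable {n : ℕ}

/-! ### Volumes -/

/-- Integration of radial functions in polar coordinates. -/
lemma exists_lintegral_nsq (hn : 0 < n) : ∃ c : ℝ, 0 ≤ c ∧ ∀ f : ℝ → ℝ, (∀ s, 0 ≤ f s) →
    IntegrableOn (fun y => y ^ (2 * n - 1) * f (y ^ 2)) (Set.Ioi 0) →
    ∫⁻ x : CSpace n, ENNReal.ofReal (f (nsq x))
      = ENNReal.ofReal (c * ∫ y in Set.Ioi (0 : ℝ), y ^ (2 * n - 1) * f (y ^ 2)) := by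
  set E := EuclideanSpace ℂ (Fin n)
  have : Nontrivial E := by
    have : Nonempty (Fin n) := ⟨⟨0, hn⟩⟩
    infer_instance
  -- `CSpace n` carries the sup norm, so Lebesgue measure is transported to the Euclidean space,
  -- where `nsq` is the squared norm; the image is a Haar measure, to which polar coordinates apply.
  let T : CSpace n ≃L[ℝ] E := (PiLp.continuousLinearEquiv 2 ℝ (fun _ : Fin n => ℂ)).symm
  have hT : ∀ x, ‖T x‖ ^ 2 = nsq x := fun x => by
    rw [EuclideanSpace.norm_sq_eq, nsq_eq_sum]
    refine Finset.sum_congr rfl fun i _ => ?_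
    rw [Complex.normSq_eq_norm_sq]
    rfl
  let μ : Measure E := Measure.map T volume
  have hμ : μ.IsAddHaarMeasure := T.isAddHaarMeasure_map volume
  have hdim : Module.finrank ℝ E = 2 * n := by
    rw [← T.toLinearEquiv.finrank_eq, Module.finrank_pi_fintype]
    simp [Complex.finrank_real_complex, mul_comm]
  refine ⟨(2 * n : ℕ) * μ.real (Metric.ball 0 1), by positivity, fun f hf hint => ?_⟩
  have h1 : Integrable (fun x : E => f (‖x‖ ^ 2)) μ := by
    refine (integrable_fun_norm_addHaar μ (f := fun y => f (y ^ 2))).2 ?_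
    rw [hdim]
    exact hint
  have h2 := integral_fun_norm_addHaar μ (fun y => f (y ^ 2))
  rw [hdim, nsmul_eq_mul, smul_eq_mul, ← mul_assoc] at h2
  simp only [smul_eq_mul] at h2
  rw [← h2, ofReal_integral_eq_lintegral_ofReal h1 (Eventually.of_forall fun x => hf _)]
  have h3 : MeasurableEmbedding T := T.toHomeomorph.measurableEmbedding
  rw [h3.lintegral_map]
  simp only [hT]

variable {g : RMetric n} {D D₁ D₂ φ : ℝ → ℝ} {a : ℝ}

namespace HasProfile

/-- The volume of the annuli, in terms of the moment map. -/
lemma exists_vol_annulus (h : g.HasProfile D D₁ D₂ φ) (hn : 1 ≤ n) : ∃ c : ℝ, 0 ≤ c ∧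
    ∀ s₁ s₂, 0 < s₁ → s₁ ≤ s₂ →
      g.vol {x | s₁ < nsq x ∧ nsq x < s₂} = ENNReal.ofReal (c * (φ s₂ ^ n - φ s₁ ^ n)) := by
  obtain ⟨c, hc, hcf⟩ := exists_lintegral_nsq hn
  refine ⟨c / (2 * n), by positivity, fun s₁ s₂ h1 h2 => ?_⟩
  have hnpos : (0 : ℝ) < n := by exact_mod_cast hn
  have hDc := h.cont
  have hφc : Continuous φ := continuous_iff_continuousAt.2 fun s => (h.moment s).continuousAt
  have hφ0 : ∀ s, 0 < s → 0 < φ s := fun s hs => h.moment_pos hs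
  set G : ℝ → ℝ := fun s => (φ s / s) ^ (n - 1) * D s
  -- In polar coordinates the powers of `y` cancel: `y^(2n-1) (φ/y²)^(n-1) D = φ^(n-1) D y`, the
  -- derivative of `φ(y²)^n/(2n)`.
  set H : ℝ → ℝ := fun y => φ (y ^ 2) ^ (n - 1) * D (y ^ 2) * y
  have hHc : Continuous H := by fun_prop
  have hS : MeasurableSet {x : CSpace n | s₁ < nsq x ∧ nsq x < s₂} :=
    (isOpen_lt continuous_const continuous_nsq).measurableSet.inter
      (isOpen_lt continuous_nsq continuous_const).measurableSet
  have e1 : g.vol {x | s₁ < nsq x ∧ nsq x < s₂}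
      = ∫⁻ x : CSpace n, ENNReal.ofReal ((Set.Ioo s₁ s₂).indicator G (nsq x)) := by
    rw [vol, withDensity_apply _ hS, ← lintegral_indicator hS]
    refine lintegral_congr fun x => ?_
    by_cases hx : s₁ < nsq x ∧ nsq x < s₂
    · have hx0 : x ≠ 0 := by rintro rfl; rw [nsq_zero] at hx; linarith [hx.1]
      rw [Set.indicator_of_mem (show x ∈ {x : CSpace n | s₁ < nsq x ∧ nsq x < s₂} from hx),
        Set.indicator_of_mem (Set.mem_Ioo.2 hx), h.det_gram hx0]
    · rw [Set.indicator_of_notMem (show x ∉ {x : CSpace n | s₁ < nsq x ∧ nsq x < s₂} from hx),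
        Set.indicator_of_notMem (fun h' => hx (Set.mem_Ioo.1 h')), ENNReal.ofReal_zero]
  have e2 : Set.EqOn (fun y => y ^ (2 * n - 1) * (Set.Ioo s₁ s₂).indicator G (y ^ 2))
      ((Set.Ioo √s₁ √s₂).indicator H) (Set.Ioi 0) := by
    intro y hy
    have hy : 0 < y := hy
    have hiff : y ^ 2 ∈ Set.Ioo s₁ s₂ ↔ y ∈ Set.Ioo √s₁ √s₂ := by
      rw [Set.mem_Ioo, Set.mem_Ioo, Real.sqrt_lt' hy, Real.lt_sqrt hy.le]
    simp only
    by_cases hyS : y ∈ Set.Ioo √s₁ √s₂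
    · rw [Set.indicator_of_mem hyS, Set.indicator_of_mem (hiff.2 hyS)]
      obtain ⟨m, rfl⟩ : ∃ m, n = m + 1 := ⟨n - 1, by omega⟩
      have : 2 * (m + 1) - 1 = 2 * m + 1 := by omega
      simp only [G, H, this, Nat.add_sub_cancel, div_pow, pow_succ y, pow_mul]
      field_simp
    · rw [Set.indicator_of_notMem hyS, Set.indicator_of_notMem (fun h' => hyS (hiff.1 h')),
        mul_zero]
  have hle : √s₁ ≤ √s₂ := Real.sqrt_le_sqrt h2
  have hsub : Set.Ioi (0 : ℝ) ∩ Set.Ioo √s₁ √s₂ = Set.Ioo √s₁ √s₂ :=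
    Set.inter_eq_right.2 fun y hy => lt_of_le_of_lt (Real.sqrt_nonneg _) hy.1
  have hG0 : ∀ s, 0 ≤ (Set.Ioo s₁ s₂).indicator G s := Set.indicator_nonneg fun s hs => by
    have hs0 : 0 < s := h1.trans hs.1
    have := hφ0 s hs0
    have := h.pos s
    positivity
  have hint : IntegrableOn (fun y => y ^ (2 * n - 1) * (Set.Ioo s₁ s₂).indicator G (y ^ 2))
      (Set.Ioi 0) := by
    rw [integrableOn_congr_fun e2 measurableSet_Ioi]
    refine Integrable.integrableOn ((integrable_indicator_iff measurableSet_Ioo).2 ?_)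
    exact hHc.integrableOn_Icc.mono_set Set.Ioo_subset_Icc_self
  have hd : ∀ y, HasDerivAt (fun y => φ (y ^ 2) ^ n / (2 * n)) (H y) y := by
    intro y
    have k1 : HasDerivAt (fun y => φ (y ^ 2)) (D (y ^ 2) * (2 * y)) y := by
      refine ((h.moment (y ^ 2)).comp y (hasDerivAt_pow 2 y)).congr_deriv ?_
      simp
    refine ((k1.fun_pow n).div_const (2 * n)).congr_deriv ?_
    simp only [H]
    field_simp
  rw [e1, hcf _ hG0 hint, setIntegral_congr_fun measurableSet_Ioi e2,
    setIntegral_indicator measurableSet_Ioo, hsub, ← integral_Ioc_eq_integral_Ioo,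
    ← intervalIntegral.integral_of_le hle,
    intervalIntegral.integral_eq_sub_of_hasDerivAt (fun y _ => hd y) (hHc.intervalIntegrable _ _),
    Real.sq_sqrt h1.le, Real.sq_sqrt (h1.le.trans h2)]
  congr 1
  field_simp

end HasProfile

namespace HasSolitonProfile

lemma exists_moment_eq (h : g.HasSolitonProfile D D₁ D₂ φ a) (ha : 0 < a) {M : ℝ} (hM : 0 < M) :
    ∃ s, 0 < s ∧ φ s = M := by
  have hφc : Continuous φ := continuous_iff_continuousAt.2 fun s => (h.moment s).continuousAt
  obtain ⟨b, hb0, hb⟩ := ((eventually_ge_atTop 0).and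
    ((h.moment_tendsto ha).eventually_ge_atTop M)).exists
  obtain ⟨s, hs, hsM⟩ := intermediate_value_Icc hb0 hφc.continuousOn
    (show M ∈ Set.Icc (φ 0) (φ b) from ⟨by rw [h.moment_zero]; exact hM.le, hb⟩)
  refine ⟨s, lt_of_le_of_ne hs.1 ?_, hsM⟩
  rintro rfl
  rw [h.moment_zero] at hsM
  exact hM.ne hsM

theorem isCollapsed (h : g.HasSolitonProfile D D₁ D₂ φ a) (ha : 0 < a) {e : CSpace n}
    (he : nsq e = 1) : g.IsCollapsed := by
  rintro ⟨κ, hκ, hnc⟩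
  have hn : (0 : ℝ) < n := by linarith [h.one_le]
  obtain ⟨C, hC, s₀, hs₀, hcurv⟩ := h.curvBound_le ha
  obtain ⟨c, hc, hvol⟩ := h.exists_vol_annulus (by exact_mod_cast h.one_le)
  set L := 2 * √(n / a) with hL
  have hL0 : 0 < L := by positivity
  set K := (2 * n : ℝ) ^ 2 * (2 * C) with hK
  have hK0 : 0 < K := by positivity
  -- On the region `φ > M/2` the curvature norm is at most `2K/M`, which is exactly `(δ√M)⁻²`.
  set δ := √(1 / (2 * K)) with hδ
  have hδ0 : 0 < δ := by positivity
  have hδsq : δ ^ 2 = 1 / (2 * K) := Real.sq_sqrt (by positivity)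
  have ht : Tendsto (fun M : ℝ => L * δ / √M) atTop (𝓝 0) :=
    Real.tendsto_sqrt_atTop.const_div_atTop _
  have hvt : Tendsto (fun M : ℝ => c * ((1 + L * δ / √M) ^ n - (1 - L * δ / √M) ^ n)) atTop
      (𝓝 0) := by
    have := (((ht.const_add 1).pow n).sub ((ht.const_sub 1).pow n)).const_mul c
    simpa using this
  -- `M ≥ 2φ(s₀)` and `t < 1/2` keep the ball where the curvature bound holds; the last condition
  -- makes the annulus too thin for the constant `κ`.
  obtain ⟨M, ⟨hM0, hMs⟩, hMt, hMv⟩ := (((eventually_gt_atTop 0).and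
    (eventually_ge_atTop (2 * φ s₀))).and ((ht.eventually_lt_const (show (0 : ℝ) < 1 / 2 by
      norm_num)).and (hvt.eventually_lt_const (show 0 < κ * δ ^ (2 * n) by positivity)))).exists
  have hsM : 0 < √M := Real.sqrt_pos.2 hM0
  have hsqM : √M ^ 2 = M := Real.sq_sqrt hM0.le
  set t := L * δ / √M with htdef
  have ht0 : 0 < t := by positivity
  have hw : L * (δ * √M) = t * M := by
    rw [htdef, ← hsqM, Real.sqrt_sq hsM.le]; field_simp
  obtain ⟨s, hs, hφs⟩ := h.exists_moment_eq ha hM0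
  obtain ⟨s₁, hs₁, hφs₁⟩ := h.exists_moment_eq ha (show 0 < M * (1 - t) from
    mul_pos hM0 (by linarith))
  obtain ⟨s₂, hs₂, hφs₂⟩ := h.exists_moment_eq ha (show 0 < M * (1 + t) by positivity)
  have hmono := h.moment_strictMono
  have hnsq : nsq (√s • e) = s := by rw [nsq_rsmul, he, mul_one, Real.sq_sqrt hs.le]
  have hball : ∀ q ∈ g.ball (√s • e) (δ * √M), |φ (nsq q) - M| < t * M := by
    intro q hq
    have h1 := lt_of_le_of_lt (h.abs_moment_sub_le_eDist ha (√s • e) q) hq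
    rw [hnsq, hφs, ENNReal.ofReal_lt_ofReal_iff (by positivity), div_lt_iff₀ hL0] at h1
    linarith
  have hsub : g.ball (√s • e) (δ * √M) ⊆ {x | s₁ < nsq x ∧ nsq x < s₂} := by
    intro q hq
    have h1 := abs_lt.1 (hball q hq)
    refine ⟨hmono.lt_iff_lt.1 ?_, hmono.lt_iff_lt.1 ?_⟩
    · rw [hφs₁]; linarith [h1.1]
    · rw [hφs₂]; linarith [h1.2]
  have hrm : ∀ q ∈ g.ball (√s • e) (δ * √M), g.rmNorm q ≤ ((δ * √M) ^ 2)⁻¹ := by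
    intro q hq
    have h1 := abs_lt.1 (hball q hq)
    have h2 : M / 2 < φ (nsq q) := by nlinarith [h1.1]
    have h3 : s₀ < nsq q := hmono.lt_iff_lt.1 (by linarith)
    have hq0 : q ≠ 0 := by rintro rfl; rw [nsq_zero] at h3; linarith
    calc g.rmNorm q ≤ (2 * n) ^ 2 * (2 * curvBound D D₁ D₂ φ (nsq q)) := h.rmNorm_le_curvBound hq0
      _ ≤ (2 * n) ^ 2 * (2 * (C / φ (nsq q))) := by gcongr; exact hcurv _ h3.le
      _ ≤ (2 * n) ^ 2 * (2 * (C / (M / 2))) := by gcongr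
      _ = ((δ * √M) ^ 2)⁻¹ := by
        rw [mul_pow δ, hδsq, hsqM, hK]; field_simp
  have h1 := (hnc (√s • e) (δ * √M) (by positivity) hrm).trans (measure_mono hsub)
  have hs12 : s₁ ≤ s₂ := (hmono.lt_iff_lt.1 (by rw [hφs₁, hφs₂]; nlinarith)).le
  have hpow : (M * (1 - t)) ^ n ≤ (M * (1 + t)) ^ n :=
    pow_le_pow_left₀ (mul_nonneg hM0.le (by linarith)) (by nlinarith) n
  rw [hvol s₁ s₂ hs₁ hs12, hφs₁, hφs₂, ENNReal.ofReal_le_ofReal_iff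
    (mul_nonneg hc (by linarith)), mul_pow, pow_mul √M, hsqM, mul_pow, mul_pow] at h1
  have h2 := mul_lt_mul_of_pos_right hMv (pow_pos hM0 n)
  nlinarith

end HasSolitonProfile

end

end RMetric

/-! ### The theorem -/

theorem mainTheorem12 (n : ℕ) (g : RMetric n) (hK : g.IsKahler) (hU : g.IsUnitaryInvariant)
    (hS : g.IsSteadyGradientSoliton) (hne : ¬ g.IsFlat) :
    g.IsCollapsed ∧
      Filter.Tendsto (fun x : CSpace n => g.kahlerScal x * g.distance 0 x)
        (Filter.cocompact (CSpace n)) (𝓝 (√(g.kahlerScal 0) * ((n : ℝ) - 1) / 2)) := by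
  rcases n with _ | n
  -- In dimension zero every metric is flat; otherwise a unit vector `e` exists.
  · exact absurd (fun x u v w => Subsingleton.elim _ _) hne
  obtain ⟨e, he⟩ : ∃ e : CSpace (n + 1), RMetric.nsq e = 1 :=
    ⟨Pi.single 0 1, by
      rw [RMetric.nsq_eq_sum, Finset.sum_eq_single 0 (fun i _ hi => by simp [hi]) (by simp)]
      simp⟩
  obtain ⟨D, D₁, D₂, φ, hP⟩ := RMetric.exists_hasProfile hK hU he
  obtain ⟨a, hode, hint⟩ := hP.soliton_ode hS he
  have h : g.HasSolitonProfile D D₁ D₂ φ a := ⟨hP, hode, hint, by simp⟩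
  have ha : 0 < a := h.nonneg.lt_of_ne fun h0 => by
    subst h0
    exact hne (h.isFlat_of_eq_zero he)
  refine ⟨h.isCollapsed ha he, ?_⟩
  rw [h.kahlerScal_zero he]
  exact h.kahlerScal_mul_distance_tendsto ha
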